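/- Let $S$ be a closed connected surface and let $\mathsf G$ be a graph embedded in $S$ with finite nonempty edge set $\mathsf E$ and finite face set $\mathsf F$ (the faces being the connected components of the complement), such that every face is simply connected. Every $e\in\mathsf E$ carries a weight $\theta_e\in(0,\frac{\pi}{2}]$, and $f(e^+),f(e^-)\in\mathsf F$ denote the (possibly equal) faces on the two sides of $e$. For $\theta\in(0,\pi)$ and $(K_1,K_2)\in\mathbb R^2$ consider the bigon in the unit sphere $\mathbb S^2$ which is the intersection of two disks of radii $r_1,r_2\in(0,\frac{\pi}{2})$ with $\log\cot r_i=K_i$ and has interior angle $\theta$. Let side $i$ be the side on the boundary of the $i$-th disk, and let $T_i(K_1,K_2)$ be its total geodesic curvature, i.e. $\cot r_i$ times its length. Put $$\Omega_\theta(K_1,K_2)=\int_0^{(K_1,K_2)}(T_1\,\mathrm dK_1+T_2\,\mathrm dK_2),$$ the integral being taken along the straight segment. A spherical conical metric on $S$ is a metric locally modeled on spherical cones of arbitrary positive cone angles. A circle pattern $\mathcal D$ on $(S,\sigma)$ is a local isometry into $S$ from a finite disjoint union of disks $D$ of radii $<\frac{\pi}{2}$ about the apices of spherical cones, which misses only finitely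 many points, is at most $2$-to-$1$, and for which the images of the disks do not contain each other. Its bigons are the connected components of the set of points with two preimages, and its weighted graph $\mathsf G_{\mathcal D}$ has the missed points as vertices and one edge for each bigon, namely a curve in the bigon joining its two vertices, weighted by the angle of the bigon; the faces of $\mathsf G_{\mathcal D}$ correspond to the disks. Let $\mathcal M$ be the space of pairs $(\sigma,\mathcal D)$ such that $\mathsf G_{\mathcal D}$ is isotopic to $\mathsf G$ with matching weights, up to homeomorphisms isotopic to the identity; $D_f$ denotes the disk corresponding to the face $f$, and $\mathcal M$ is identified with $\mathbb R^{\mathsf F}$ by $(\sigma,\mathcal D)\mapsto(K_f)_{f\in\mathsf F}$, $K_f=\log\cot r(D_f)$, where $r(D_f)$ is the radius of $D_f$. Let $T(\partial D_f)$ be the total geodesic curvature of $\partial D_f$, i.e. $\cot r(D_f)$ times the length of $\partial D_f$. Given $(T_f)_{f\in\mathsf F}$ with all $T_f>0$, the function $$\Omega:\mathbb R^{\mathsf F}\to\mathbb R,\qquad \Omega(K)=\sum_{e\in\mathsf E}\Omega_{\theta_e}(K_{f(e^+)},K_{f(e^-)})-\sum_{f\in\mathsf F}T_fK_f,$$ is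 strictly convex and $C^1$, and the following hold. (i) $K\in\mathbb R^{\mathsf F}$ is a critical point of $\Omega$ if and only if the corresponding $(\sigma,\mathcal D)\in\mathcal M$ satisfies $T(\partial D_f)=T_f$ for all $f\in\mathsf F$. (ii) $\Omega$ is proper, in the sense that $\Omega(K)\to+\infty$ as $K\to\infty$ in $\mathbb R^{\mathsf F}$ (if $|\mathsf F|\ge 2$, equivalently: $\Omega$ is a proper continuous map to $\mathbb R$), if and only if $$\sum_{f\in\mathsf F'}T_f<\sum_{e\text{ incident with some face in }\mathsf F'}2\theta_e\qquad\text{for every nonempty subset }\mathsf F'\subset\mathsf F.$$ -/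

import Mathlib

open Real Set Filter Topology

noncomputable section

namespace CirclePatterns

/-! ### Local isometries -/

/-- `g` is a local isometry for the distance functions `dX`, `dY`: every point `p` has a ball that
`g` maps isometrically onto the ball of the same radius about `g p`. -/
def IsLocalIsometry {X Y : Type*} (dX : X → X → ℝ) (dY : Y → Y → ℝ) (g : X → Y) : Prop :=
  ∀ p : X, ∃ ε : ℝ, 0 < ε ∧
    (∀ x y : X, dX p x < ε → dX p y < ε → dY (g x) (g y) = dX x y) ∧
    (∀ z : Y, dY (g p) z < ε → ∃ x : X, dX p x < ε ∧ g x = z)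

/-! ### The round sphere and spherical bigons -/

/-- Euclidean 3-space. -/
abbrev Space3 : Type := EuclideanSpace ℝ (Fin 3)

/-- The unit sphere in Euclidean 3-space. -/
abbrev Sphere2 : Type := Metric.sphere (0 : Space3) 1

/-- The intrinsic (great circle) distance of the unit sphere. -/
def sphDist (x y : Sphere2) : ℝ := InnerProductGeometry.angle (x : Space3) (y : Space3)

/-- The orthogonal projection of `a` to the tangent plane of the unit sphere at the unit vector
`p`: a tangent vector at `p` that points along the great circle arc from `p` to `a`. -/
def tangentTo (p a : Space3) : Space3 := a - (inner ℝ a p) • p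

/-- The spherical angle at the unit vector `p` between the great circle arcs from `p` to the unit
vectors `a` and `b`. -/
def sphAngle (p a b : Space3) : ℝ :=
  InnerProductGeometry.angle (tangentTo p a) (tangentTo p b)

/-- The open disk of centre `o` and radius `r` in the unit sphere. -/
def sphDisk (o : Sphere2) (r : ℝ) : Set Sphere2 := {x | sphDist o x < r}

/-- A bigon in the unit sphere, with its two sides labelled: two disks of radii less than `π / 2`
not containing each other, whose boundary circles meet in the two points `v` and `v'`. -/
structure Bigon where
  o₁ : Sphere2
  o₂ : Sphere2
  r₁ : ℝ
  r₂ : ℝ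
  r₁_pos : 0 < r₁
  r₁_lt : r₁ < π / 2
  r₂_pos : 0 < r₂
  r₂_lt : r₂ < π / 2
  v : Sphere2
  v' : Sphere2
  v_ne : v ≠ v'
  dist_o₁_v : sphDist o₁ v = r₁
  dist_o₂_v : sphDist o₂ v = r₂
  dist_o₁_v' : sphDist o₁ v' = r₁
  dist_o₂_v' : sphDist o₂ v' = r₂
  not_subset₁₂ : ¬ sphDisk o₁ r₁ ⊆ sphDisk o₂ r₂
  not_subset₂₁ : ¬ sphDisk o₂ r₂ ⊆ sphDisk o₁ r₁

/-- The open region of the bigon: the intersection of the two disks. -/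
def Bigon.region (b : Bigon) : Set Sphere2 := sphDisk b.o₁ b.r₁ ∩ sphDisk b.o₂ b.r₂

/-- The interior angle of the bigon. Near the vertex `v`, the bigon is bounded by the lines
orthogonal to the directions from `v` to the two centres, so that its angle and the angle at `v`
between these directions add up to `π`. -/
def Bigon.angle (b : Bigon) : ℝ := π - sphAngle b.v b.o₁ b.o₂

/-- The open geodesic segment that joins the two vertices of the bigon. -/
def Bigon.diagonal (b : Bigon) : Set Sphere2 :=
  {x | ∃ s t : ℝ, 0 < s ∧ 0 < t ∧ (x : Space3) = s • (b.v : Space3) + t • (b.v' : Space3)}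

/-! ### Total geodesic curvatures of the sides of a bigon and their primitive -/

/-- The radius `r ∈ (0, π / 2)` with `log (cot r) = K`. -/
def radiusOf (K : ℝ) : ℝ := arctan (exp (-K))

/-- The vertex `v` of the bigon of angle `θ` and radii `r₁`, `r₂`, in standard position. -/
def stdVertex : Space3 := !₂[0, 0, 1]

/-- The centre of the first disk of the bigon of angle `θ` and radii `r₁`, `r₂`, in standard
position: at distance `r₁` from the vertex. -/
def stdCenter₁ (r₁ : ℝ) : Space3 := !₂[sin r₁, 0, cos r₁]

/-- The centre of the second disk of the bigon of angle `θ` and radii `r₁`, `r₂`, in standard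
position: at distance `r₂` from the vertex, in a direction that makes the angle `π - θ` with
the direction to the first centre. -/
def stdCenter₂ (θ r₂ : ℝ) : Space3 :=
  !₂[sin r₂ * cos (π - θ), sin r₂ * sin (π - θ), cos r₂]

/-- The angle of the sector of the first disk spanned by side 1, for the bigon of angle `θ` and
radii `r₁`, `r₂`. The reflection that fixes both centres exchanges the two vertices of
the bigon, so the arc from one centre to the other halves the sector. -/
def sectorAngle₁ (θ r₁ r₂ : ℝ) : ℝ :=
  2 * sphAngle (stdCenter₁ r₁) stdVertex (stdCenter₂ θ r₂)

/-- The angle of the sector of the second disk spanned by side 2. -/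
def sectorAngle₂ (θ r₁ r₂ : ℝ) : ℝ :=
  2 * sphAngle (stdCenter₂ θ r₂) stdVertex (stdCenter₁ r₁)

/-- The total geodesic curvature `k₁ ℓ₁` of side 1 of the bigon of angle `θ`, as a function of the
logarithms `K₁`, `K₂` of the geodesic curvatures `k₁`, `k₂` of its sides. -/
def bigonT₁ (θ K₁ K₂ : ℝ) : ℝ :=
  cot (radiusOf K₁) * (sectorAngle₁ θ (radiusOf K₁) (radiusOf K₂) * sin (radiusOf K₁))

/-- The total geodesic curvature `k₂ ℓ₂` of side 2. -/
def bigonT₂ (θ K₁ K₂ : ℝ) : ℝ :=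
  cot (radiusOf K₂) * (sectorAngle₂ θ (radiusOf K₁) (radiusOf K₂) * sin (radiusOf K₂))

/-- The function `Ω_θ`: the integral of the 1-form `T₁ dK₁ + T₂ dK₂` from `0` to `(K₁, K₂)`,
taken along the straight segment. -/
def bigonOmega (θ K₁ K₂ : ℝ) : ℝ :=
  ∫ s in (0 : ℝ)..1, (bigonT₁ θ (s * K₁) (s * K₂) * K₁ + bigonT₂ θ (s * K₁) (s * K₂) * K₂)

/-! ### Spherical cones, spherical conical metrics and circle patterns -/

/-- The points of the open disk of radius `r` about the cone point in the spherical cone of angle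
`α`, in polar coordinates: the apex `(0, 0)` and the points `(ρ, φ)` with `0 < ρ < r` and
`0 ≤ φ < α`. -/
def ConeDisk (α r : ℝ) : Type :=
  {p : ℝ × ℝ // p = (0, 0) ∨ (0 < p.1 ∧ p.1 < r ∧ 0 ≤ p.2 ∧ p.2 < α)}

/-- The apex of a cone disk. -/
def ConeDisk.apex (α r : ℝ) : ConeDisk α r := ⟨(0, 0), Or.inl rfl⟩

/-- The distance in the spherical cone of angle `α` between two points at distances at most `π / 2`
from the apex: the spherical law of cosines for the angular distance of the two points in the
circle of length `α`, if that is at most `π`; otherwise the shortest path runs through the apex. -/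
def coneDist (α : ℝ) {r : ℝ} (x y : ConeDisk α r) : ℝ :=
  arccos (cos x.1.1 * cos y.1.1 + sin x.1.1 * sin y.1.1 *
    cos (min π (min |x.1.2 - y.1.2| (α - |x.1.2 - y.1.2|))))

/-- A spherical conical metric on a topological space: a metric that induces the topology and for
which every point has a ball isometric to a disk about the apex of a spherical cone of some
positive angle (`2 * π` at a nonsingular point). -/
structure SphericalMetric (S : Type*) [t : TopologicalSpace S] where
  metric : MetricSpace S
  compat : metric.toPseudoMetricSpace.toUniformSpace.toTopologicalSpace = t
  locally_conical : ∀ p : S, ∃ α ε : ℝ, 0 < α ∧ 0 < ε ∧ ε ≤ π / 2 ∧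
    ∃ φ : ConeDisk α ε → S, φ (ConeDisk.apex α ε) = p ∧
      (∀ x y, metric.dist (φ x) (φ y) = coneDist α x y) ∧
      (∀ q, metric.dist p q < ε → q ∈ range φ)

/-- A circle pattern on a spherical surface, with disks indexed by `F`: a local isometry from the
disjoint union of disks about the apices of spherical cones, of radii less than `π / 2`, that
misses only finitely many points, is at most two-to-one, and such that the images of the disks
do not contain each other. -/
structure CirclePattern {S : Type*} [TopologicalSpace S] (σ : SphericalMetric S) (F : Type*) where
  coneAngle : F → ℝ
  radius : F → ℝ
  coneAngle_pos : ∀ f, 0 < coneAngle f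
  radius_pos : ∀ f, 0 < radius f
  radius_lt : ∀ f, radius f < π / 2
  immersion : (f : F) → ConeDisk (coneAngle f) (radius f) → S
  isLocalIsometry : ∀ f, IsLocalIsometry (coneDist (coneAngle f)) σ.metric.dist (immersion f)
  finite_missed : ((⋃ f, range (immersion f))ᶜ).Finite
  two_to_one : ∀ q : S,
    {x : (f : F) × ConeDisk (coneAngle f) (radius f) | immersion x.1 x.2 = q}.encard ≤ 2
  not_subset : ∀ f g, f ≠ g → ¬ range (immersion f) ⊆ range (immersion g)

namespace CirclePattern

variable {S : Type*} [TopologicalSpace S] {σ : SphericalMetric S} {F : Type*}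

/-- The vertices of the graph of a circle pattern: the points that lie in no disk. -/
def vertices (D : CirclePattern σ F) : Set S := (⋃ f, range (D.immersion f))ᶜ

/-- The set of points with two preimages; its connected components are the bigons of the
pattern. -/
def overlap (D : CirclePattern σ F) : Set S :=
  {q | {x : (f : F) × ConeDisk (D.coneAngle f) (D.radius f) | D.immersion x.1 x.2 = q}.encard = 2}

/-- The logarithm `K_f` of the geodesic curvature `cot r_f` of the boundary of the disk `D_f`. -/
def logCurvature (D : CirclePattern σ F) (f : F) : ℝ := log (cot (D.radius f))

/-- The length of the boundary of the disk `D_f`, a circle of radius `r_f` about the apex of a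
spherical cone. -/
def boundaryLength (D : CirclePattern σ F) (f : F) : ℝ := D.coneAngle f * sin (D.radius f)

/-- The total geodesic curvature `T(∂D_f)` of the boundary of the disk `D_f`: geodesic curvature
times length. -/
def totalCurvature (D : CirclePattern σ F) (f : F) : ℝ := cot (D.radius f) * D.boundaryLength f

end CirclePattern

/-! ### Graphs on surfaces -/

/-- A graph embedded in a topological space, with edges indexed by `E` (loops and multiple edges
are allowed). -/
structure EmbeddedGraph (S : Type*) [TopologicalSpace S] (E : Type*) where
  vertices : Set S
  finite_vertices : vertices.Finite
  edge : E → C(unitInterval, S)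
  edge_zero_mem : ∀ e, edge e 0 ∈ vertices
  edge_one_mem : ∀ e, edge e 1 ∈ vertices
  edge_injOn : ∀ e, InjOn (edge e) (Ioo 0 1)
  edge_notMem : ∀ e, ∀ t ∈ Ioo (0 : unitInterval) 1, edge e t ∉ vertices
  edge_disjoint : ∀ e e', e ≠ e' → Disjoint (edge e '' Ioo 0 1) (edge e' '' Ioo 0 1)

namespace EmbeddedGraph

variable {S : Type*} [TopologicalSpace S] {E : Type*}

/-- An edge without its endpoints. -/
def openEdge (G : EmbeddedGraph S E) (e : E) : Set S := G.edge e '' Ioo 0 1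

/-- The union of all vertices and edges. -/
def support (G : EmbeddedGraph S E) : Set S := G.vertices ∪ ⋃ e, range (G.edge e)

end EmbeddedGraph

/-- A graph embedded in a topological space all of whose faces, the connected components of
the complement, are simply connected. The faces are indexed by `F`, and `side e true`,
`side e false` are the faces `f(e⁺)`, `f(e⁻)` on the two sides of the edge `e`: the faces adjacent
to the interior of `e`, which are two faces or a single face that lies on both sides. -/
structure CellularGraph (S : Type*) [TopologicalSpace S] (E F : Type*) extends
    EmbeddedGraph S E where
  face : F → Set S
  face_injective : Function.Injective face
  range_face : range face =
    {U | ∃ x ∈ toEmbeddedGraph.supportᶜ, U = connectedComponentIn toEmbeddedGraph.supportᶜ x}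
  simplyConnected_face : ∀ f, SimplyConnectedSpace (face f)
  side : E → Bool → F
  side_spec : ∀ e f, (∃ s, side e s = f) ↔
    (closure (face f) ∩ toEmbeddedGraph.openEdge e).Nonempty

/-- A homeomorphism is isotopic to the identity. -/
def IsIsotopicToId {S : Type*} [TopologicalSpace S] (h : S ≃ₜ S) : Prop :=
  ∃ H : unitInterval → S → S, Continuous (Function.uncurry H) ∧
    (∀ t, IsHomeomorph (H t)) ∧ (∀ x, H 0 x = x) ∧ (∀ x, H 1 x = h x)

/-- A spherical conical metric on `S` with a circle pattern that realizes the graph `G` weighted by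
`θ`, i.e. a representative of a point of the moduli space. The components of the overlap of
the pattern are bigons `b_e` of angles `θ_e` in bijection with the edges `e` of `G`, and the graph
of the pattern, with the missed points as vertices and the geodesic diagonals of the `b_e` as
edges, is mapped onto `G` by a homeomorphism isotopic to the identity, in such a way that the disk
`D_f` corresponds to the face `f`. -/
structure Realization {S : Type*} [TopologicalSpace S] {E F : Type*} (G : CellularGraph S E F)
    (θ : E → ℝ) where
  metric : SphericalMetric S
  pattern : CirclePattern metric F
  bigon : E → Bigon
  chart : (e : E) → (bigon e).region → S
  chart_isLocalIsometry : ∀ e,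
    IsLocalIsometry (fun x y : (bigon e).region => sphDist x y) metric.metric.dist (chart e)
  chart_injective : ∀ e, Function.Injective (chart e)
  bigon_angle : ∀ e, (bigon e).angle = θ e
  component : ∀ e, ∃ q ∈ pattern.overlap,
    range (chart e) = connectedComponentIn pattern.overlap q
  component_injective : ∀ e e', range (chart e) = range (chart e') → e = e'
  component_surjective : ∀ q ∈ pattern.overlap, ∃ e, q ∈ range (chart e)
  homeo : S ≃ₜ S
  homeo_isotopic : IsIsotopicToId homeo
  homeo_vertices : homeo '' pattern.vertices = G.vertices
  homeo_edge : ∀ e,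
    homeo '' (chart e '' {x | (x : Sphere2) ∈ (bigon e).diagonal}) = G.openEdge e
  homeo_center : ∀ f, homeo (pattern.immersion f (ConeDisk.apex _ _)) ∈ G.face f

/-! ### The function `Ω` -/

/-- The function `Ω(K) = ∑_e Ω_{θ_e}(K_{f(e⁺)}, K_{f(e⁻)}) - ∑_f T_f K_f` on `ℝ^F`. -/
def omega {S : Type*} [TopologicalSpace S] {E F : Type*} [Fintype E] [Fintype F]
    (G : CellularGraph S E F) (θ : E → ℝ) (T : F → ℝ) (K : F → ℝ) : ℝ :=
  ∑ e, bigonOmega (θ e) (K (G.side e true)) (K (G.side e false)) - ∑ f, T f * K f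

open Classical in
/-- The strict subset inequalities: for every nonempty set `F'` of faces, the sum of the `T_f` over
`F'` is less than the sum of the `2 θ_e` over the edges `e` incident with a face in `F'`. -/
def SubsetInequalities {S : Type*} [TopologicalSpace S] {E F : Type*} [Fintype E]
    (G : CellularGraph S E F) (θ : E → ℝ) (T : F → ℝ) : Prop :=
  ∀ F' : Finset F, F'.Nonempty →
    ∑ f ∈ F', T f < ∑ e with ∃ s, G.side e s ∈ F', 2 * θ e

end CirclePatterns

end

/-!
The function `Ω` is a sum over the edges of primitives `Ω_θ` of the 1-forms `T₁ dK₁ + T₂ dK₂`, minus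
a linear function. Spherical trigonometry gives the closed formula `sideCurvature` for `Tᵢ`, which
shows that the 1-form is closed; by the Poincaré lemma `Ω_θ` is `C¹` with differential
`T₁ dK₁ + T₂ dK₂` (`hasFDerivAt_bigonOmega`). The Hessian of `Ω_θ` is symmetric with a negative entry
off the diagonal and strictly dominant diagonal, by `u / (1 + u ^ 2) < arctan u`
(`neg_mixedDeriv_lt_ownDeriv`). Hence `Ω_θ` is strictly convex, and so is `Ω` because every face lies
on a side of some edge (`CellularGraph.exists_side_eq`).

A convex function tends to `+∞` at infinity as soon as it does so along every ray from the origin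
(`tendsto_cocompact_of_ray`), and in dimension at least two this is the same as being proper
(`isProperMap_iff_tendsto_atTop`). Along the ray in direction `(u, v)` the slope of `Ω_θ` tends to
`2 θ max (u, v, 0)` (`tendsto_bigonForm_ray`), so `Ω` is proper if and only if
`∑ f, T f * H f < ∑ e, 2 θ e * max (H (e⁺), H (e⁻), 0)` for all `H ≠ 0`. For indicator functions of
sets of faces these are the subset inequalities; conversely the positive part of `H` is a positive
combination of the indicator functions of its superlevel sets (`sum_mul_lt_sum_mul_max`).

The statement on critical points says that the total geodesic curvature of the disk `D_f` is the sum
of those of the sides of bigons on its boundary, taken over the sides of edges at which the face `f`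
lies. This has to be derived from the bare definition of a circle pattern, in which disks are mapped
by local isometries and bigons are components of the overlap.

* A local isometry from a piece of the sphere to a cone turns the cosine of the distance from the
  apex into a linear function on the sphere (`exists_cos_rad_eq_sdot`). So each sheet of the pattern
  over a bigon has a centre in the chart of the bigon, and the pairs of a disk and a centre that
  occur are the same over the whole bigon (`BigonPattern.labels_eq`).
* Boundary points of the bigon in the chart that go to missed points are isolated
  (`LocallyIsometricOn.exists_isolated`). At the other boundary points one sheet ends, so both
  boundary circles of the bigon are boundaries of the sheets: the two sheets have the centres and
  the radii of the two circles (`BigonPattern.exists_label_center`), and the bigon lifts to two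
  disks (`BigonPattern.lift`).
* The rays of `D_f` which end in a given bigon fill a sector, whose angle is that of the bigon seen
  from its centre. Sectors of different bigons are disjoint, since a point has at most two
  preimages. A ray ends at a missed point or at a point that some disk covers, and then it ends in
  the overlap; the angles of the first kind are isolated
  (`BigonPattern.eventually_mem_coveredAngles`). So the cone angle is the sum of the angles of the
  sectors (`BigonPattern.coneAngle_eq_sum`).
* A point of a disk is undominated if, where a second disk covers it, the cosine of the distance
  from the apex divided by the cosine of the radius is larger for the first disk. Such points form a
  set that is star-shaped about the apex and avoids the edges, so it lies in the face of the disk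
  (`BigonPattern.IsGraph.mem_of_isUndominated`). The edge of a bigon is in the closure of the
  undominated parts of both disks of the bigon, which therefore are the disks of the faces on its
  two sides (`Realization.exists_sides`).
-/

namespace CirclePatterns

/-! ### Spherical trigonometry -/

lemma inner_tangentTo (p a b : Space3) (hp : ‖p‖ = 1) :
    inner ℝ (tangentTo p a) (tangentTo p b) = inner ℝ a b - inner ℝ a p * inner ℝ b p := by
  have h1 : inner ℝ p p = (1 : ℝ) := by rw [real_inner_self_eq_norm_sq, hp]; norm_num
  simp only [tangentTo, inner_sub_left, inner_sub_right, real_inner_smul_left,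
    real_inner_smul_right, h1, real_inner_comm b p]
  ring

lemma norm_tangentTo (p a : Space3) (hp : ‖p‖ = 1) (ha : ‖a‖ = 1) :
    ‖tangentTo p a‖ = √(1 - inner ℝ a p ^ 2) := by
  rw [@norm_eq_sqrt_real_inner _ _ _ (tangentTo p a), inner_tangentTo p a a hp,
    real_inner_self_eq_norm_sq, ha]
  congr 1; ring

/-- The spherical law of cosines for the angle at `p` of a triangle `p`, `v`, `q` whose angle at `v`
is `π - θ` and whose sides at `v` have lengths `r₁`, `r₂`. -/
lemma sphAngle_eq_arctan {p v q : Space3} (hp : ‖p‖ = 1) (hv : ‖v‖ = 1) (hq : ‖q‖ = 1)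
    {r₁ r₂ θ : ℝ} (h₁ : 0 < r₁) (h₁' : r₁ < π / 2) (h₂ : 0 < r₂) (h₂' : r₂ < π / 2)
    (hθ : 0 < θ) (hθ' : θ ≤ π / 2) (hvp : inner ℝ v p = cos r₁) (hvq : inner ℝ v q = cos r₂)
    (hqp : inner ℝ q p = cos r₁ * cos r₂ - sin r₁ * sin r₂ * cos θ) :
    sphAngle p v q =
      arctan (sin θ * sin r₂ / (sin r₁ * cos r₂ + cos r₁ * sin r₂ * cos θ)) := by
  have hs₁ : 0 < sin r₁ := sin_pos_of_pos_of_lt_pi h₁ (by linarith [pi_pos])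
  have hs₂ : 0 < sin r₂ := sin_pos_of_pos_of_lt_pi h₂ (by linarith [pi_pos])
  have hc₁ : 0 < cos r₁ := cos_pos_of_mem_Ioo ⟨by linarith, h₁'⟩
  have hc₂ : 0 < cos r₂ := cos_pos_of_mem_Ioo ⟨by linarith, h₂'⟩
  have hsθ : 0 < sin θ := sin_pos_of_pos_of_lt_pi hθ (by linarith [pi_pos])
  have hcθ : 0 ≤ cos θ := cos_nonneg_of_mem_Icc ⟨by linarith, hθ'⟩
  set X := sin r₁ * cos r₂ + cos r₁ * sin r₂ * cos θ with hX
  have hXpos : 0 < X := by positivity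
  set Y := sin θ * sin r₂ with hY
  have hYpos : 0 < Y := by positivity
  have e₁ := sin_sq_add_cos_sq r₁
  have e₂ := sin_sq_add_cos_sq r₂
  have e₃ := sin_sq_add_cos_sq θ
  have hD : 1 - (cos r₁ * cos r₂ - sin r₁ * sin r₂ * cos θ) ^ 2 = X ^ 2 + Y ^ 2 := by
    rw [hX, hY]
    linear_combination (-cos r₂ ^ 2 - sin r₂ ^ 2 * cos θ ^ 2) * e₁ - e₂ - sin r₂ ^ 2 * e₃
  have hn : cos r₂ - cos r₁ * (cos r₁ * cos r₂ - sin r₁ * sin r₂ * cos θ) = sin r₁ * X := by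
    rw [hX]; linear_combination (-cos r₂) * e₁
  have hs : √(1 - cos r₁ ^ 2) = sin r₁ := by
    rw [← sin_sq, sqrt_sq hs₁.le]
  have hDpos : 0 < √(X ^ 2 + Y ^ 2) := sqrt_pos.2 (by positivity)
  rw [sphAngle, InnerProductGeometry.angle, inner_tangentTo p v q hp, norm_tangentTo p v hp hv,
    norm_tangentTo p q hp hq, hvp, hvq, hqp, hn, hs, hD,
    mul_div_mul_left _ _ hs₁.ne', arccos_eq_arctan (by positivity)]
  congr 1
  have : 1 - (X / √(X ^ 2 + Y ^ 2)) ^ 2 = (Y / √(X ^ 2 + Y ^ 2)) ^ 2 := by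
    rw [div_pow, div_pow, sq_sqrt (by positivity)]
    field_simp; ring
  rw [this, sqrt_sq (by positivity)]
  field_simp

lemma norm_stdVertex : ‖stdVertex‖ = 1 := by
  simp [stdVertex, EuclideanSpace.norm_eq, Fin.sum_univ_three]

lemma norm_stdCenter₁ (r : ℝ) : ‖stdCenter₁ r‖ = 1 := by
  simp [stdCenter₁, EuclideanSpace.norm_eq, Fin.sum_univ_three]

lemma norm_stdCenter₂ (θ r : ℝ) : ‖stdCenter₂ θ r‖ = 1 := by
  simp only [stdCenter₂, EuclideanSpace.norm_eq, Fin.sum_univ_three]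
  simp
  rw [mul_pow, mul_pow, sq_abs, sq_abs, sq_abs, sin_sq θ, sin_sq r]; ring

lemma inner_stdVertex_stdCenter₁ (r : ℝ) : inner ℝ stdVertex (stdCenter₁ r) = cos r := by
  simp [stdVertex, stdCenter₁, PiLp.inner_apply, Fin.sum_univ_three]

lemma inner_stdVertex_stdCenter₂ (θ r : ℝ) : inner ℝ stdVertex (stdCenter₂ θ r) = cos r := by
  simp [stdVertex, stdCenter₂, PiLp.inner_apply, Fin.sum_univ_three]

lemma inner_stdCenter (θ r₁ r₂ : ℝ) : inner ℝ (stdCenter₂ θ r₂) (stdCenter₁ r₁) =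
    cos r₁ * cos r₂ - sin r₁ * sin r₂ * cos θ := by
  simp [stdCenter₁, stdCenter₂, PiLp.inner_apply, Fin.sum_univ_three]
  ring

section
variable {θ r₁ r₂ : ℝ} (h₁ : 0 < r₁) (h₁' : r₁ < π / 2) (h₂ : 0 < r₂) (h₂' : r₂ < π / 2)
    (hθ : 0 < θ) (hθ' : θ ≤ π / 2)
include h₁ h₁' h₂ h₂' hθ hθ'

lemma sectorAngle₁_eq : sectorAngle₁ θ r₁ r₂ =
    2 * arctan (sin θ * sin r₂ / (sin r₁ * cos r₂ + cos r₁ * sin r₂ * cos θ)) := by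
  rw [sectorAngle₁, sphAngle_eq_arctan (norm_stdCenter₁ _) norm_stdVertex (norm_stdCenter₂ _ _)
    h₁ h₁' h₂ h₂' hθ hθ' (inner_stdVertex_stdCenter₁ _) (inner_stdVertex_stdCenter₂ _ _)
    (inner_stdCenter _ _ _)]

lemma sectorAngle₂_eq : sectorAngle₂ θ r₁ r₂ =
    2 * arctan (sin θ * sin r₁ / (sin r₂ * cos r₁ + cos r₂ * sin r₁ * cos θ)) := by
  rw [sectorAngle₂, sphAngle_eq_arctan (norm_stdCenter₂ _ _) norm_stdVertex (norm_stdCenter₁ _)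
    h₂ h₂' h₁ h₁' hθ hθ' (inner_stdVertex_stdCenter₂ _ _) (inner_stdVertex_stdCenter₁ _)
    (by rw [real_inner_comm, inner_stdCenter]; ring)]
end

/-! ### The total geodesic curvature of a side as a function of two real variables -/

lemma radiusOf_pos (K : ℝ) : 0 < radiusOf K := by
  rw [radiusOf]; exact arctan_pos.2 (exp_pos _)

lemma radiusOf_lt (K : ℝ) : radiusOf K < π / 2 := arctan_lt_pi_div_two _

lemma sin_radiusOf (K : ℝ) : sin (radiusOf K) = 1 / √(1 + exp K ^ 2) := by
  rw [radiusOf, sin_arctan, exp_neg]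
  have h := exp_pos K
  have : √(1 + (exp K)⁻¹ ^ 2) = √(1 + exp K ^ 2) / exp K := by
    rw [sqrt_eq_iff_mul_self_eq (by positivity) (by positivity), div_mul_div_comm,
      mul_self_sqrt (by positivity)]
    field_simp; ring
  rw [this]; field_simp

lemma cos_radiusOf (K : ℝ) : cos (radiusOf K) = exp K / √(1 + exp K ^ 2) := by
  rw [radiusOf, cos_arctan, exp_neg]
  have h := exp_pos K
  have : √(1 + (exp K)⁻¹ ^ 2) = √(1 + exp K ^ 2) / exp K := by
    rw [sqrt_eq_iff_mul_self_eq (by positivity) (by positivity), div_mul_div_comm,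
      mul_self_sqrt (by positivity)]
    field_simp; ring
  rw [this]; field_simp

/-- The total geodesic curvature of the side on the first disk of the bigon of angle `θ`, as a
function of the logarithms `x`, `y` of the geodesic curvatures of the two sides. The bigon being
symmetric, the other side has the total geodesic curvature `sideCurvature θ y x`. -/
noncomputable def sideCurvature (θ x y : ℝ) : ℝ :=
  2 * (exp x / √(1 + exp x ^ 2)) *
    arctan (sin θ * √(1 + exp x ^ 2) / (exp y + exp x * cos θ))

lemma cos_mul_two_arctan_radiusOf (θ x y : ℝ) :
    cos (radiusOf x) * (2 * arctan (sin θ * sin (radiusOf y) /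
      (sin (radiusOf x) * cos (radiusOf y) + cos (radiusOf x) * sin (radiusOf y) * cos θ))) =
    sideCurvature θ x y := by
  rw [sideCurvature, sin_radiusOf, sin_radiusOf, cos_radiusOf, cos_radiusOf]
  have hx : 0 < √(1 + exp x ^ 2) := sqrt_pos.2 (by positivity)
  have hy : 0 < √(1 + exp y ^ 2) := sqrt_pos.2 (by positivity)
  have : sin θ * (1 / √(1 + exp y ^ 2)) / (1 / √(1 + exp x ^ 2) * (exp y / √(1 + exp y ^ 2)) +
      exp x / √(1 + exp x ^ 2) * (1 / √(1 + exp y ^ 2)) * cos θ) =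
      sin θ * √(1 + exp x ^ 2) / (exp y + exp x * cos θ) := by
    have : 1 / √(1 + exp x ^ 2) * (exp y / √(1 + exp y ^ 2)) +
      exp x / √(1 + exp x ^ 2) * (1 / √(1 + exp y ^ 2)) * cos θ =
      (exp y + exp x * cos θ) * ((1 / √(1 + exp x ^ 2)) * (1 / √(1 + exp y ^ 2))) := by
      field_simp
    rw [this, ← div_div, mul_comm (1 / √(1 + exp x ^ 2)), ← div_div]
    field_simp
  rw [this]; ring

lemma cot_mul_sin {r : ℝ} (h : 0 < r) (h' : r < π / 2) (a : ℝ) :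
    cot r * (a * sin r) = cos r * a := by
  have : sin r ≠ 0 := (sin_pos_of_pos_of_lt_pi h (by linarith [pi_pos])).ne'
  rw [cot_eq_cos_div_sin]; field_simp

section
variable {θ : ℝ} (hθ : 0 < θ) (hθ' : θ ≤ π / 2)
include hθ hθ'

lemma bigonT₁_eq (x y : ℝ) : bigonT₁ θ x y = sideCurvature θ x y := by
  rw [bigonT₁, cot_mul_sin (radiusOf_pos _) (radiusOf_lt _), sectorAngle₁_eq (radiusOf_pos _)
    (radiusOf_lt _) (radiusOf_pos _) (radiusOf_lt _) hθ hθ', cos_mul_two_arctan_radiusOf]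

lemma bigonT₂_eq (x y : ℝ) : bigonT₂ θ x y = sideCurvature θ y x := by
  rw [bigonT₂, cot_mul_sin (radiusOf_pos _) (radiusOf_lt _), sectorAngle₂_eq (radiusOf_pos _)
    (radiusOf_lt _) (radiusOf_pos _) (radiusOf_lt _) hθ hθ', cos_mul_two_arctan_radiusOf]

lemma sin_pos_of_bigon : 0 < sin θ := sin_pos_of_pos_of_lt_pi hθ (by linarith [pi_pos])
lemma cos_nonneg_of_bigon : 0 ≤ cos θ := cos_nonneg_of_mem_Icc ⟨by linarith, hθ'⟩
end

/-- The denominator of the partial derivatives of `sideCurvature`. -/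
noncomputable def sideDenom (θ x y : ℝ) : ℝ :=
  exp x ^ 2 + exp y ^ 2 + 2 * exp x * exp y * cos θ + sin θ ^ 2

lemma sideDenom_comm (θ x y : ℝ) : sideDenom θ x y = sideDenom θ y x := by
  simp only [sideDenom]; ring

/-- The common value of the two mixed partial derivatives of `bigonOmega`. -/
noncomputable def mixedDeriv (θ x y : ℝ) : ℝ :=
  -(2 * exp x * exp y * sin θ / sideDenom θ x y)

lemma mixedDeriv_comm (θ x y : ℝ) : mixedDeriv θ x y = mixedDeriv θ y x := by
  simp only [mixedDeriv, sideDenom_comm θ x y]; ring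

/-- The partial derivative of `sideCurvature` in the first variable. -/
noncomputable def ownDeriv (θ x y : ℝ) : ℝ :=
  2 * exp x / (√(1 + exp x ^ 2) * (1 + exp x ^ 2)) *
      arctan (sin θ * √(1 + exp x ^ 2) / (exp y + exp x * cos θ)) +
    2 * exp x ^ 2 * sin θ * (exp x * exp y - cos θ) / ((1 + exp x ^ 2) * sideDenom θ x y)

/-- The inequality behind the strict convexity of `Ω`. -/
lemma div_one_add_sq_lt_arctan {u : ℝ} (hu : 0 < u) : u / (1 + u ^ 2) < arctan u := by
  have key : StrictMonoOn (fun u : ℝ => arctan u - u / (1 + u ^ 2)) (Ici 0) := by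
    apply strictMonoOn_of_deriv_pos (convex_Ici 0)
    · apply Continuous.continuousOn
      refine continuous_arctan.sub (continuous_id.div (by fun_prop) fun x => by positivity)
    · intro x hx
      rw [interior_Ici] at hx
      have hx' : (0 : ℝ) < x := hx
      have h : HasDerivAt (fun u : ℝ => arctan u - u / (1 + u ^ 2))
          (1 / (1 + x ^ 2) - (1 * (1 + x ^ 2) - x * (2 * x)) / (1 + x ^ 2) ^ 2) x := by
        refine (hasDerivAt_arctan x).sub ((hasDerivAt_id x).div ?_ (by positivity))
        simpa using (hasDerivAt_pow 2 x).const_add 1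
      rw [h.deriv]
      have : 1 / (1 + x ^ 2) - (1 * (1 + x ^ 2) - x * (2 * x)) / (1 + x ^ 2) ^ 2 =
          2 * x ^ 2 / (1 + x ^ 2) ^ 2 := by field_simp; ring
      rw [this]; positivity
  have := key (mem_Ici.2 le_rfl) (mem_Ici.2 hu.le) hu
  simp at this; linarith

section
variable {θ : ℝ} (hs : 0 < sin θ) (hc : 0 ≤ cos θ)
include hs hc

lemma sideDenom_pos (x y : ℝ) : 0 < sideDenom θ x y := by
  rw [sideDenom]; positivity

/-- The Hessian of `bigonOmega` is strictly diagonally dominant. -/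
lemma neg_mixedDeriv_lt_ownDeriv (x y : ℝ) : -mixedDeriv θ x y < ownDeriv θ x y := by
  have hN := sideDenom_pos hs hc x y
  have hx := exp_pos x
  have hy := exp_pos y
  have hw : 0 < √(1 + exp x ^ 2) := sqrt_pos.2 (by positivity)
  have hw2 : √(1 + exp x ^ 2) ^ 2 = 1 + exp x ^ 2 := sq_sqrt (by positivity)
  have hd : 0 < exp y + exp x * cos θ := by positivity
  have h := div_one_add_sq_lt_arctan
    (u := sin θ * √(1 + exp x ^ 2) / (exp y + exp x * cos θ)) (by positivity)
  have hu : sin θ * √(1 + exp x ^ 2) / (exp y + exp x * cos θ) /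
      (1 + (sin θ * √(1 + exp x ^ 2) / (exp y + exp x * cos θ)) ^ 2) =
      sin θ * √(1 + exp x ^ 2) * (exp y + exp x * cos θ) / sideDenom θ x y := by
    have : sideDenom θ x y = (exp y + exp x * cos θ) ^ 2 + (sin θ * √(1 + exp x ^ 2)) ^ 2 := by
      rw [mul_pow, hw2, sideDenom]
      linear_combination (-exp x ^ 2) * sin_sq_add_cos_sq θ
    rw [this]; field_simp
  rw [hu] at h
  have h2 := mul_lt_mul_of_pos_left h
    (show 0 < 2 * exp x / (√(1 + exp x ^ 2) * (1 + exp x ^ 2)) by positivity)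
  rw [ownDeriv, mixedDeriv, neg_neg]
  refine lt_of_eq_of_lt ?_ (add_lt_add_left h2 _)
  field_simp
  ring

lemma hasDerivAt_sideCurvature_comp {f g : ℝ → ℝ} {f' g' t : ℝ} (hf : HasDerivAt f f' t)
    (hg : HasDerivAt g g' t) :
    HasDerivAt (fun t => sideCurvature θ (f t) (g t))
      (ownDeriv θ (f t) (g t) * f' + mixedDeriv θ (f t) (g t) * g') t := by
  have hN := sideDenom_pos hs hc (f t) (g t)
  have hx := exp_pos (f t)
  have hy := exp_pos (g t)
  have hw : 0 < √(1 + exp (f t) ^ 2) := sqrt_pos.2 (by positivity)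
  have hw2 : √(1 + exp (f t) ^ 2) ^ 2 = 1 + exp (f t) ^ 2 := sq_sqrt (by positivity)
  have hd : 0 < exp (g t) + exp (f t) * cos θ := by positivity
  have h1 := hf.exp
  have h2 := hg.exp
  have h3 : HasDerivAt (fun t => √(1 + exp (f t) ^ 2)) _ t :=
    ((h1.pow 2).const_add 1).sqrt (by simp only [Pi.pow_apply]; positivity)
  have h4 := ((h1.div h3 hw.ne').const_mul 2).mul
    (((h3.const_mul (sin θ)).div (h2.add (h1.mul_const (cos θ))) hd.ne').arctan)
  simp only [Pi.div_apply, Pi.add_apply, Pi.pow_apply] at h4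
  refine h4.congr_deriv ?_
  have hu : 1 + (sin θ * √(1 + exp (f t) ^ 2) / (exp (g t) + exp (f t) * cos θ)) ^ 2 =
      sideDenom θ (f t) (g t) / (exp (g t) + exp (f t) * cos θ) ^ 2 := by
    have : sideDenom θ (f t) (g t) = (exp (g t) + exp (f t) * cos θ) ^ 2 +
        (sin θ * √(1 + exp (f t) ^ 2)) ^ 2 := by
      rw [mul_pow, hw2, sideDenom]
      linear_combination (-exp (f t) ^ 2) * sin_sq_add_cos_sq θ
    rw [this]; field_simp
  rw [hu, ownDeriv, mixedDeriv]
  generalize arctan _ = A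
  generalize √(1 + exp (f t) ^ 2) = W at *
  rw [← hw2]
  field_simp
  push_cast
  linear_combination (2 * f' * A * sideDenom θ (f t) (g t) -
    2 * W * sin θ * f' * exp (f t) * cos θ) * hw2
end

end CirclePatterns

namespace CirclePatterns

/-! ### The primitive of the total geodesic curvatures -/

/-- The closed 1-form `T₁ dK₁ + T₂ dK₂`. -/
noncomputable def bigonForm (θ : ℝ) (p : ℝ × ℝ) : ℝ × ℝ →L[ℝ] ℝ :=
  sideCurvature θ p.1 p.2 • ContinuousLinearMap.fst ℝ ℝ ℝ +
    sideCurvature θ p.2 p.1 • ContinuousLinearMap.snd ℝ ℝ ℝ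

lemma bigonForm_apply (θ : ℝ) (p v : ℝ × ℝ) :
    bigonForm θ p v = sideCurvature θ p.1 p.2 * v.1 + sideCurvature θ p.2 p.1 * v.2 := by
  simp [bigonForm]

section
variable {θ : ℝ} (hs : 0 < sin θ) (hc : 0 ≤ cos θ)
include hs hc

omit hs in
lemma differentiable_sideCurvature :
    Differentiable ℝ (fun p : ℝ × ℝ => sideCurvature θ p.1 p.2) := by
  unfold sideCurvature
  have h1 : ∀ p : ℝ × ℝ, √(1 + exp p.1 ^ 2) ≠ 0 := fun p => (sqrt_pos.2 (by positivity)).ne'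
  have h2 : ∀ p : ℝ × ℝ, 1 + exp p.1 ^ 2 ≠ 0 := fun p => by positivity
  have h3 : ∀ p : ℝ × ℝ, exp p.2 + exp p.1 * cos θ ≠ 0 := fun p => by positivity
  have h4 : ContDiff ℝ 1 (fun p : ℝ × ℝ => √(1 + exp p.1 ^ 2)) :=
    ContDiff.sqrt (by fun_prop) h2
  have h5 : ContDiff ℝ 1 (fun p : ℝ × ℝ => 2 * (exp p.1 / √(1 + exp p.1 ^ 2)) *
      arctan (sin θ * √(1 + exp p.1 ^ 2) / (exp p.2 + exp p.1 * cos θ))) :=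
    (contDiff_const.mul ((contDiff_exp.comp contDiff_fst).div h4 h1)).mul
      (((contDiff_const.mul h4).div (by fun_prop) h3).arctan)
  exact h5.differentiable one_ne_zero

omit hs in
lemma differentiable_bigonForm : Differentiable ℝ (bigonForm θ) := by
  unfold bigonForm
  have h := differentiable_sideCurvature hc
  have h' : Differentiable ℝ (fun p : ℝ × ℝ => sideCurvature θ p.2 p.1) :=
    h.comp (differentiable_snd.prodMk differentiable_fst)
  exact (h.smul_const _).add (h'.smul_const _)

lemma hasDerivAt_bigonForm_line (a x y : ℝ × ℝ) (t : ℝ) :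
    HasDerivAt (fun t : ℝ => bigonForm θ (a + t • x) y)
      ((ownDeriv θ (a + t • x).1 (a + t • x).2 * x.1 +
        mixedDeriv θ (a + t • x).1 (a + t • x).2 * x.2) * y.1 +
      (ownDeriv θ (a + t • x).2 (a + t • x).1 * x.2 +
        mixedDeriv θ (a + t • x).1 (a + t • x).2 * x.1) * y.2) t := by
  simp only [bigonForm_apply]
  have h1 : HasDerivAt (fun t : ℝ => (a + t • x).1) x.1 t := by
    simpa using ((hasDerivAt_id t).mul_const x.1).const_add a.1
  have h2 : HasDerivAt (fun t : ℝ => (a + t • x).2) x.2 t := by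
    simpa using ((hasDerivAt_id t).mul_const x.2).const_add a.2
  have h3 := (hasDerivAt_sideCurvature_comp hs hc h1 h2).mul_const y.1
  have h4 := (hasDerivAt_sideCurvature_comp hs hc h2 h1).mul_const y.2
  rw [mixedDeriv_comm θ (a + t • x).2] at h4
  exact h3.add h4

lemma fderiv_bigonForm_symm (a x y : ℝ × ℝ) :
    fderiv ℝ (bigonForm θ) a x y = fderiv ℝ (bigonForm θ) a y x := by
  have key : ∀ x y : ℝ × ℝ, fderiv ℝ (bigonForm θ) a x y =
      ((ownDeriv θ a.1 a.2 * x.1 + mixedDeriv θ a.1 a.2 * x.2) * y.1 +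
      (ownDeriv θ a.2 a.1 * x.2 + mixedDeriv θ a.1 a.2 * x.1) * y.2) := by
    intro x y
    have h1 := hasDerivAt_bigonForm_line hs hc a x y 0
    have hl : HasDerivAt (fun t : ℝ => a + t • x) x 0 := by
      simpa using ((hasDerivAt_id (0 : ℝ)).smul_const x).const_add a
    have hd : HasFDerivAt (bigonForm θ) (fderiv ℝ (bigonForm θ) a) (a + (0 : ℝ) • x) := by
      simpa using (differentiable_bigonForm hc a).hasFDerivAt
    have h2 : HasDerivAt (fun t : ℝ => bigonForm θ (a + t • x)) (fderiv ℝ (bigonForm θ) a x) 0 :=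
      HasFDerivAt.comp_hasDerivAt (l := bigonForm θ) (0 : ℝ) hd hl
    have h3 : HasDerivAt (fun t : ℝ => bigonForm θ (a + t • x) y)
        (fderiv ℝ (bigonForm θ) a x y) 0 :=
      (ContinuousLinearMap.apply ℝ ℝ y).hasFDerivAt.comp_hasDerivAt (0 : ℝ) h2
    simpa using h3.unique h1
  rw [key, key]; ring

omit hs in
lemma continuous_bigonForm : Continuous (bigonForm θ) := (differentiable_bigonForm hc).continuous
end

section
variable {θ : ℝ} (hθ : 0 < θ) (hθ' : θ ≤ π / 2)
include hθ hθ'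

/-- By the Poincaré lemma, `bigonOmega` is a primitive of the closed form `bigonForm`. -/
lemma hasFDerivAt_bigonOmega (p : ℝ × ℝ) :
    HasFDerivAt (fun p : ℝ × ℝ => bigonOmega θ p.1 p.2) (bigonForm θ p) p := by
  have hs := sin_pos_of_bigon hθ hθ'
  have hc := cos_nonneg_of_bigon hθ hθ'
  obtain ⟨f, hf⟩ := Convex.exists_forall_hasFDerivAt_of_fderiv_symmetric convex_univ isOpen_univ
    (differentiable_bigonForm hc).differentiableOn
    (fun a _ x y => fderiv_bigonForm_symm hs hc a x y)
  have hf' := fun a => hf a (mem_univ a)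
  have : (fun p : ℝ × ℝ => bigonOmega θ p.1 p.2) = fun p => f p - f 0 := by
    ext p
    have hder : ∀ s : ℝ, HasDerivAt (fun s : ℝ => f (s • p)) (bigonForm θ (s • p) p) s := by
      intro s
      have hl : HasDerivAt (fun t : ℝ => t • p) p s := by
        simpa using (hasDerivAt_id s).smul_const p
      exact (hf' (s • p)).comp_hasDerivAt s hl
    have hcont : Continuous fun s : ℝ => bigonForm θ (s • p) p :=
      ((continuous_bigonForm hc).comp (by fun_prop)).clm_apply continuous_const
    have := intervalIntegral.integral_eq_sub_of_hasDerivAt (a := 0) (b := 1)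
      (fun s _ => hder s) (hcont.intervalIntegrable _ _)
    rw [one_smul, zero_smul] at this
    rw [← this, bigonOmega]
    congr 1
    ext s
    rw [bigonForm_apply, bigonT₁_eq hθ hθ', bigonT₂_eq hθ hθ']
    simp
  rw [this]
  exact (hf' p).sub_const _
end

section
variable {θ : ℝ} (hs : 0 < sin θ) (hc : 0 ≤ cos θ)
include hs hc

lemma mixedDeriv_neg (x y : ℝ) : mixedDeriv θ x y < 0 := by
  have := sideDenom_pos hs hc x y
  rw [mixedDeriv, neg_lt_zero]; positivity

/-- The Hessian of `bigonOmega` is nonnegative, and positive on nonzero vectors. -/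
lemma hessian_nonneg (x y u v : ℝ) :
    0 ≤ (ownDeriv θ x y * u + mixedDeriv θ x y * v) * u +
      (ownDeriv θ y x * v + mixedDeriv θ x y * u) * v ∧
    ((u ≠ 0 ∨ v ≠ 0) → 0 < (ownDeriv θ x y * u + mixedDeriv θ x y * v) * u +
      (ownDeriv θ y x * v + mixedDeriv θ x y * u) * v) := by
  have h1 := neg_mixedDeriv_lt_ownDeriv hs hc x y
  have h2 := neg_mixedDeriv_lt_ownDeriv hs hc y x
  have h3 := mixedDeriv_neg hs hc x y
  rw [mixedDeriv_comm θ y x] at h2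
  have e : (ownDeriv θ x y * u + mixedDeriv θ x y * v) * u +
      (ownDeriv θ y x * v + mixedDeriv θ x y * u) * v =
      (ownDeriv θ x y + mixedDeriv θ x y) * u ^ 2 + (ownDeriv θ y x + mixedDeriv θ x y) * v ^ 2 +
        (-mixedDeriv θ x y) * (u - v) ^ 2 := by ring
  rw [e]
  have a : 0 < ownDeriv θ x y + mixedDeriv θ x y := by linarith
  have b : 0 < ownDeriv θ y x + mixedDeriv θ x y := by linarith
  have c : 0 < -mixedDeriv θ x y := by linarith
  refine ⟨by positivity, ?_⟩
  rintro (h | h) <;> positivity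

/-! ### Asymptotics of the total geodesic curvatures -/

/-- The form of the total geodesic curvature that shows its limits along rays: only `exp (y - x)`
and `exp (-2 x)` enter. -/
lemma sideCurvature_eq_sub (x y : ℝ) : sideCurvature θ x y =
    2 * (1 / √(1 + exp (-2 * x))) *
      (π / 2 - arctan ((exp (y - x) + cos θ) / (sin θ * √(1 + exp (-2 * x))))) := by
  have hx := exp_pos x
  have hy := exp_pos y
  have e1 : exp (-2 * x) = (exp x ^ 2)⁻¹ := by
    rw [← exp_nat_mul, ← exp_neg]; congr 1; push_cast; ring
  have e2 : √(1 + exp (-2 * x)) = √(1 + exp x ^ 2) / exp x := by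
    rw [e1, sqrt_eq_iff_mul_self_eq (by positivity) (by positivity), div_mul_div_comm,
      mul_self_sqrt (by positivity)]
    field_simp; ring
  have hw : 0 < √(1 + exp x ^ 2) := sqrt_pos.2 (by positivity)
  rw [sideCurvature, e2, exp_sub]
  have : arctan (sin θ * √(1 + exp x ^ 2) / (exp y + exp x * cos θ)) =
      π / 2 - arctan ((exp y / exp x + cos θ) / (sin θ * (√(1 + exp x ^ 2) / exp x))) := by
    rw [← arctan_inv_of_pos (by positivity)]
    congr 1
    field_simp
  rw [this]; field_simp

lemma sideCurvature_pos (x y : ℝ) : 0 < sideCurvature θ x y := by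
  have hw : 0 < √(1 + exp x ^ 2) := sqrt_pos.2 (by positivity)
  have : 0 < arctan (sin θ * √(1 + exp x ^ 2) / (exp y + exp x * cos θ)) :=
    arctan_pos.2 (by positivity)
  rw [sideCurvature]; positivity

lemma sideCurvature_le (x y : ℝ) : sideCurvature θ x y ≤ π * exp x := by
  have hw : 1 ≤ √(1 + exp x ^ 2) := one_le_sqrt.2 (by nlinarith [exp_pos x])
  rw [sideCurvature]
  have h1 : exp x / √(1 + exp x ^ 2) ≤ exp x := div_le_self (exp_pos x).le hw
  have h2 := (arctan_lt_pi_div_two (sin θ * √(1 + exp x ^ 2) / (exp y + exp x * cos θ))).le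
  calc _ ≤ 2 * exp x * (π / 2) := by gcongr
    _ = _ := by ring

lemma tendsto_sideCurvature_of_neg {u : ℝ} (hu : u < 0) (v : ℝ) :
    Tendsto (fun t : ℝ => sideCurvature θ (t * u) (t * v)) atTop (𝓝 0) := by
  refine squeeze_zero (fun t => (sideCurvature_pos hs hc _ _).le)
    (fun t => sideCurvature_le hs hc _ _) ?_
  have : Tendsto (fun t : ℝ => t * u) atTop atBot := tendsto_id.atTop_mul_const_of_neg hu
  simpa using (tendsto_exp_atBot.comp this).const_mul π

/-- Along a ray with `u > 0` the disk of the side shrinks, and the total geodesic curvature tends to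
its angle in the Euclidean bigon, which depends on the limit of the ratio of the radii. -/
lemma tendsto_sideCurvature_aux {u : ℝ} (hu : 0 < u) {v A : ℝ}
    (h : Tendsto (fun t : ℝ => arctan ((exp (t * v - t * u) + cos θ) /
      (sin θ * √(1 + exp (-2 * (t * u)))))) atTop (𝓝 A)) :
    Tendsto (fun t : ℝ => sideCurvature θ (t * u) (t * v)) atTop (𝓝 (2 * (π / 2 - A))) := by
  simp only [sideCurvature_eq_sub hs hc]
  have h0 : Tendsto (fun t : ℝ => -2 * (t * u)) atTop atBot := by
    refine (tendsto_id.atTop_mul_const_of_neg (show -2 * u < 0 by linarith)).congr fun t => ?_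
    simp; ring
  have h1 : Tendsto (fun t : ℝ => √(1 + exp (-2 * (t * u)))) atTop (𝓝 1) := by
    simpa using ((tendsto_exp_atBot.comp h0).const_add 1).sqrt
  have h2 := ((h1.inv₀ one_ne_zero).const_mul 2).mul (h.const_sub (π / 2))
  simpa using h2

omit hs hc in
lemma tendsto_sqrt_aux {u : ℝ} (hu : 0 < u) :
    Tendsto (fun t : ℝ => sin θ * √(1 + exp (-2 * (t * u)))) atTop (𝓝 (sin θ)) := by
  have h0 : Tendsto (fun t : ℝ => -2 * (t * u)) atTop atBot := by
    refine (tendsto_id.atTop_mul_const_of_neg (show -2 * u < 0 by linarith)).congr fun t => ?_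
    simp; ring
  simpa using (((tendsto_exp_atBot.comp h0).const_add 1).sqrt).const_mul (sin θ)
end

section
variable {θ : ℝ} (hθ : 0 < θ) (hθ' : θ ≤ π / 2)
include hθ hθ'

lemma tendsto_sideCurvature_of_lt {u v : ℝ} (hu : 0 < u) (hv : v < u) :
    Tendsto (fun t : ℝ => sideCurvature θ (t * u) (t * v)) atTop (𝓝 (2 * θ)) := by
  have hs := sin_pos_of_bigon hθ hθ'
  have hc := cos_nonneg_of_bigon hθ hθ'
  have h1 : Tendsto (fun t : ℝ => t * v - t * u) atTop atBot := by
    refine (tendsto_id.atTop_mul_const_of_neg (show v - u < 0 by linarith)).congr fun t => ?_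
    simp; ring
  have h2 := (((tendsto_exp_atBot.comp h1).add_const (cos θ)).div (tendsto_sqrt_aux hu)
    hs.ne')
  have h3 := tendsto_sideCurvature_aux hs hc hu ((continuous_arctan.tendsto _).comp h2)
  have : arctan ((0 + cos θ) / sin θ) = π / 2 - θ := by
    rw [zero_add, ← arctan_tan (x := π / 2 - θ) (by linarith) (by linarith), tan_pi_div_two_sub,
      tan_eq_sin_div_cos, inv_div]
  rw [this] at h3
  simpa using h3

lemma tendsto_sideCurvature_self {u : ℝ} (hu : 0 < u) :
    Tendsto (fun t : ℝ => sideCurvature θ (t * u) (t * u)) atTop (𝓝 θ) := by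
  have hs := sin_pos_of_bigon hθ hθ'
  have hc := cos_nonneg_of_bigon hθ hθ'
  have h2 : Tendsto (fun t : ℝ => (exp (t * u - t * u) + cos θ) /
      (sin θ * √(1 + exp (-2 * (t * u))))) atTop (𝓝 ((1 + cos θ) / sin θ)) := by
    simp only [sub_self, exp_zero]
    exact tendsto_const_nhds.div (tendsto_sqrt_aux hu) hs.ne'
  have h3 := tendsto_sideCurvature_aux hs hc hu ((continuous_arctan.tendsto _).comp h2)
  have : arctan ((1 + cos θ) / sin θ) = π / 2 - θ / 2 := by
    have e : sin (θ / 2) ≠ 0 := (sin_pos_of_pos_of_lt_pi (by linarith) (by linarith [pi_pos])).ne'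
    have e2 : cos (θ / 2) ≠ 0 := (cos_pos_of_mem_Ioo ⟨by linarith, by linarith⟩).ne'
    rw [← arctan_tan (x := π / 2 - θ / 2) (by linarith [pi_pos]) (by linarith),
      tan_pi_div_two_sub, tan_eq_sin_div_cos, inv_div]
    have a1 : sin θ = 2 * sin (θ / 2) * cos (θ / 2) := by rw [← sin_two_mul]; congr 1; ring
    have a2 : cos θ = 2 * cos (θ / 2) ^ 2 - 1 := by rw [← cos_two_mul]; congr 1; ring
    rw [a1, a2]
    congr 1
    field_simp; ring
  rw [this] at h3
  convert h3 using 2; ring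

lemma tendsto_sideCurvature_of_gt {u v : ℝ} (hu : 0 < u) (hv : u < v) :
    Tendsto (fun t : ℝ => sideCurvature θ (t * u) (t * v)) atTop (𝓝 0) := by
  have hs := sin_pos_of_bigon hθ hθ'
  have hc := cos_nonneg_of_bigon hθ hθ'
  have h1 : Tendsto (fun t : ℝ => t * v - t * u) atTop atTop := by
    refine (tendsto_id.atTop_mul_const (show 0 < v - u by linarith)).congr fun t => ?_
    simp; ring
  have h2 := (tendsto_atTop_add_const_right _ (cos θ) (tendsto_exp_atTop.comp h1)).atTop_mul_pos
    (inv_pos.2 hs) ((tendsto_sqrt_aux hu).inv₀ hs.ne')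
  have h3 := tendsto_sideCurvature_aux hs hc (v := v) (A := π / 2) hu
    ((tendsto_arctan_atTop.mono_right nhdsWithin_le_nhds).comp h2)
  simpa using h3

/-- The slope of `bigonOmega` along a ray has the limit `2 θ max (u, v, 0)`. -/
lemma tendsto_bigonForm_ray (u v : ℝ) :
    Tendsto (fun t : ℝ => bigonForm θ (t * u, t * v) (u, v)) atTop
      (𝓝 (2 * θ * max (max u v) 0)) := by
  have hs := sin_pos_of_bigon hθ hθ'
  have hc := cos_nonneg_of_bigon hθ hθ'
  have key : ∀ u v : ℝ, Tendsto (fun t : ℝ => sideCurvature θ (t * u) (t * v) * u) atTop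
      (𝓝 (2 * θ * if u ≤ 0 then 0 else if v < u then u else if v = u then u / 2 else 0)) := by
    intro u v
    split_ifs with h1 h2 h3
    · rcases h1.lt_or_eq with h | rfl
      · simpa using (tendsto_sideCurvature_of_neg hs hc h v).mul_const u
      · simp
    · exact (tendsto_sideCurvature_of_lt hθ hθ' (not_le.1 h1) h2).mul_const u
    · subst h3
      convert (tendsto_sideCurvature_self hθ hθ' (not_le.1 h1)).mul_const v using 2; ring
    · simpa using (tendsto_sideCurvature_of_gt hθ hθ' (not_le.1 h1)
        (lt_of_le_of_ne (not_lt.1 h2) (Ne.symm h3))).mul_const u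
  simp only [bigonForm_apply]
  convert (key u v).add (key v u) using 2
  rw [← mul_add]
  congr 1
  grind
end

end CirclePatterns

namespace CirclePatterns

/-! ### Coercivity of convex functions -/

section Coercive
variable {V : Type*} [NormedAddCommGroup V] [NormedSpace ℝ V] [FiniteDimensional ℝ V]

lemma tendsto_cocompact_smul {x : V} (hx : x ≠ 0) :
    Tendsto (fun t : ℝ => t • x) atTop (cocompact V) := by
  have : ProperSpace V := FiniteDimensional.proper_real V
  rw [← Metric.cobounded_eq_cocompact, ← tendsto_norm_atTop_iff_cobounded]
  simp only [norm_smul]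
  exact tendsto_norm_atTop_atTop.atTop_mul_const (norm_pos_iff.2 hx)

/-- A convex function on a finite-dimensional space that tends to `+∞` along every ray from the
origin tends to `+∞` at infinity. -/
lemma tendsto_cocompact_of_ray {f : V → ℝ} (hf : ConvexOn ℝ univ f) (hcont : Continuous f)
    (hray : ∀ x : V, x ≠ 0 → Tendsto (fun t : ℝ => f (t • x)) atTop atTop) :
    Tendsto f (cocompact V) atTop := by
  have : ProperSpace V := FiniteDimensional.proper_real V
  -- convexity along the segment from the origin to `x`
  have hseg : ∀ (x : V) (a : ℝ), 0 ≤ a → a ≤ 1 → f (a • x) - f 0 ≤ a * (f x - f 0) := by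
    intro x a h0 h1
    have := hf.2 (mem_univ (0 : V)) (mem_univ x) (show 0 ≤ 1 - a by linarith) h0 (by ring)
    simp only [smul_zero, zero_add, smul_eq_mul] at this
    linarith
  -- by compactness of the unit sphere, `f` exceeds `f 0` on the sphere of some radius `n + 1`
  obtain ⟨n, hn⟩ : ∃ n : ℕ, Metric.sphere (0 : V) 1 ⊆ {x | f 0 < f ((n + 1 : ℝ) • x)} := by
    refine (isCompact_sphere (0 : V) 1).elim_directed_cover
      (fun n : ℕ => {x | f 0 < f ((n + 1 : ℝ) • x)}) (fun n => ?_) ?_ ?_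
    · exact isOpen_lt continuous_const (by fun_prop)
    · intro x hx
      have hx0 : x ≠ 0 := by rintro rfl; simp at hx
      have h1 := (hray x hx0).comp (tendsto_natCast_atTop_atTop.comp (tendsto_add_atTop_nat 1))
      obtain ⟨n, hn⟩ := (h1.eventually_gt_atTop (f 0)).exists
      exact mem_iUnion.2 ⟨n, by simpa using hn⟩
    · refine directed_of_isDirected_le fun m n hmn x hx => ?_
      simp only [mem_ofPred_eq] at hx ⊢
      have hmn' : (m : ℝ) ≤ n := by exact_mod_cast hmn
      have h := hseg ((n + 1 : ℝ) • x) ((m + 1) / (n + 1)) (by positivity)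
        (by rw [div_le_one (by positivity)]; linarith)
      rw [smul_smul, div_mul_cancel₀ _ (by positivity : (n : ℝ) + 1 ≠ 0)] at h
      have : 0 < (m + 1) / (n + 1 : ℝ) := by positivity
      by_contra! hle
      nlinarith
  obtain ⟨c, hc, hcf⟩ : ∃ c > 0, ∀ x ∈ Metric.sphere (0 : V) 1, c ≤ f ((n + 1 : ℝ) • x) - f 0 := by
    rcases (Metric.sphere (0 : V) 1).eq_empty_or_nonempty with he | hne
    · exact ⟨1, one_pos, by simp [he]⟩
    · obtain ⟨x, hx, hmin⟩ := (isCompact_sphere (0 : V) 1).exists_isMinOn hne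
        (f := fun x => f ((n + 1 : ℝ) • x) - f 0) (by fun_prop)
      exact ⟨_, sub_pos.2 (hn hx), fun y hy => hmin hy⟩
  have hlim : Tendsto (fun x : V => f 0 + c / (n + 1) * ‖x‖) (cocompact V) atTop :=
    tendsto_atTop_add_const_left _ _
      ((tendsto_norm_cocompact_atTop (E := V)).const_mul_atTop (by positivity))
  refine tendsto_atTop_mono' _ ?_ hlim
  filter_upwards [(tendsto_norm_cocompact_atTop (E := V)).eventually_ge_atTop ((n : ℝ) + 1)]
    with x hx
  have hx0 : 0 < ‖x‖ := lt_of_lt_of_le (by positivity) hx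
  have h1 := hcf (‖x‖⁻¹ • x) (by simp [norm_smul, hx0.ne'])
  have h2 := hseg x ((n + 1) / ‖x‖) (by positivity) (by rwa [div_le_one hx0])
  rw [smul_smul, ← div_eq_mul_inv] at h1
  have h3 := h1.trans h2
  have : c / (n + 1) * ‖x‖ ≤ f x - f 0 := by
    rw [div_mul_eq_mul_div, le_div_iff₀ hx0] at h3
    rw [div_mul_eq_mul_div, div_le_iff₀ (by positivity)]
    linarith
  linarith

/-- In dimension at least two, a convex function that is proper as a continuous map to `ℝ` tends to
`+∞` at infinity: off a ball it has a constant sign, and the negative sign contradicts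
convexity. -/
lemma isProperMap_iff_tendsto_atTop {f : V → ℝ} (hf : ConvexOn ℝ univ f) (hcont : Continuous f)
    (hV : 2 ≤ Module.finrank ℝ V) :
    IsProperMap f ↔ Tendsto f (cocompact V) atTop := by
  have : ProperSpace V := FiniteDimensional.proper_real V
  rw [isProperMap_iff_tendsto_cocompact]
  constructor
  · rintro ⟨-, h⟩
    have habs : Tendsto (fun x => |f x|) (cocompact V) atTop :=
      (tendsto_norm_cocompact_atTop (E := ℝ)).comp h
    obtain ⟨R, hR0, hR⟩ : ∃ R : ℝ, 0 ≤ R ∧ ∀ x : V, R < ‖x‖ → |f 0| < |f x| := by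
      have := habs.eventually_gt_atTop |f 0|
      rw [← Metric.cobounded_eq_cocompact, ← comap_norm_atTop, eventually_comap,
        eventually_atTop] at this
      obtain ⟨R, hR⟩ := this
      exact ⟨max R 0, le_max_right _ _, fun x hx => hR _ ((le_max_left _ _).trans hx.le) x rfl⟩
    have hrank : 1 < Module.rank ℝ V := by
      rw [← Module.finrank_eq_rank]; exact_mod_cast hV
    have hconn : IsPreconnected {x : V | R < ‖x‖} := by
      have himg : {x : V | R < ‖x‖} =
          (fun p : ℝ × V => p.1 • p.2) '' (Ioi R ×ˢ Metric.sphere (0 : V) 1) := by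
        ext x
        simp only [mem_ofPred_eq, mem_image, mem_prod, mem_Ioi, mem_sphere_zero_iff_norm,
          Prod.exists]
        constructor
        · intro hx
          have hx0 : ‖x‖ ≠ 0 := (hR0.trans_lt hx).ne'
          exact ⟨‖x‖, ‖x‖⁻¹ • x, ⟨hx, by simp [norm_smul, hx0]⟩, by simp [smul_smul, hx0]⟩
        · rintro ⟨r, y, ⟨hr, hy⟩, rfl⟩
          rw [norm_smul, hy, mul_one]
          exact hr.trans_le (le_abs_self r)
      rw [himg]
      exact (isPreconnected_Ioi.prod (isPreconnected_sphere hrank 0 1)).image _ (by fun_prop)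
    have hpos : ∀ x : V, R < ‖x‖ → 0 < f x := by
      intro x hx
      by_contra! hneg
      have hz := hconn.image f hcont.continuousOn
      have hx' : R < ‖-x‖ := by rwa [norm_neg]
      have hconv := hf.2 (mem_univ x) (mem_univ (-x)) (by norm_num : (0 : ℝ) ≤ 1 / 2)
        (by norm_num : (0 : ℝ) ≤ 1 / 2) (by norm_num)
      simp only [smul_neg, add_neg_cancel, smul_eq_mul] at hconv
      have h1 := hR x hx
      have h2 := hR _ hx'
      rw [abs_of_nonpos hneg] at h1
      have h3 := neg_abs_le (f 0)
      have hp : 0 ≤ f (-x) := by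
        by_contra! hn
        rw [abs_of_neg hn] at h2
        linarith
      obtain ⟨y, hy, hy0⟩ := hz.Icc_subset ⟨x, hx, rfl⟩ ⟨-x, hx', rfl⟩ ⟨hneg, hp⟩
      have := hR y hy
      rw [hy0, abs_zero] at this
      exact absurd this (not_lt.2 (abs_nonneg _))
    refine habs.congr' ?_
    have := (tendsto_norm_cocompact_atTop (E := V)).eventually_gt_atTop R
    filter_upwards [this] with x hx
    exact abs_of_pos (hpos x hx)
  · intro h
    refine ⟨hcont, ?_⟩
    rw [cocompact_eq_atBot_atTop (α := ℝ)]
    exact h.mono_right le_sup_right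

end Coercive

/-! ### The subset inequalities -/

section Subset
variable {E F : Type*} [Fintype E] [Fintype F]

open Classical in
/-- If the weight of the edges incident to any nonempty set of vertices exceeds the total of `T`
over the set, then the same holds for the weighted sums that a nonnegative function `H` defines:
`H` is a positive combination of indicator functions of its superlevel sets. -/
lemma sum_mul_lt_sum_mul_max (p q : E → F) (w : E → ℝ) (T : F → ℝ)
    (h : ∀ F' : Finset F, F'.Nonempty →
      ∑ f ∈ F', T f < ∑ e with p e ∈ F' ∨ q e ∈ F', w e)
    (H : F → ℝ) (hH : ∀ f, 0 ≤ H f) :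
    ∑ f, T f * H f ≤ ∑ e, w e * max (H (p e)) (H (q e)) ∧
    (H ≠ 0 → ∑ f, T f * H f < ∑ e, w e * max (H (p e)) (H (q e))) := by
  induction hn : (Finset.univ.filter fun f => 0 < H f).card using Nat.strong_induction_on
    generalizing H with
  | _ n ih =>
  set F' := Finset.univ.filter fun f => 0 < H f with hF'
  rcases F'.eq_empty_or_nonempty with he | hne
  · have h0 : H = 0 := by
      ext f
      by_contra hf
      have : f ∈ F' := by simp [hF', lt_of_le_of_ne (hH f) (Ne.symm hf)]
      rw [he] at this
      simp at this
    subst h0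
    simp
  · obtain ⟨f₀, hf₀, hmin⟩ := F'.exists_min_image H hne
    set m := H f₀ with hm
    have hm0 : 0 < m := by simpa [hF'] using hf₀
    have hdich : ∀ f, H f = 0 ∨ m ≤ H f := fun f => by
      rcases (hH f).eq_or_lt with h | h
      · exact Or.inl h.symm
      · exact Or.inr (hmin f (by simp [hF', h]))
    have hmem : ∀ f, f ∈ F' ↔ 0 < H f := fun f => by simp [hF']
    -- subtract the smallest positive value `m` of `H` on the set `F'` of faces where `H` is positive;
    -- the subset inequality for `F'` accounts for the difference
    set H' : F → ℝ := fun f => if f ∈ F' then H f - m else 0 with hH'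
    have hH'0 : ∀ f, 0 ≤ H' f := fun f => by
      simp only [hH']
      split_ifs with hf
      · exact sub_nonneg.2 (hmin f hf)
      · exact le_rfl
    have hlt : (Finset.univ.filter fun f => 0 < H' f).card < n := by
      rw [← hn]
      refine Finset.card_lt_card ⟨fun f hf => ?_, fun hsub => ?_⟩
      · by_contra hf'
        simp [hH', hf'] at hf
      · have := hsub hf₀
        simp [hH', hf₀, hm] at this
    have hi := (ih _ hlt H' hH'0 rfl).1
    have e1 : ∑ f, T f * H f = ∑ f, T f * H' f + m * ∑ f ∈ F', T f := by
      rw [Finset.mul_sum, ← Finset.sum_filter_add_sum_filter_not _ (· ∈ F') fun f => T f * H f,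
        ← Finset.sum_filter_add_sum_filter_not _ (· ∈ F') fun f => T f * H' f]
      have a1 : Finset.univ.filter (· ∈ F') = F' := by ext; simp
      have a2 : ∑ f with f ∉ F', T f * H f = 0 := Finset.sum_eq_zero fun f hf => by
        have : ¬ 0 < H f := by simpa [hmem] using hf
        rw [le_antisymm (not_lt.1 this) (hH f), mul_zero]
      have a3 : ∑ f with f ∉ F', T f * H' f = 0 := Finset.sum_eq_zero fun f hf => by
        have : f ∉ F' := by simpa using hf
        simp [hH', this]
      rw [a1, a2, a3, add_zero, add_zero, ← Finset.sum_add_distrib]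
      exact Finset.sum_congr rfl fun f hf => by simp [hH', hf]; ring
    have e2 : ∑ e, w e * max (H (p e)) (H (q e)) = ∑ e, w e * max (H' (p e)) (H' (q e)) +
        m * ∑ e with p e ∈ F' ∨ q e ∈ F', w e := by
      rw [Finset.mul_sum, Finset.sum_filter, ← Finset.sum_add_distrib]
      refine Finset.sum_congr rfl fun e _ => ?_
      have : max (H (p e)) (H (q e)) = max (H' (p e)) (H' (q e)) +
          if p e ∈ F' ∨ q e ∈ F' then m else 0 := by
        have b1 := hdich (p e)
        have b2 := hdich (q e)
        simp only [hH', hmem]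
        grind
      rw [this]; split_ifs <;> ring
    have h3 := mul_lt_mul_of_pos_left (h F' hne) hm0
    rw [e1, e2]
    exact ⟨by linarith, fun _ => by linarith⟩

end Subset

end CirclePatterns

namespace CirclePatterns

/-! ### Faces of an embedded graph -/

section Graph
variable {S : Type*} [TopologicalSpace S] {E F : Type*}

lemma EmbeddedGraph.openEdge_nonempty (G : EmbeddedGraph S E) (e : E) : (G.openEdge e).Nonempty :=
  (nonempty_Ioo.2 (by norm_num : (0 : unitInterval) < 1)).image _

lemma EmbeddedGraph.support_eq (G : EmbeddedGraph S E) :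
    G.support = G.vertices ∪ ⋃ e, G.openEdge e := by
  apply Subset.antisymm
  · rintro x (hx | hx)
    · exact Or.inl hx
    · obtain ⟨e, t, rfl⟩ := mem_iUnion.1 hx
      by_cases h0 : t = 0
      · exact Or.inl (h0 ▸ G.edge_zero_mem e)
      by_cases h1 : t = 1
      · exact Or.inl (h1 ▸ G.edge_one_mem e)
      · exact Or.inr (mem_iUnion.2 ⟨e, t, ⟨lt_of_le_of_ne t.2.1 fun h => h0 h.symm,
          lt_of_le_of_ne t.2.2 fun h => h1 h⟩, rfl⟩)
  · rintro x (hx | hx)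
    · exact Or.inl hx
    · obtain ⟨e, t, -, rfl⟩ := mem_iUnion.1 hx
      exact Or.inr (mem_iUnion.2 ⟨e, t, rfl⟩)

lemma EmbeddedGraph.isClosed_support [T2Space S] [Finite E] (G : EmbeddedGraph S E) :
    IsClosed G.support :=
  G.finite_vertices.isClosed.union
    (isClosed_iUnion_of_finite fun e => (isCompact_range (G.edge e).continuous).isClosed)

variable (G : CellularGraph S E F)

lemma CellularGraph.exists_face_eq (f : F) :
    ∃ x ∈ G.supportᶜ, G.face f = connectedComponentIn G.supportᶜ x := by
  have : G.face f ∈ range G.face := ⟨f, rfl⟩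
  rwa [G.range_face] at this

lemma CellularGraph.face_subset (f : F) : G.face f ⊆ G.supportᶜ := by
  obtain ⟨x, hx, h⟩ := G.exists_face_eq f
  rw [h]; exact connectedComponentIn_subset _ _

lemma CellularGraph.face_nonempty (f : F) : (G.face f).Nonempty := by
  obtain ⟨x, hx, h⟩ := G.exists_face_eq f
  rw [h]; exact ⟨x, mem_connectedComponentIn hx⟩

lemma CellularGraph.face_eq_of_mem {f : F} {x : S} (hx : x ∈ G.face f) :
    G.face f = connectedComponentIn G.supportᶜ x := by
  obtain ⟨y, hy, h⟩ := G.exists_face_eq f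
  rw [h] at hx ⊢
  exact connectedComponentIn_eq hx

lemma CellularGraph.face_unique {f g : F} {x : S} (hf : x ∈ G.face f) (hg : x ∈ G.face g) :
    f = g :=
  G.face_injective (by rw [G.face_eq_of_mem hf, G.face_eq_of_mem hg])

lemma CellularGraph.isOpen_face [T2Space S] [LocallyConnectedSpace S] [Finite E] (f : F) :
    IsOpen (G.face f) := by
  obtain ⟨x, hx, h⟩ := G.exists_face_eq f
  rw [h]
  exact G.isClosed_support.isOpen_compl.connectedComponentIn

lemma CellularGraph.subset_face {f : F} {s : Set S} (hs : IsPreconnected s)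
    (hd : s ⊆ G.supportᶜ) {x : S} (hx : x ∈ s) (hxf : x ∈ G.face f) : s ⊆ G.face f := by
  rw [G.face_eq_of_mem hxf]
  exact hs.subset_connectedComponentIn hx hd

lemma CellularGraph.closure_face_subset [T2Space S] [LocallyConnectedSpace S] [Finite E] (f : F) :
    closure (G.face f) ⊆ G.face f ∪ G.support := by
  intro x hx
  by_contra hn
  simp only [mem_union, not_or] at hn
  have ho : IsOpen (connectedComponentIn G.supportᶜ x) :=
    G.isClosed_support.isOpen_compl.connectedComponentIn
  obtain ⟨y, hy, hyf⟩ := mem_closure_iff.1 hx _ ho (mem_connectedComponentIn hn.2)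
  apply hn.1
  rw [G.face_eq_of_mem hyf, ← connectedComponentIn_eq hy]
  exact mem_connectedComponentIn hn.2

end Graph

section Surface
variable {S : Type*} [TopologicalSpace S] [T2Space S] [ChartedSpace (EuclideanSpace ℝ (Fin 2)) S]

omit [T2Space S] in
/-- On a surface, every neighbourhood of a point contains a punctured neighbourhood that is
connected. -/
lemma exists_isPreconnected_punctured (q : S) {U : Set S} (hU : U ∈ 𝓝 q) :
    ∃ N ⊆ U, q ∈ N ∧ IsOpen N ∧ IsPreconnected (N \ {q}) := by
  set φ := chartAt (EuclideanSpace ℝ (Fin 2)) q with hφ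
  have hq : q ∈ φ.source := mem_chart_source _ q
  have hU' : φ.symm ⁻¹' U ∩ φ.target ∈ 𝓝 (φ q) := by
    refine inter_mem ?_ (φ.open_target.mem_nhds (φ.map_source hq))
    exact (φ.continuousAt_symm (φ.map_source hq)).preimage_mem_nhds (by rwa [φ.left_inv hq])
  obtain ⟨ε, hε, hball⟩ := Metric.mem_nhds_iff.1 hU'
  have htgt : Metric.ball (φ q) ε ⊆ φ.target := fun x hx => (hball hx).2
  refine ⟨φ.symm '' Metric.ball (φ q) ε, ?_, ⟨φ q, Metric.mem_ball_self hε, φ.left_inv hq⟩,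
    φ.symm.isOpen_image_of_subset_source Metric.isOpen_ball htgt, ?_⟩
  · rintro _ ⟨x, hx, rfl⟩
    exact (hball hx).1
  · have himg : φ.symm '' Metric.ball (φ q) ε \ {q} = (fun p : ℝ × _ => φ.symm (φ q + p.1 • p.2)) ''
        (Ioo 0 ε ×ˢ Metric.sphere (0 : EuclideanSpace ℝ (Fin 2)) 1) := by
      ext y
      simp only [Set.mem_sdiff, mem_image, mem_prod, mem_singleton_iff, Prod.exists,
        mem_sphere_zero_iff_norm]
      constructor
      · rintro ⟨⟨x, hx, rfl⟩, hne⟩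
        have hx0 : x - φ q ≠ 0 := fun h => hne (by rw [sub_eq_zero.1 h, φ.left_inv hq])
        have hn : ‖x - φ q‖ ≠ 0 := norm_ne_zero_iff.2 hx0
        refine ⟨‖x - φ q‖, ‖x - φ q‖⁻¹ • (x - φ q), ⟨⟨norm_pos_iff.2 hx0, ?_⟩, ?_⟩, ?_⟩
        · rwa [← dist_eq_norm]
        · simp [norm_smul, hn]
        · simp [smul_smul, hn]
      · rintro ⟨r, v, ⟨⟨hr0, hr⟩, hv⟩, rfl⟩
        have hmem : φ q + r • v ∈ Metric.ball (φ q) ε := by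
          simp [norm_smul, hv, abs_of_pos hr0, hr]
        refine ⟨⟨_, hmem, rfl⟩, fun h => ?_⟩
        have := congrArg φ h
        rw [φ.right_inv (htgt hmem)] at this
        have hv0 : r • v = 0 := by simpa using this
        have : ‖r • v‖ = r := by rw [norm_smul, hv, mul_one, norm_of_nonneg hr0.le]
        rw [hv0, norm_zero] at this
        exact hr0.ne this
    rw [himg]
    have hrank : 1 < Module.rank ℝ (EuclideanSpace ℝ (Fin 2)) := by
      rw [← Module.finrank_eq_rank]; simp
    refine (isPreconnected_Ioo.prod (isPreconnected_sphere hrank 0 1)).image _ ?_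
    refine φ.continuousOn_symm.comp (by fun_prop) ?_
    rintro ⟨r, v⟩ ⟨⟨hr0, hr⟩, hv⟩
    have hv' : ‖v‖ = 1 := by simpa using hv
    exact htgt (by simp [norm_smul, hv', abs_of_pos hr0, hr])

/-- Every face lies on a side of some edge: otherwise its closure, which differs from the face only
by vertices, would be open, since removing finitely many points from a surface does not disconnect
it locally. -/
lemma CellularGraph.exists_side_eq [ConnectedSpace S] {E F : Type*} [Finite E] [Nonempty E]
    (G : CellularGraph S E F) (f : F) : ∃ e s, G.side e s = f := by
  have : LocallyConnectedSpace S :=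
    ChartedSpace.locallyConnectedSpace (EuclideanSpace ℝ (Fin 2)) S
  by_contra! hno
  have hdisj : ∀ e, ∀ x ∈ closure (G.face f), x ∉ G.openEdge e := fun e x hx hxe => by
    obtain ⟨s, hs⟩ := (G.side_spec e f).2 ⟨x, hx, hxe⟩
    exact hno e s hs
  have hsub : ∀ x ∈ closure (G.face f), x ∈ G.face f ∨ x ∈ G.vertices := fun x hx => by
    rcases G.closure_face_subset f hx with h | h
    · exact Or.inl h
    · rw [G.support_eq] at h
      rcases h with h | h
      · exact Or.inr h
      · obtain ⟨e, he⟩ := mem_iUnion.1 h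
        exact absurd he (hdisj e x hx)
  -- a face not adjacent to any edge contains a punctured neighbourhood of each vertex in its closure
  have hopen : IsOpen (closure (G.face f)) := by
    rw [isOpen_iff_mem_nhds]
    intro q hq
    rcases hsub q hq with h | h
    · exact mem_of_superset ((G.isOpen_face f).mem_nhds h) subset_closure
    · have hV : (G.vertices \ {q})ᶜ ∈ 𝓝 q :=
        (G.finite_vertices.subset sdiff_subset).isClosed.isOpen_compl.mem_nhds (by simp)
      obtain ⟨N, hNV, hqN, hNo, hNc⟩ := exists_isPreconnected_punctured q hV
      refine mem_of_superset (hNo.mem_nhds hqN) fun x hx => ?_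
      rcases eq_or_ne x q with rfl | hxq
      · exact hq
      have hqf : q ∉ G.face f := fun hqf => G.face_subset f hqf (Or.inl h)
      obtain ⟨y, hyN, hyf⟩ := mem_closure_iff.1 hq N hNo hqN
      have hyq : y ≠ q := fun hy => hqf (hy ▸ hyf)
      refine subset_closure (hNc.subset_of_closure_inter_subset (G.isOpen_face f)
        ⟨y, ⟨hyN, hyq⟩, hyf⟩ ?_ ⟨hx, hxq⟩)
      rintro z ⟨hz, hzN⟩
      rcases hsub z hz with hzf | hzv
      · exact hzf
      · exact absurd ⟨hzv, hzN.2⟩ (hNV hzN.1)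
  have huniv : closure (G.face f) = univ :=
    IsClopen.eq_univ ⟨isClosed_closure, hopen⟩ (G.face_nonempty f).closure
  obtain ⟨e⟩ := ‹Nonempty E›
  obtain ⟨x, hx⟩ := G.openEdge_nonempty e
  exact hdisj e x (huniv ▸ mem_univ x) hx

end Surface

/-! ### The function `Ω` -/

section Omega
variable {S : Type*} [TopologicalSpace S] {E F : Type*} [Fintype E] [Fintype F]
  (G : CellularGraph S E F) (θ : E → ℝ) (T : F → ℝ)

/-- The derivative of `omega`. -/
noncomputable def omegaDeriv (K : F → ℝ) : (F → ℝ) →L[ℝ] ℝ :=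
  ∑ e, (bigonForm (θ e) (K (G.side e true), K (G.side e false))).comp
      ((ContinuousLinearMap.proj (G.side e true)).prod
        (ContinuousLinearMap.proj (G.side e false))) -
    ∑ f, T f • ContinuousLinearMap.proj f

lemma omegaDeriv_apply (K H : F → ℝ) : omegaDeriv G θ T K H =
    ∑ e, bigonForm (θ e) (K (G.side e true), K (G.side e false))
      (H (G.side e true), H (G.side e false)) - ∑ f, T f * H f := by
  simp [omegaDeriv]

/-- The recession function of `omega`. -/
noncomputable def omegaSlope (H : F → ℝ) : ℝ :=
  ∑ e, 2 * θ e * max (max (H (G.side e true)) (H (G.side e false))) 0 - ∑ f, T f * H f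

variable (hθ : ∀ e, 0 < θ e ∧ θ e ≤ π / 2)
include hθ

lemma hasFDerivAt_omega (K : F → ℝ) : HasFDerivAt (omega G θ T) (omegaDeriv G θ T K) K := by
  have key : ∀ e, HasFDerivAt
      (fun K : F → ℝ => bigonOmega (θ e) (K (G.side e true)) (K (G.side e false)))
      ((bigonForm (θ e) (K (G.side e true), K (G.side e false))).comp
        ((ContinuousLinearMap.proj (G.side e true)).prod
          (ContinuousLinearMap.proj (G.side e false)))) K := by
    intro e
    have h1 : HasFDerivAt (fun K : F → ℝ => (K (G.side e true), K (G.side e false)))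
        ((ContinuousLinearMap.proj (G.side e true)).prod
          (ContinuousLinearMap.proj (G.side e false))) K :=
      (hasFDerivAt_apply (𝕜 := ℝ) (G.side e true) K).prodMk (hasFDerivAt_apply (G.side e false) K)
    exact (hasFDerivAt_bigonOmega (hθ e).1 (hθ e).2
      (K (G.side e true), K (G.side e false))).comp K h1
  exact (HasFDerivAt.fun_sum fun e _ => key e).fun_sub
    (HasFDerivAt.fun_sum fun f _ => (hasFDerivAt_apply (𝕜 := ℝ) f K).const_mul (T f))

lemma continuous_omegaDeriv : Continuous (omegaDeriv G θ T) := by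
  unfold omegaDeriv
  refine (continuous_finsetSum _ fun e _ => ?_).sub continuous_const
  exact ((continuous_bigonForm
    (cos_nonneg_of_bigon (hθ e).1 (hθ e).2)).comp (by fun_prop)).clm_comp continuous_const

lemma contDiff_omega : ContDiff ℝ 1 (omega G θ T) :=
  contDiff_one_iff_hasFDerivAt.2 ⟨_, continuous_omegaDeriv G θ T hθ, hasFDerivAt_omega G θ T hθ⟩

lemma hasDerivAt_omega_line (K H : F → ℝ) (t : ℝ) :
    HasDerivAt (fun t : ℝ => omega G θ T (K + t • H)) (omegaDeriv G θ T (K + t • H) H) t := by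
  have hl : HasDerivAt (fun t : ℝ => K + t • H) H t := by
    simpa using ((hasDerivAt_id t).smul_const H).const_add K
  exact (hasFDerivAt_omega G θ T hθ (K + t • H)).comp_hasDerivAt t hl

/-- Each Hessian is nonnegative, and in a direction `H` with `H f ≠ 0` that of an edge on the
boundary of the face `f` is positive; so `omega` is strictly convex on lines. -/
lemma strictMono_omegaDeriv_line (hside : ∀ f, ∃ e s, G.side e s = f) (K : F → ℝ) {H : F → ℝ}
    (hH : H ≠ 0) : StrictMono fun t : ℝ => omegaDeriv G θ T (K + t • H) H := by
  simp only [omegaDeriv_apply]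
  set p := fun e => G.side e true
  set q := fun e => G.side e false
  have hder : ∀ t : ℝ, ∀ e, HasDerivAt (fun t : ℝ => bigonForm (θ e)
      ((K + t • H) (p e), (K + t • H) (q e)) (H (p e), H (q e))) _ t := fun t e =>
    hasDerivAt_bigonForm_line (sin_pos_of_bigon (hθ e).1 (hθ e).2)
      (cos_nonneg_of_bigon (hθ e).1 (hθ e).2) (K (p e), K (q e)) (H (p e), H (q e))
      (H (p e), H (q e)) t
  refine strictMono_of_deriv_pos fun t => ?_
  rw [((HasDerivAt.fun_sum fun e (_ : e ∈ Finset.univ) => hder t e).sub_const _).deriv]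
  have hpos := fun e => hessian_nonneg (sin_pos_of_bigon (hθ e).1 (hθ e).2)
    (cos_nonneg_of_bigon (hθ e).1 (hθ e).2) ((K (p e), K (q e)) + t • (H (p e), H (q e))).1
    ((K (p e), K (q e)) + t • (H (p e), H (q e))).2 (H (p e)) (H (q e))
  obtain ⟨f, hf⟩ := Function.ne_iff.1 hH
  obtain ⟨e, s, rfl⟩ := hside f
  refine Finset.sum_pos' (fun e _ => (hpos e).1) ⟨e, Finset.mem_univ e, (hpos e).2 ?_⟩
  cases s
  · exact Or.inr hf
  · exact Or.inl hf

lemma strictConvexOn_omega (hside : ∀ f, ∃ e s, G.side e s = f) :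
    StrictConvexOn ℝ univ (omega G θ T) := by
  refine ⟨convex_univ, fun x _ y _ hxy a b ha hb hab => ?_⟩
  have hH : y - x ≠ 0 := sub_ne_zero.2 hxy.symm
  have hder := hasDerivAt_omega_line G θ T hθ x (y - x)
  have hsc : StrictConvexOn ℝ univ fun t : ℝ => omega G θ T (x + t • (y - x)) := by
    refine StrictMono.strictConvexOn_univ_of_deriv
      (continuous_iff_continuousAt.2 fun t => (hder t).continuousAt) ?_
    rw [show deriv _ = _ from funext fun t => (hder t).deriv]
    exact strictMono_omegaDeriv_line G θ T hθ hside x hH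
  have h := hsc.2 (mem_univ 0) (mem_univ 1) zero_ne_one ha hb hab
  simp only [smul_eq_mul, mul_zero, mul_one, zero_add, zero_smul, add_zero, one_smul,
    add_sub_cancel] at h
  have e : x + b • (y - x) = a • x + b • y := by
    rw [← eq_sub_iff_add_eq] at hab; subst hab; module
  rwa [e] at h

lemma tendsto_omegaDeriv_ray (H : F → ℝ) :
    Tendsto (fun t : ℝ => omegaDeriv G θ T (t • H) H) atTop (𝓝 (omegaSlope G θ T H)) := by
  simp only [omegaDeriv_apply]
  exact (tendsto_finsetSum _ fun e _ => tendsto_bigonForm_ray (hθ e).1 (hθ e).2 _ _).sub_const _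

/-- Along a ray, `omega` tends to `+∞` if and only if its recession function is positive. -/
lemma tendsto_omega_ray_iff (hside : ∀ f, ∃ e s, G.side e s = f) {H : F → ℝ} (hH : H ≠ 0) :
    Tendsto (fun t : ℝ => omega G θ T (t • H)) atTop atTop ↔ 0 < omegaSlope G θ T H := by
  have hder := hasDerivAt_omega_line G θ T hθ 0 H
  have hmono := strictMono_omegaDeriv_line G θ T hθ hside 0 hH
  simp only [zero_add] at hder hmono
  have hlim := tendsto_omegaDeriv_ray G θ T hθ H
  constructor
  · intro h
    by_contra! hle
    have hanti : Antitone fun t : ℝ => omega G θ T (t • H) :=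
      antitone_of_hasDerivAt_nonpos hder fun t => (hmono.monotone.ge_of_tendsto hlim t).trans hle
    obtain ⟨t, ht, ht0⟩ := ((h.eventually_gt_atTop (omega G θ T ((0 : ℝ) • H))).and
      (eventually_ge_atTop 0)).exists
    exact absurd (hanti ht0) (not_le.2 ht)
  · intro h
    set R := omegaSlope G θ T H
    obtain ⟨t₀, ht₀⟩ := (hlim.eventually (lt_mem_nhds (half_lt_self h))).exists
    have hlow : ∀ t, t₀ ≤ t → R / 2 * (t - t₀) ≤ omega G θ T (t • H) - omega G θ T (t₀ • H) := by
      intro t ht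
      refine (convex_Ici t₀).mul_sub_le_image_sub_of_le_deriv
        (f := fun t : ℝ => omega G θ T (t • H))
        (fun t _ => (hder t).continuousAt.continuousWithinAt)
        (fun t _ => (hder t).differentiableAt.differentiableWithinAt) (fun t ht => ?_)
        t₀ self_mem_Ici t ht ht
      rw [interior_Ici] at ht
      rw [(hder t).deriv]
      exact ht₀.le.trans (hmono (mem_Ioi.1 ht)).le
    have hlin : Tendsto (fun t : ℝ => R / 2 * (t - t₀) + omega G θ T (t₀ • H)) atTop atTop :=
      tendsto_atTop_add_const_right _ _
        ((tendsto_atTop_add_const_right _ (-t₀) tendsto_id).const_mul_atTop (half_pos h))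
    refine tendsto_atTop_mono' _ ?_ hlin
    filter_upwards [eventually_ge_atTop t₀] with t ht
    linarith [hlow t ht]

/-- Since `omega` is convex, it is enough to look at rays. On the indicator function of a set of
faces the recession function is the difference of the two sides of the corresponding subset
inequality, and the general case follows by summing over superlevel sets. -/
lemma tendsto_omega_iff (hT : ∀ f, 0 < T f) (hside : ∀ f, ∃ e s, G.side e s = f) :
    Tendsto (omega G θ T) (cocompact (F → ℝ)) atTop ↔ SubsetInequalities G θ T := by
  have hconv := (strictConvexOn_omega G θ T hθ hside).convexOn
  constructor
  · intro h F' hF'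
    classical
    set H : F → ℝ := fun f => if f ∈ F' then 1 else 0 with hHdef
    obtain ⟨f₀, hf₀⟩ := hF'
    have hH : H ≠ 0 := fun h => by simpa [hHdef, hf₀] using congrFun h f₀
    have h1 := (tendsto_omega_ray_iff G θ T hθ hside hH).1 (h.comp (tendsto_cocompact_smul hH))
    rw [omegaSlope, sub_pos] at h1
    have e1 : ∑ f, T f * H f = ∑ f ∈ F', T f := by simp [hHdef]
    have e2 : ∑ e, 2 * θ e * max (max (H (G.side e true)) (H (G.side e false))) 0 =
        ∑ e with ∃ s, G.side e s ∈ F', 2 * θ e := by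
      rw [Finset.sum_filter]
      refine Finset.sum_congr rfl fun e _ => ?_
      simp only [hHdef, Bool.exists_bool]
      split_ifs <;> simp_all
    rw [e1, e2] at h1
    convert h1
  · intro h
    refine tendsto_cocompact_of_ray hconv
      (contDiff_omega G θ T hθ).continuous fun H hH => ?_
    refine (tendsto_omega_ray_iff G θ T hθ hside hH).2 (sub_pos.2 ?_)
    classical
    -- only the positive part of `H` enters the recession function on the side of the edges
    have h0 := sum_mul_lt_sum_mul_max (fun e => G.side e true) (fun e => G.side e false)
      (fun e => 2 * θ e) T (fun F' hF' => by
        have := h F' hF'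
        simp only [Bool.exists_bool] at this
        simp only [or_comm (a := G.side _ true ∈ F')]
        convert this) (fun f => max (H f) 0) (fun f => le_max_right _ _)
    have e1 : ∀ a b : ℝ, max (max a 0) (max b 0) = max (max a b) 0 := fun a b => by
      rw [max_max_max_comm, max_self]
    simp only [e1] at h0
    have h2 : ∀ f, T f * H f ≤ T f * max (H f) 0 := fun f =>
      mul_le_mul_of_nonneg_left (le_max_left _ _) (hT f).le
    by_cases hneg : ∃ f, H f < 0
    · obtain ⟨f, hf⟩ := hneg
      refine lt_of_lt_of_le (Finset.sum_lt_sum (fun f _ => h2 f) ⟨f, Finset.mem_univ f, ?_⟩) h0.1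
      rw [max_eq_right hf.le, mul_zero]
      exact mul_neg_of_pos_of_neg (hT f) hf
    · push Not at hneg
      have : (fun f => max (H f) 0) = H := funext fun f => max_eq_left (hneg f)
      have h3 := h0.2 (by rwa [this])
      exact lt_of_le_of_lt (Finset.sum_le_sum fun f _ => h2 f) h3

end Omega
end CirclePatterns

namespace CirclePatterns

/-! ### Polar coordinates on the sphere -/

/-- The point of the unit sphere with polar coordinates `(ρ, φ)` about the north pole. -/
noncomputable def polar (ρ φ : ℝ) : Space3 := !₂[sin ρ * cos φ, sin ρ * sin φ, cos ρ]

lemma inner_polar (ρ φ ρ' φ' : ℝ) :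
    inner ℝ (polar ρ φ) (polar ρ' φ') = cos ρ * cos ρ' + sin ρ * sin ρ' * cos (φ - φ') := by
  simp [polar, PiLp.inner_apply, Fin.sum_univ_three, cos_sub]
  ring

lemma norm_polar (ρ φ : ℝ) : ‖polar ρ φ‖ = 1 := by
  have h : ‖polar ρ φ‖ ^ 2 = 1 := by
    rw [← real_inner_self_eq_norm_sq, inner_polar, sub_self, cos_zero]
    linear_combination sin_sq_add_cos_sq ρ
  exact (pow_eq_one_iff_of_nonneg (norm_nonneg _) two_ne_zero).1 h

/-- The third side of a spherical triangle with sides `ρ`, `ρ'` and enclosed angle `a`. -/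
noncomputable def thirdSide (ρ ρ' a : ℝ) : ℝ := arccos (cos ρ * cos ρ' + sin ρ * sin ρ' * cos a)

lemma thirdSide_eq_angle (ρ ρ' φ φ' : ℝ) : thirdSide ρ ρ' (φ' - φ) =
    InnerProductGeometry.angle (polar ρ φ) (polar ρ' φ') := by
  rw [InnerProductGeometry.angle, norm_polar, norm_polar, inner_polar, thirdSide,
    ← cos_neg (φ - φ')]
  simp

lemma thirdSide_comm (ρ ρ' a : ℝ) : thirdSide ρ ρ' a = thirdSide ρ' ρ a := by
  simp only [thirdSide]; congr 1; ring

lemma cos_thirdSide (ρ ρ' a : ℝ) :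
    cos (thirdSide ρ ρ' a) = cos ρ * cos ρ' + sin ρ * sin ρ' * cos a := by
  have h := thirdSide_eq_angle ρ ρ' 0 a
  rw [sub_zero] at h
  rw [h, InnerProductGeometry.cos_angle, norm_polar, norm_polar, inner_polar, zero_sub, cos_neg]
  simp

lemma thirdSide_triangle (ρ₁ ρ₂ ρ₃ a b : ℝ) :
    thirdSide ρ₁ ρ₃ (a + b) ≤ thirdSide ρ₁ ρ₂ a + thirdSide ρ₂ ρ₃ b := by
  have h1 := thirdSide_eq_angle ρ₁ ρ₃ 0 (a + b)
  have h2 := thirdSide_eq_angle ρ₁ ρ₂ 0 a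
  have h3 := thirdSide_eq_angle ρ₂ ρ₃ a (a + b)
  rw [sub_zero] at h1 h2
  rw [add_sub_cancel_left] at h3
  rw [h1, h2, h3]
  exact InnerProductGeometry.angle_le_angle_add_angle _ _ _

lemma thirdSide_mono {ρ ρ' a b : ℝ} (h : 0 ≤ sin ρ) (h' : 0 ≤ sin ρ') (ha : 0 ≤ a) (hab : a ≤ b)
    (hb : b ≤ π) : thirdSide ρ ρ' a ≤ thirdSide ρ ρ' b := by
  apply arccos_le_arccos
  have := cos_le_cos_of_nonneg_of_le_pi ha hb hab
  have := mul_le_mul_of_nonneg_left this (mul_nonneg h h')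
  linarith

/-- The triangle inequality for the cone metric: a gap of angles larger than `π` counts as `π`. -/
lemma thirdSide_triangle_of_le {ρ₁ ρ₂ ρ₃ a b c : ℝ} (h₁ : 0 ≤ sin ρ₁) (h₂ : 0 ≤ sin ρ₂)
    (h₃ : 0 ≤ sin ρ₃) (ha' : a ≤ π) (hb : b ≤ π) (hc : 0 ≤ c) (hc' : c ≤ π)
    (h : c ≤ a + b) : thirdSide ρ₁ ρ₃ c ≤ thirdSide ρ₁ ρ₂ a + thirdSide ρ₂ ρ₃ b := by
  by_cases hab : a + b ≤ π
  · exact (thirdSide_mono h₁ h₃ hc h hab).trans (thirdSide_triangle _ _ _ _ _)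
  · push Not at hab
    have h4 := thirdSide_triangle ρ₁ ρ₂ ρ₃ a (π - a)
    rw [add_sub_cancel] at h4
    have h5 : thirdSide ρ₂ ρ₃ (π - a) ≤ thirdSide ρ₂ ρ₃ b :=
      thirdSide_mono h₂ h₃ (by linarith) (by linarith) hb
    have h6 := thirdSide_mono h₁ h₃ hc hc' le_rfl
    linarith

lemma abs_sub_le_thirdSide {ρ ρ' a : ℝ} (h : 0 ≤ ρ) (hπ : ρ ≤ π) (h' : 0 ≤ ρ') (hπ' : ρ' ≤ π) :
    |ρ - ρ'| ≤ thirdSide ρ ρ' a := by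
  have hs : 0 ≤ sin ρ := sin_nonneg_of_nonneg_of_le_pi h hπ
  have hs' : 0 ≤ sin ρ' := sin_nonneg_of_nonneg_of_le_pi h' hπ'
  have h1 : cos (thirdSide ρ ρ' a) ≤ cos |ρ - ρ'| := by
    rw [cos_thirdSide, cos_abs, cos_sub]
    nlinarith [cos_le_one a, mul_nonneg hs hs']
  by_contra! hlt
  have := cos_lt_cos_of_nonneg_of_le_pi (arccos_nonneg _)
    (by rw [abs_le]; constructor <;> linarith) hlt
  exact absurd h1 (not_le.2 this)

lemma thirdSide_zero_left {ρ : ℝ} (a : ℝ) (h : 0 ≤ ρ) (hπ : ρ ≤ π) : thirdSide 0 ρ a = ρ := by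
  simp [thirdSide, arccos_cos h hπ]

/-- Two points at distance `ρ`, `ρ'` from a vertex at which they span the angle `a ∈ [0, π]` and
whose distance is `|ρ - ρ'|` lie in the same direction. -/
lemma eq_zero_of_thirdSide_eq {ρ ρ' a : ℝ} (h : 0 < sin ρ) (h' : 0 < sin ρ') (ha : 0 ≤ a)
    (ha' : a ≤ π) (he : thirdSide ρ ρ' a = |ρ - ρ'|) : a = 0 := by
  have h1 := cos_thirdSide ρ ρ' a
  rw [he, cos_abs, cos_sub] at h1
  have h2 : sin ρ * sin ρ' * (1 - cos a) = 0 := by linarith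
  have h3 : cos a = cos 0 := by
    rcases mul_eq_zero.1 h2 with h2 | h2
    · exact absurd h2 (by positivity)
    · rw [cos_zero]; linarith
  exact injOn_cos ⟨ha, ha'⟩ ⟨le_rfl, pi_pos.le⟩ h3

/-- If two points at distances `ρ₀`, `ρ` from a vertex span an angle of at least `η` at it, then
their distance is bounded below in terms of `ρ₀` and `η`. -/
lemma cos_thirdSide_le {ρ₀ ρ a η : ℝ} (h₀ : 0 ≤ sin ρ₀) (h : 0 ≤ sin ρ)
    (hη : 0 ≤ η) (ha : η ≤ a) (ha' : a ≤ π) :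
    cos (thirdSide ρ₀ ρ a) ≤ √(1 - sin ρ₀ ^ 2 * sin η ^ 2) := by
  rw [cos_thirdSide]
  have h1 := cos_le_cos_of_nonneg_of_le_pi hη ha' ha
  have h2 := mul_le_mul_of_nonneg_left h1 (mul_nonneg h₀ h)
  refine le_trans (add_le_add_right h2 _) (le_trans (le_abs_self _) (abs_le_sqrt ?_))
  have e0 := sin_sq_add_cos_sq ρ₀
  have e1 := sin_sq_add_cos_sq ρ
  have e2 := sin_sq_add_cos_sq η
  have : 1 - sin ρ₀ ^ 2 * sin η ^ 2 - (cos ρ₀ * cos ρ + sin ρ₀ * sin ρ * cos η) ^ 2 =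
      (cos ρ₀ * sin ρ - sin ρ₀ * cos η * cos ρ) ^ 2 := by
    linear_combination -e0 + (- cos ρ₀ ^ 2 - sin ρ₀ ^ 2 * cos η ^ 2) * e1 - sin ρ₀ ^ 2 * e2
  nlinarith [sq_nonneg (cos ρ₀ * sin ρ - sin ρ₀ * cos η * cos ρ)]

/-! ### The metric of a spherical cone -/

/-- The distance of two angles `φ`, `φ'` in the circle of length `α`. -/
noncomputable def circDist (α φ φ' : ℝ) : ℝ := min |φ - φ'| (α - |φ - φ'|)

lemma circDist_comm (α φ φ' : ℝ) : circDist α φ φ' = circDist α φ' φ := by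
  rw [circDist, circDist, abs_sub_comm]

lemma circDist_nonneg {α φ φ' : ℝ} (h : φ ∈ Ico 0 α) (h' : φ' ∈ Ico 0 α) :
    0 ≤ circDist α φ φ' :=
  le_min (abs_nonneg _) (sub_nonneg.2 (abs_le.2 ⟨by linarith [h.1, h'.2], by linarith [h.2, h'.1]⟩))

lemma circDist_triangle {α φ₁ φ₂ φ₃ : ℝ} (h₁ : φ₁ ∈ Ico 0 α) (h₂ : φ₂ ∈ Ico 0 α)
    (h₃ : φ₃ ∈ Ico 0 α) : circDist α φ₁ φ₃ ≤ circDist α φ₁ φ₂ + circDist α φ₂ φ₃ := by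
  obtain ⟨a1, a2⟩ := h₁
  obtain ⟨b1, b2⟩ := h₂
  obtain ⟨c1, c2⟩ := h₃
  unfold circDist
  rcases abs_cases (φ₁ - φ₃) with ⟨e1, _⟩ | ⟨e1, _⟩ <;>
  rcases abs_cases (φ₁ - φ₂) with ⟨e2, _⟩ | ⟨e2, _⟩ <;>
  rcases abs_cases (φ₂ - φ₃) with ⟨e3, _⟩ | ⟨e3, _⟩ <;>
  rw [e1, e2, e3] <;>
  rcases min_choice (φ₁ - φ₂) (α - (φ₁ - φ₂)) with m | m <;> grind

lemma eq_of_circDist_eq_zero {α φ φ' : ℝ} (h : φ ∈ Ico 0 α) (h' : φ' ∈ Ico 0 α)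
    (he : circDist α φ φ' = 0) : φ = φ' := by
  obtain ⟨a1, a2⟩ := h
  obtain ⟨b1, b2⟩ := h'
  unfold circDist at he
  grind

namespace ConeDisk
variable {α r : ℝ}

/-- The distance of a point of a cone disk from the apex. -/
def rad (x : ConeDisk α r) : ℝ := x.1.1

/-- The angular coordinate of a point of a cone disk. -/
def ang (x : ConeDisk α r) : ℝ := x.1.2

lemma rad_nonneg (x : ConeDisk α r) : 0 ≤ x.rad := by
  rcases x with ⟨p, rfl | h⟩
  · exact le_rfl
  · exact h.1.le

lemma rad_lt (hr : 0 < r) (x : ConeDisk α r) : x.rad < r := by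
  rcases x with ⟨p, rfl | h⟩
  · exact hr
  · exact h.2.1

lemma ang_mem (hα : 0 < α) (x : ConeDisk α r) : x.ang ∈ Ico 0 α := by
  rcases x with ⟨p, rfl | h⟩
  · exact ⟨le_rfl, hα⟩
  · exact h.2.2

lemma ext_of_rad_ang {x y : ConeDisk α r} (h : x.rad = y.rad) (h' : x.ang = y.ang) : x = y :=
  Subtype.ext (Prod.ext h h')

lemma eq_apex_of_rad_eq_zero {x : ConeDisk α r} (h : x.rad = 0) : x = apex α r := by
  rcases x with ⟨p, rfl | h'⟩
  · rfl
  · exact absurd h h'.1.ne'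

@[simp] lemma rad_apex : (apex α r).rad = 0 := rfl

/-- The point of a cone disk with given polar coordinates. -/
def mk (ρ φ : ℝ) (h : 0 < ρ) (h' : ρ < r) (hφ : φ ∈ Ico 0 α) : ConeDisk α r :=
  ⟨(ρ, φ), Or.inr ⟨h, h', hφ.1, hφ.2⟩⟩

lemma exists_eq_mk (x : ConeDisk α r) (hx : x ≠ apex α r) :
    0 < x.rad ∧ x.rad < r ∧ x.ang ∈ Ico 0 α := by
  rcases x with ⟨p, rfl | h⟩
  · exact absurd rfl hx
  · exact ⟨h.1, h.2.1, h.2.2⟩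

lemma coneDist_eq (x y : ConeDisk α r) :
    coneDist α x y = thirdSide x.rad y.rad (min π (circDist α x.ang y.ang)) := rfl

section
variable [hα : Fact (0 < α)] [hr : Fact (0 < r ∧ r ≤ π / 2)]

omit hα in
lemma rad_le (x : ConeDisk α r) : x.rad ≤ π / 2 := (rad_lt hr.1.1 x).le.trans hr.1.2

omit hα in
lemma rad_le_pi (x : ConeDisk α r) : x.rad ≤ π := x.rad_le.trans (by linarith [pi_pos])

omit hα in
lemma sin_rad_nonneg (x : ConeDisk α r) : 0 ≤ sin x.rad :=
  sin_nonneg_of_nonneg_of_le_pi x.rad_nonneg x.rad_le_pi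

omit hα in
lemma sin_rad_pos {x : ConeDisk α r} (hx : 0 < x.rad) : 0 < sin x.rad :=
  sin_pos_of_pos_of_lt_pi hx (x.rad_le.trans_lt (by linarith [pi_pos]))

omit hr in
lemma gap_mem (x y : ConeDisk α r) : min π (circDist α x.ang y.ang) ∈ Icc 0 π :=
  ⟨le_min pi_pos.le (circDist_nonneg (x.ang_mem hα.1) (y.ang_mem hα.1)), min_le_left _ _⟩

/-- The distance `coneDist` is a metric: it is the third side of a spherical triangle whose angle is
the distance on the circle of length `α`, cut off at `π`. -/
noncomputable instance : MetricSpace (ConeDisk α r) where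
  dist x y := coneDist α x y
  dist_self x := by
    have : thirdSide x.rad x.rad (min π (circDist α x.ang x.ang)) = 0 := by
      have h0 : circDist α x.ang x.ang = 0 := by simp [circDist, hα.1.le]
      rw [h0, min_eq_right pi_pos.le, thirdSide, cos_zero, mul_one, ← sq, ← sq, add_comm,
        sin_sq_add_cos_sq, arccos_one]
    exact this
  dist_comm x y := by
    rw [coneDist_eq, coneDist_eq, thirdSide_comm, circDist_comm]
  dist_triangle x y z := by
    simp only [coneDist_eq]
    refine thirdSide_triangle_of_le x.sin_rad_nonneg y.sin_rad_nonneg z.sin_rad_nonneg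
      (gap_mem _ _).2 (gap_mem _ _).2 (gap_mem _ _).1 (gap_mem _ _).2 ?_
    have h1 := circDist_triangle (x.ang_mem hα.1) (y.ang_mem hα.1) (z.ang_mem hα.1)
    have h2 := circDist_nonneg (x.ang_mem hα.1) (y.ang_mem hα.1)
    have h3 := circDist_nonneg (y.ang_mem hα.1) (z.ang_mem hα.1)
    have := pi_pos
    grind
  eq_of_dist_eq_zero {x y} h := by
    change coneDist α x y = 0 at h
    rw [coneDist_eq] at h
    have h1 := abs_sub_le_thirdSide (a := min π (circDist α x.ang y.ang)) x.rad_nonneg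
      x.rad_le_pi y.rad_nonneg y.rad_le_pi
    have h2 : x.rad = y.rad := by
      rw [h] at h1; exact sub_eq_zero.1 (abs_eq_zero.1 (le_antisymm h1 (abs_nonneg _)))
    rcases x.rad_nonneg.eq_or_lt with h0 | h0
    · exact (eq_apex_of_rad_eq_zero h0.symm).trans
        (eq_apex_of_rad_eq_zero (h2.symm.trans h0.symm)).symm
    · have h3 := eq_zero_of_thirdSide_eq (sin_rad_pos h0) (sin_rad_pos (h2 ▸ h0)) (gap_mem x y).1
        (gap_mem x y).2 (by rw [h, h2]; simp)
      refine ext_of_rad_ang h2 (eq_of_circDist_eq_zero (x.ang_mem hα.1) (y.ang_mem hα.1) ?_)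
      have := pi_pos
      grind

lemma dist_eq (x y : ConeDisk α r) :
    dist x y = thirdSide x.rad y.rad (min π (circDist α x.ang y.ang)) := rfl

lemma dist_eq_coneDist (x y : ConeDisk α r) : dist x y = coneDist α x y := rfl

lemma abs_rad_sub_le (x y : ConeDisk α r) : |x.rad - y.rad| ≤ dist x y :=
  abs_sub_le_thirdSide x.rad_nonneg x.rad_le_pi y.rad_nonneg y.rad_le_pi

lemma dist_apex (x : ConeDisk α r) : dist (apex α r) x = x.rad :=
  thirdSide_zero_left _ x.rad_nonneg x.rad_le_pi

/-- Two points at a distance that equals the difference of their radii have the same angle. -/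
lemma ang_eq_of_dist_eq {x y : ConeDisk α r} (hx : 0 < x.rad) (hy : 0 < y.rad)
    (h : dist x y = |x.rad - y.rad|) : x.ang = y.ang := by
  have h3 := eq_zero_of_thirdSide_eq (sin_rad_pos hx) (sin_rad_pos hy) (gap_mem x y).1
    (gap_mem x y).2 h
  refine eq_of_circDist_eq_zero (x.ang_mem hα.1) (y.ang_mem hα.1) ?_
  have := pi_pos
  grind

/-- The closed subdisks of a cone disk are compact. -/
lemma isCompact_rad_le {s : ℝ} (hs : s < r) : IsCompact {x : ConeDisk α r | x.rad ≤ s} := by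
  classical
  -- polar coordinates, with the angles `0` and `α` identified
  let g : ℝ × ℝ → ConeDisk α r := fun p =>
    if h : 0 < p.1 ∧ p.1 < r ∧ 0 ≤ p.2 ∧ p.2 < α then ⟨p, Or.inr h⟩
    else if h : 0 < p.1 ∧ p.1 < r then mk p.1 0 h.1 h.2 ⟨le_rfl, hα.1⟩ else apex α r
  have hg : ∀ p ∈ Icc (0 : ℝ) s ×ˢ Icc (0 : ℝ) α, (g p).rad = p.1 ∧
      (p.1 = 0 ∨ (g p).ang = p.2 ∨ ((g p).ang = 0 ∧ p.2 = α)) := by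
    rintro ⟨ρ, φ⟩ ⟨⟨h1, h2⟩, h3, h4⟩
    simp only at h1 h2 h3 h4 ⊢
    rcases h1.eq_or_lt with rfl | h1
    · simp [g, rad, apex]
    · rcases h4.eq_or_lt with rfl | h4
      · simp [g, h1, h2.trans_lt hs, mk, rad, ang]
      · simp [g, h1, h2.trans_lt hs, h3, h4, rad, ang]
  have hdist : ∀ p ∈ Icc (0 : ℝ) s ×ˢ Icc (0 : ℝ) α, ∀ q ∈ Icc (0 : ℝ) s ×ˢ Icc (0 : ℝ) α,
      dist (g p) (g q) = thirdSide p.1 q.1 (min π (circDist α p.2 q.2)) := by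
    intro p hp q hq
    obtain ⟨h1, h2⟩ := hg p hp
    obtain ⟨h3, h4⟩ := hg q hq
    rw [dist_eq, h1, h3]
    by_cases h0 : p.1 = 0 ∨ q.1 = 0
    · rcases h0 with h0 | h0 <;> simp [thirdSide, h0]
    · push Not at h0
      have h2 := h2.resolve_left h0.1
      have h4 := h4.resolve_left h0.2
      congr 2
      obtain ⟨-, p1, p2⟩ := hp
      obtain ⟨-, q1, q2⟩ := hq
      have := hα.1
      unfold circDist
      grind
  have hcont : ContinuousOn g (Icc (0 : ℝ) s ×ˢ Icc (0 : ℝ) α) := by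
    intro p hp
    rw [ContinuousWithinAt, tendsto_iff_dist_tendsto_zero]
    have h1 : Tendsto (fun q : ℝ × ℝ => thirdSide q.1 p.1 (min π (circDist α q.2 p.2)))
        (𝓝[Icc (0 : ℝ) s ×ˢ Icc (0 : ℝ) α] p)
        (𝓝 (thirdSide p.1 p.1 (min π (circDist α p.2 p.2)))) := by
      have : Continuous (fun q : ℝ × ℝ => thirdSide q.1 p.1 (min π (circDist α q.2 p.2))) := by
        unfold thirdSide circDist
        fun_prop
      exact this.continuousAt.tendsto.mono_left nhdsWithin_le_nhds
    rw [← hdist p hp p hp, dist_self] at h1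
    refine h1.congr' ?_
    filter_upwards [self_mem_nhdsWithin] with q hq
    exact (hdist q hq p hp).symm
  refine ((isCompact_Icc.prod isCompact_Icc).image_of_continuousOn hcont).of_isClosed_subset ?_ ?_
  · have : Continuous (rad : ConeDisk α r → ℝ) := by
      refine continuous_iff_continuousAt.2 fun x => ?_
      rw [ContinuousAt, tendsto_iff_dist_tendsto_zero]
      refine squeeze_zero (fun _ => dist_nonneg) (fun y => abs_rad_sub_le y x) ?_
      exact tendsto_iff_dist_tendsto_zero.1 tendsto_id
    exact isClosed_le this continuous_const
  · intro x hx
    rcases x.rad_nonneg.eq_or_lt with h0 | h0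
    · refine ⟨(0, 0), ⟨⟨le_rfl, x.rad_nonneg.trans hx⟩, le_rfl, hα.1.le⟩, ?_⟩
      rw [eq_apex_of_rad_eq_zero h0.symm]
      simp [g]
    · have ha := x.ang_mem hα.1
      refine ⟨(x.rad, x.ang), ⟨⟨h0.le, hx⟩, ha.1, ha.2.le⟩, ?_⟩
      have : 0 < x.rad ∧ x.rad < r ∧ 0 ≤ x.ang ∧ x.ang < α := ⟨h0, hx.trans_lt hs, ha.1, ha.2⟩
      exact dif_pos this

end
end ConeDisk
end CirclePatterns

namespace CirclePatterns

/-! ### The intrinsic metric of the sphere -/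

/-- The inner product of two points of the unit sphere. -/
noncomputable def sdot (x y : Sphere2) : ℝ := inner ℝ (x : Space3) (y : Space3)

lemma Sphere2.norm_eq (x : Sphere2) : ‖(x : Space3)‖ = 1 := by simp

lemma sdot_comm (x y : Sphere2) : sdot x y = sdot y x := real_inner_comm _ _

lemma sdot_self (x : Sphere2) : sdot x x = 1 := by
  rw [sdot, real_inner_self_eq_norm_sq, x.norm_eq, one_pow]

lemma cos_sphDist (x y : Sphere2) : cos (sphDist x y) = sdot x y := by
  rw [sphDist, InnerProductGeometry.cos_angle, x.norm_eq, y.norm_eq, mul_one, div_one, sdot]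

lemma sphDist_eq_arccos (x y : Sphere2) : sphDist x y = arccos (sdot x y) := by
  rw [sphDist, InnerProductGeometry.angle, x.norm_eq, y.norm_eq, mul_one, div_one, sdot]

lemma sphDist_nonneg (x y : Sphere2) : 0 ≤ sphDist x y := InnerProductGeometry.angle_nonneg _ _

lemma sphDist_le_pi (x y : Sphere2) : sphDist x y ≤ π := InnerProductGeometry.angle_le_pi _ _

lemma sphDist_comm (x y : Sphere2) : sphDist x y = sphDist y x :=
  InnerProductGeometry.angle_comm _ _

lemma sphDist_triangle (x y z : Sphere2) : sphDist x z ≤ sphDist x y + sphDist y z :=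
  InnerProductGeometry.angle_le_angle_add_angle _ _ _

lemma sphDist_self (x : Sphere2) : sphDist x x = 0 := by
  rw [sphDist_eq_arccos, sdot_self, arccos_one]

lemma sphDist_eq_of_sdot {x y : Sphere2} {a : ℝ} (h : 0 ≤ a) (h' : a ≤ π) (he : sdot x y = cos a) :
    sphDist x y = a := by rw [sphDist_eq_arccos, he, arccos_cos h h']

lemma sdot_le_one (x y : Sphere2) : sdot x y ≤ 1 := by rw [← cos_sphDist]; exact cos_le_one _

lemma eq_of_sdot_eq_one {x y : Sphere2} (h : sdot x y = 1) : x = y :=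
  Subtype.ext ((inner_eq_one_iff_of_norm_eq_one x.norm_eq y.norm_eq).1 h)

lemma eq_of_sphDist_eq_zero {x y : Sphere2} (h : sphDist x y = 0) : x = y :=
  eq_of_sdot_eq_one (by rw [← cos_sphDist, h, cos_zero])

lemma mem_sphDisk {o x : Sphere2} {r : ℝ} (h : 0 ≤ r) (h' : r ≤ π) :
    x ∈ sphDisk o r ↔ cos r < sdot o x := by
  rw [← cos_sphDist]
  exact (strictAntiOn_cos.lt_iff_gt ⟨h, h'⟩ ⟨sphDist_nonneg _ _, sphDist_le_pi _ _⟩).symm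

lemma continuous_sdot_right (x : Sphere2) : Continuous (sdot x) := by
  unfold sdot; fun_prop

lemma continuous_sphDist_right (x : Sphere2) : Continuous (sphDist x) := by
  rw [show sphDist x = fun y => arccos (sdot x y) from funext (sphDist_eq_arccos x)]
  exact continuous_arccos.comp (continuous_sdot_right x)

lemma isOpen_sphDisk (o : Sphere2) (r : ℝ) : IsOpen (sphDisk o r) :=
  isOpen_lt (continuous_sphDist_right o) continuous_const

lemma dist_le_sphDist (x y : Sphere2) : dist x y ≤ sphDist x y := by
  rw [Subtype.dist_eq, dist_eq_norm]
  refine abs_le_of_sq_le_sq' ?_ (sphDist_nonneg x y) |>.2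
  rw [norm_sub_sq_real, x.norm_eq, y.norm_eq]
  have := one_sub_sq_div_two_le_cos (x := sphDist x y)
  rw [cos_sphDist, sdot] at this
  linarith

lemma eventually_sphDist_lt (x : Sphere2) {ε : ℝ} (hε : 0 < ε) : ∀ᶠ y in 𝓝 x, sphDist x y < ε :=
  (isOpen_sphDisk x ε).mem_nhds (by rwa [sphDisk, mem_ofPred_eq, sphDist_self])

lemma exists_sphDist_lt_subset {x : Sphere2} {U : Set Sphere2} (hU : U ∈ 𝓝 x) :
    ∃ ε > 0, ∀ y, sphDist x y < ε → y ∈ U := by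
  obtain ⟨ε, hε, h⟩ := Metric.mem_nhds_iff.1 hU
  refine ⟨ε, hε, fun y hy => h ?_⟩
  rw [Metric.mem_ball, dist_comm]
  exact (dist_le_sphDist x y).trans_lt hy

lemma exists_sphDist_lt_of_mem_closure {p : Sphere2} {W : Set Sphere2} (hp : p ∈ closure W)
    {ε : ℝ} (hε : 0 < ε) : ∃ x ∈ W, sphDist p x < ε := by
  obtain ⟨x, hx, hxW⟩ := mem_closure_iff_nhds.1 hp _ (eventually_sphDist_lt p hε)
  exact ⟨x, hxW, hx⟩

/-! ### Linear functions on the sphere -/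

/-- A linear function that vanishes on an open subset of the sphere is zero. -/
lemma eq_zero_of_eventually_inner_eq_zero {x : Sphere2} {m : Space3}
    (h : ∀ᶠ y : Sphere2 in 𝓝 x, inner ℝ m (y : Space3) = 0) : m = 0 := by
  have hx : (x : Space3) ≠ 0 := by
    intro h0; have := x.norm_eq; rw [h0, norm_zero] at this; exact zero_ne_one this
  -- homogenize: the function vanishes on a neighbourhood of `x` in space
  have hlim : Tendsto (fun t : ℝ => (x : Space3) + t • m) (𝓝[≠] 0) (𝓝 (x : Space3)) := by
    have : Continuous fun t : ℝ => (x : Space3) + t • m := by fun_prop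
    simpa using (this.tendsto 0).mono_left nhdsWithin_le_nhds
  obtain ⟨ε, hε, hε'⟩ := exists_sphDist_lt_subset h
  have hangle : Tendsto (fun v : Space3 => InnerProductGeometry.angle (x : Space3) v)
      (𝓝 (x : Space3)) (𝓝 0) := by
    have : ContinuousAt (fun v : Space3 => InnerProductGeometry.angle (x : Space3) v) x :=
      (InnerProductGeometry.continuousAt_angle (x := ((x : Space3), (x : Space3))) hx hx).comp
        (by fun_prop : ContinuousAt (fun v : Space3 => ((x : Space3), v)) (x : Space3))
    simpa [ContinuousAt, InnerProductGeometry.angle_self hx] using this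
  have hev : ∀ᶠ v : Space3 in 𝓝 (x : Space3), inner ℝ m v = 0 := by
    filter_upwards [hangle.eventually_lt_const hε, eventually_ne_nhds hx] with v hv hv0
    have hn : 0 < ‖v‖ := norm_pos_iff.2 hv0
    have := hε' ⟨‖v‖⁻¹ • v, by simp [norm_smul, hn.ne']⟩
      (by rwa [sphDist, InnerProductGeometry.angle_smul_right_of_pos _ _ (inv_pos.2 hn)])
    rw [mem_ofPred_eq, real_inner_smul_right] at this
    exact (mul_eq_zero.1 this).resolve_left (inv_pos.2 hn).ne'
  obtain ⟨t, ht, ht0⟩ := ((hlim.eventually hev).and self_mem_nhdsWithin).exists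
  have h0 := hev.self_of_nhds
  rw [inner_add_right, h0, zero_add, real_inner_smul_right] at ht
  exact inner_self_eq_zero.1 ((mul_eq_zero.1 ht).resolve_left ht0)

lemma eq_of_eventually_sdot_eq {x n n' : Sphere2} (h : ∀ᶠ y in 𝓝 x, sdot n y = sdot n' y) :
    n = n' := by
  refine Subtype.ext (sub_eq_zero.1 (eq_zero_of_eventually_inner_eq_zero (x := x) ?_))
  filter_upwards [h] with y hy
  rw [inner_sub_left]
  exact sub_eq_zero.2 hy

lemma span_eq_top_of_mem_nhds {x : Sphere2} {U : Set Sphere2} (hU : U ∈ 𝓝 x) :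
    Submodule.span ℝ ((fun y : Sphere2 => (y : Space3)) '' U) = ⊤ := by
  rw [← Submodule.orthogonal_eq_bot_iff, Submodule.eq_bot_iff]
  intro m hm
  refine eq_zero_of_eventually_inner_eq_zero (x := x) ?_
  filter_upwards [hU] with y hy
  rw [real_inner_comm]
  exact (Submodule.mem_orthogonal _ _).1 hm _ (Submodule.subset_span ⟨y, hy, rfl⟩)

/-- An isometry between parts of the sphere is the restriction of an orthogonal map; so it pulls
linear functions back to linear functions. -/
lemma exists_sdot_comp_eq {x₀ : Sphere2} {U : Set Sphere2} (hU : U ∈ 𝓝 x₀) (g : Sphere2 → Sphere2)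
    (hg : ∀ x ∈ U, ∀ y ∈ U, sdot (g x) (g y) = sdot x y) (N : Sphere2) :
    ∃ n : Sphere2, ∀ x ∈ U, sdot N (g x) = sdot n x := by
  obtain ⟨b, hbU, hbs, hbi⟩ := exists_linearIndependent ℝ ((fun y : Sphere2 => (y : Space3)) '' U)
  rw [span_eq_top_of_mem_nhds hU] at hbs
  let B : Module.Basis b ℝ Space3 := Module.Basis.mk hbi (by rw [Subtype.range_coe, hbs])
  have hpre : ∀ i : b, ∃ y ∈ U, (y : Space3) = B i := fun i => by
    obtain ⟨y, hy, h⟩ := hbU i.2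
    exact ⟨y, hy, by rw [Module.Basis.mk_apply]; exact h⟩
  choose y hyU hy using hpre
  let L : Space3 →ₗ[ℝ] Space3 := B.constr ℝ fun i => (g (y i) : Space3)
  have hL : ∀ i, L (B i) = g (y i) := fun i => B.constr_basis ℝ _ i
  have hinner : ∀ u v : Space3, inner ℝ (L u) (L v) = inner ℝ u v := by
    have h : ((innerₗ Space3).compl₁₂ L L) = innerₗ Space3 := by
      refine B.ext fun i => B.ext fun j => ?_
      simp only [LinearMap.compl₁₂_apply, innerₗ_apply_apply, hL]
      rw [← hy i, ← hy j]
      exact hg _ (hyU i) _ (hyU j)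
    intro u v
    exact congrArg (fun f => f u v) h
  let Li : Space3 ≃ₗᵢ[ℝ] Space3 := (L.isometryOfInner hinner).toLinearIsometryEquiv rfl
  have hLi : ∀ u, Li u = L u := fun u => rfl
  have hLg : ∀ x ∈ U, L x = g x := by
    intro x hx
    have h0 : ∀ v : Space3, inner ℝ (L x - g x) (L v) = 0 := by
      have h : (innerₗ Space3 (L x - g x)).comp L = 0 := by
        refine B.ext fun i => ?_
        simp only [LinearMap.comp_apply, innerₗ_apply_apply, LinearMap.zero_apply, inner_sub_left,
          hinner]
        rw [hL, ← hy i]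
        exact sub_eq_zero.2 (hg _ hx _ (hyU i)).symm
      exact fun v => congrArg (fun f => f v) h
    have h1 := h0 (Li.symm (L x - g x))
    rw [← hLi (Li.symm _), Li.apply_symm_apply] at h1
    exact sub_eq_zero.1 (inner_self_eq_zero.1 h1)
  refine ⟨⟨Li.symm N, by simp [N.norm_eq]⟩, fun x hx => ?_⟩
  simp only [sdot]
  rw [← hLg x hx, ← hLi]
  conv_lhs => rw [← Li.apply_symm_apply (N : Space3)]
  exact Li.inner_map_map _ _

/-- A function that is locally the restriction of a linear function `⟪n, ·⟫` with a unit vector `n`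
is so globally on connected sets. -/
lemma exists_eq_sdot {W : Set Sphere2} (hW : IsPreconnected W) (u : Sphere2 → ℝ)
    (hu : ∀ x ∈ W, ∃ n, ∀ᶠ y in 𝓝 x, u y = sdot n y) : ∃ n, ∀ x ∈ W, u x = sdot n x := by
  rcases W.eq_empty_or_nonempty with rfl | ⟨x₀, hx₀⟩
  · exact ⟨⟨stdVertex, by simp [norm_stdVertex]⟩, by simp⟩
  choose! n hn using hu
  have key : ∀ x ∈ W, ∀ y ∈ W, n x = n y := by
    intro x hx y hy
    refine hW.induction₂' (fun x y => n x = n y) (fun z hz => ?_) (fun _ _ _ _ _ _ => Eq.trans)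
      hx hy
    filter_upwards [self_mem_nhdsWithin,
      (eventually_eventually_nhds.2 (hn z hz)).filter_mono nhdsWithin_le_nhds] with w hw h
    have : n z = n w := by
      refine eq_of_eventually_sdot_eq (x := w) ?_
      filter_upwards [h, hn w hw] with v h1 h2
      rw [← h1, h2]
    exact ⟨this, this.symm⟩
  exact ⟨n x₀, fun x hx => by rw [key x₀ hx₀ x hx]; exact (hn x hx).self_of_nhds⟩

/-! ### Local isometries from the sphere to cones -/

/-- The difference `φ' - φ` of two angles, modulo `α`, as a real number of least modulus. -/
noncomputable def angDiff (α φ φ' : ℝ) : ℝ :=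
  if |φ' - φ| ≤ α / 2 then φ' - φ else if φ < φ' then φ' - φ - α else φ' - φ + α

/-- The signed difference from `φ₀` is an isometric coordinate of the circle near `φ₀`, so a cone is
a piece of the sphere away from its apex. -/
lemma circDist_eq_abs_angDiff_sub {α φ₀ φ φ' η : ℝ} (h₀ : φ₀ ∈ Ico 0 α) (h : φ ∈ Ico 0 α)
    (h' : φ' ∈ Ico 0 α) (hη : η ≤ α / 4) (hd : circDist α φ₀ φ < η) (hd' : circDist α φ₀ φ' < η) :
    circDist α φ φ' = |angDiff α φ₀ φ - angDiff α φ₀ φ'| ∧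
      |angDiff α φ₀ φ - angDiff α φ₀ φ'| < 2 * η := by
  obtain ⟨a1, a2⟩ := h₀
  obtain ⟨b1, b2⟩ := h
  obtain ⟨c1, c2⟩ := h'
  have k : ∀ x ∈ Ico 0 α, circDist α φ₀ x < η → |angDiff α φ₀ x| < η ∧
      (angDiff α φ₀ x = x - φ₀ ∨ angDiff α φ₀ x = x - φ₀ - α ∨ angDiff α φ₀ x = x - φ₀ + α) := by
    rintro x ⟨x1, x2⟩ hx
    unfold circDist at hx
    unfold angDiff
    split_ifs with h1 h2
    · refine ⟨?_, by simp⟩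
      rw [abs_sub_comm] at hx
      rcases min_lt_iff.1 hx with hx | hx <;> linarith
    · refine ⟨?_, by simp⟩
      rw [abs_of_pos (sub_pos.2 h2)] at h1
      rw [abs_sub_comm, abs_of_pos (sub_pos.2 h2)] at hx
      rw [abs_lt]
      rcases min_lt_iff.1 hx with hx | hx <;> constructor <;> linarith
    · refine ⟨?_, by simp⟩
      rw [abs_of_nonpos (by linarith)] at h1
      rw [abs_of_nonneg (by linarith)] at hx
      rw [abs_lt]
      rcases min_lt_iff.1 hx with hx | hx <;> constructor <;> linarith
  obtain ⟨k1, k2⟩ := k φ ⟨b1, b2⟩ hd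
  obtain ⟨k3, k4⟩ := k φ' ⟨c1, c2⟩ hd'
  generalize angDiff α φ₀ φ = A at *
  generalize angDiff α φ₀ φ' = B at *
  have k5 : |A - B| < 2 * η := by
    have := abs_sub A B
    linarith [abs_sub A B]
  refine ⟨?_, k5⟩
  rw [abs_lt] at k1 k3 k5
  have : φ - φ' = A - B ∨ φ - φ' = A - B + α ∨ φ - φ' = A - B - α := by
    rcases k2 with k2 | k2 | k2 <;> rcases k4 with k4 | k4 | k4
    · left; linarith
    · right; right; linarith
    · right; left; linarith
    · right; left; linarith
    · left; linarith
    · exfalso; linarith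
    · right; right; linarith
    · exfalso; linarith
    · left; linarith
  unfold circDist
  rcases this with h | h | h
  · rw [h, min_eq_left]
    have : |A - B| ≤ α / 2 := abs_le.2 ⟨by linarith, by linarith⟩
    linarith
  · have h1 : |φ - φ'| = A - B + α := by rw [h]; exact abs_of_nonneg (by linarith)
    have h2 : A - B ≤ 0 := by
      by_contra! hp
      linarith
    rw [h1, abs_of_nonpos h2, min_eq_right] <;> linarith
  · have h1 : |φ - φ'| = α - (A - B) := by rw [h, abs_of_nonpos (by linarith)]; ring
    have h2 : 0 ≤ A - B := by
      by_contra! hp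
      linarith
    rw [h1, abs_of_nonneg h2, min_eq_right] <;> linarith

/-- An isometry from an open subset of the sphere to a spherical cone turns the cosine of the
distance from the apex into a linear function: if it hits the apex, this is the definition of the
distance, and otherwise polar coordinates develop the cone onto the sphere near any point other
than the apex. -/
lemma exists_cos_rad_eq_sdot {α r : ℝ} [hα : Fact (0 < α)] [hr : Fact (0 < r ∧ r ≤ π / 2)]
    {x₀ : Sphere2} {U : Set Sphere2} (hU : U ∈ 𝓝 x₀) (c : Sphere2 → ConeDisk α r)
    (hc : ∀ x ∈ U, ∀ y ∈ U, dist (c x) (c y) = sphDist x y) :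
    ∃ n : Sphere2, ∀ᶠ x in 𝓝 x₀, cos (c x).rad = sdot n x := by
  have hx₀ := mem_of_mem_nhds hU
  by_cases ha : c x₀ = ConeDisk.apex α r
  · refine ⟨x₀, ?_⟩
    filter_upwards [hU] with x hx
    rw [← cos_sphDist, ← hc x₀ hx₀ x hx, ha, ConeDisk.dist_apex]
  · set a := c x₀ with hadef
    have ha0 := (a.exists_eq_mk ha).1
    have hsa := ConeDisk.sin_rad_pos ha0
    have hαpos := hα.1
    set η := min α π / 4 with hη
    have hη0 : 0 < η := by have := lt_min hα.1 pi_pos; positivity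
    have hηα : η ≤ α / 4 := by rw [hη]; gcongr; exact min_le_left _ _
    have hηπ : η ≤ π / 4 := by rw [hη]; gcongr; exact min_le_right _ _
    -- close to `a`, the angular distance from `a` is small
    have hsη : 0 < sin η := sin_pos_of_pos_of_lt_pi hη0 (by linarith [pi_pos])
    set κ := √(1 - sin a.rad ^ 2 * sin η ^ 2) with hκ
    have hκ1 : κ < 1 := by
      rw [hκ, sqrt_lt' one_pos]
      have : 0 < sin a.rad ^ 2 * sin η ^ 2 := by positivity
      linarith
    have hnear : ∀ y : ConeDisk α r, κ < cos (dist a y) → circDist α a.ang y.ang < η := by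
      intro y hy
      by_contra! hle
      have := cos_thirdSide_le (ρ₀ := a.rad) (ρ := y.rad)
        (a := min π (circDist α a.ang y.ang)) hsa.le y.sin_rad_nonneg hη0.le
        (le_min (by linarith [pi_pos]) hle) (min_le_left _ _)
      rw [← ConeDisk.dist_eq] at this
      linarith
    set U' := U ∩ {x | κ < sdot x₀ x} with hU'
    have hU'n : U' ∈ 𝓝 x₀ := inter_mem hU
      ((isOpen_lt continuous_const (continuous_sdot_right x₀)).mem_nhds
        (by rw [mem_ofPred_eq, sdot_self]; exact hκ1))
    have hang : ∀ x ∈ U', circDist α a.ang (c x).ang < η := fun x hx => hnear _ (by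
      rw [hadef, hc x₀ hx₀ x hx.1, cos_sphDist]; exact hx.2)
    let g : Sphere2 → Sphere2 := fun x =>
      ⟨polar (c x).rad (angDiff α a.ang (c x).ang), by simp [norm_polar]⟩
    obtain ⟨n, hn⟩ := exists_sdot_comp_eq hU'n g (fun x hx y hy => by
      rw [← cos_sphDist x y, ← hc x hx.1 y hy.1, ConeDisk.dist_eq, cos_thirdSide]
      obtain ⟨h1, h2⟩ := circDist_eq_abs_angDiff_sub (a.ang_mem hα.1) ((c x).ang_mem hα.1)
        ((c y).ang_mem hα.1) hηα (hang x hx) (hang y hy)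
      rw [min_eq_right (by rw [h1]; linarith [pi_pos]), h1, cos_abs]
      exact inner_polar _ _ _ _) ⟨polar 0 0, by simp [norm_polar]⟩
    refine ⟨n, ?_⟩
    filter_upwards [hU'n] with x hx
    rw [← hn x hx]
    simp only [sdot, g, inner_polar]
    simp

end CirclePatterns

namespace CirclePatterns

/-! ### Great circle arcs -/

/-- The unit tangent vectors of the sphere at `o`. -/
def UnitTangent (o : Sphere2) : Type := {w : Space3 // ‖w‖ = 1 ∧ inner ℝ (o : Space3) w = 0}

/-- The great circle of unit speed that starts at `o` in the direction `w`. -/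
noncomputable def arc (o : Sphere2) (w : UnitTangent o) (t : ℝ) : Sphere2 :=
  ⟨cos t • (o : Space3) + sin t • w.1, by
    have h1 : inner ℝ (o : Space3) o = (1 : ℝ) := sdot_self o
    have h2 : inner ℝ w.1 w.1 = (1 : ℝ) := by
      rw [real_inner_self_eq_norm_sq, w.2.1, one_pow]
    have h : ‖cos t • (o : Space3) + sin t • w.1‖ ^ 2 = 1 := by
      rw [← real_inner_self_eq_norm_sq]
      simp only [inner_add_left, inner_add_right, real_inner_smul_left, real_inner_smul_right,
        h1, h2, w.2.2, real_inner_comm (o : Space3) w.1]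
      linear_combination sin_sq_add_cos_sq t
    simpa using (pow_eq_one_iff_of_nonneg (norm_nonneg _) two_ne_zero).1 h⟩

section Arc
variable {o : Sphere2} (w : UnitTangent o)

lemma coe_arc (t : ℝ) : (arc o w t : Space3) = cos t • (o : Space3) + sin t • w.1 := rfl

lemma sdot_arc (p : Sphere2) (t : ℝ) :
    sdot p (arc o w t) = cos t * sdot p o + sin t * inner ℝ (p : Space3) w.1 := by
  simp [sdot, coe_arc, inner_add_right, real_inner_smul_right]

lemma sdot_center_arc (t : ℝ) : sdot o (arc o w t) = cos t := by
  rw [sdot_arc, sdot_self, w.2.2]; ring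

lemma sphDist_center_arc {t : ℝ} (h : 0 ≤ t) (h' : t ≤ π) : sphDist o (arc o w t) = t :=
  sphDist_eq_of_sdot h h' (sdot_center_arc w t)

lemma sdot_arc_arc (s t : ℝ) : sdot (arc o w s) (arc o w t) = cos (s - t) := by
  have h2 : inner ℝ w.1 w.1 = (1 : ℝ) := by
    rw [real_inner_self_eq_norm_sq, w.2.1, one_pow]
  rw [sdot_arc, sdot_comm, sdot_center_arc, coe_arc, inner_add_left, real_inner_smul_left,
    real_inner_smul_left, w.2.2, h2, cos_sub]
  ring

lemma sphDist_arc_arc {s t : ℝ} (h : |s - t| ≤ π) :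
    sphDist (arc o w s) (arc o w t) = |s - t| :=
  sphDist_eq_of_sdot (abs_nonneg _) h (by rw [cos_abs, sdot_arc_arc])

lemma arc_zero : arc o w 0 = o := Subtype.ext (by simp [coe_arc])

lemma continuous_arc : Continuous (arc o w) :=
  Continuous.subtype_mk (by fun_prop) _

lemma coe_arc_eq_combination {ρ : ℝ} (hρ : 0 < sin ρ) (t : ℝ) : (arc o w t : Space3) =
    (sin (ρ - t) / sin ρ) • (o : Space3) + (sin t / sin ρ) • (arc o w ρ : Space3) := by
  rw [coe_arc, coe_arc, smul_add, smul_smul, smul_smul, ← add_assoc, ← add_smul, sin_sub]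
  congr 2
  · field_simp; ring
  · field_simp

end Arc

lemma exists_arc_eq {o x : Sphere2} (h : 0 < sphDist o x) (h' : sphDist o x < π) :
    ∃ w : UnitTangent o, arc o w (sphDist o x) = x := by
  have hs : 0 < sin (sphDist o x) := sin_pos_of_pos_of_lt_pi h h'
  have h1 : inner ℝ (o : Space3) o = (1 : ℝ) := sdot_self o
  have h2 : inner ℝ (x : Space3) x = (1 : ℝ) := sdot_self x
  have h3 : inner ℝ (o : Space3) x = cos (sphDist o x) := (cos_sphDist o x).symm
  have h4 : inner ℝ (x : Space3) o = cos (sphDist o x) := by rw [real_inner_comm, h3]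
  refine ⟨⟨(sin (sphDist o x))⁻¹ • ((x : Space3) - cos (sphDist o x) • (o : Space3)), ?_, ?_⟩, ?_⟩
  · refine (pow_eq_one_iff_of_nonneg (norm_nonneg _) two_ne_zero).1 ?_
    rw [← real_inner_self_eq_norm_sq]
    simp only [inner_sub_left, inner_sub_right, real_inner_smul_left, real_inner_smul_right,
      h1, h2, h3, h4]
    field_simp
    linear_combination (-1 : ℝ) * sin_sq_add_cos_sq (sphDist o x)
  · simp only [inner_sub_right, real_inner_smul_right, h1, h3]; ring
  · refine Subtype.ext ?_
    change cos (sphDist o x) • (o : Space3) + sin (sphDist o x) •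
      ((sin (sphDist o x))⁻¹ • ((x : Space3) - cos (sphDist o x) • (o : Space3))) = x
    rw [smul_smul, mul_inv_cancel₀ hs.ne', one_smul, add_sub_cancel]

/-! ### Spherically convex sets -/

/-- A subset of the sphere without pairs of antipodal points that contains the great circle arc
between any two of its points. -/
def SphConvex (W : Set Sphere2) : Prop :=
  (∀ x ∈ W, ∀ y ∈ W, sphDist x y < π) ∧ ∀ x ∈ W, ∀ y ∈ W, ∀ (z : Sphere2) (a b : ℝ),
    0 ≤ a → 0 ≤ b → (z : Space3) = a • (x : Space3) + b • (y : Space3) → z ∈ W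

lemma one_le_add_of_coe_eq {x y z : Sphere2} {a b : ℝ} (ha : 0 ≤ a) (hb : 0 ≤ b)
    (h : (z : Space3) = a • (x : Space3) + b • (y : Space3)) : 1 ≤ a + b := by
  have := norm_add_le (a • (x : Space3)) (b • (y : Space3))
  rwa [← h, z.norm_eq, norm_smul, norm_smul, x.norm_eq, y.norm_eq, mul_one, mul_one,
    norm_of_nonneg ha, norm_of_nonneg hb] at this

lemma sdot_of_coe_eq {x y z : Sphere2} {a b : ℝ} (o : Sphere2)
    (h : (z : Space3) = a • (x : Space3) + b • (y : Space3)) :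
    sdot o z = a * sdot o x + b * sdot o y := by
  simp [sdot, h, inner_add_right, real_inner_smul_right]

lemma sphConvex_sphDisk (o : Sphere2) {r : ℝ} (hr : 0 < r) (hr' : r ≤ π / 2) :
    SphConvex (sphDisk o r) := by
  refine ⟨fun x hx y hy => ?_, fun x hx y hy z a b ha hb h => ?_⟩
  · have := sphDist_triangle x o y
    rw [sphDist_comm x o] at this
    have h1 : sphDist o x < r := hx
    have h2 : sphDist o y < r := hy
    linarith
  · have hπ : r ≤ π := by linarith [pi_pos]
    rw [mem_sphDisk hr.le hπ] at hx hy ⊢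
    have h1 := one_le_add_of_coe_eq ha hb h
    have h0 : 0 ≤ cos r := cos_nonneg_of_mem_Icc ⟨by linarith, hr'⟩
    rw [sdot_of_coe_eq o h]
    rcases ha.eq_or_lt with rfl | ha
    · have : 0 < b := by linarith
      nlinarith
    · nlinarith

lemma SphConvex.inter {W W' : Set Sphere2} (h : SphConvex W) (h' : SphConvex W') :
    SphConvex (W ∩ W') :=
  ⟨fun x hx y hy => h.1 x hx.1 y hy.1, fun x hx y hy z a b ha hb he =>
    ⟨h.2 x hx.1 y hy.1 z a b ha hb he, h'.2 x hx.2 y hy.2 z a b ha hb he⟩⟩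

/-- The geodesic between two points of a spherically convex set. -/
lemma SphConvex.exists_arc {W : Set Sphere2} (h : SphConvex W) {x y : Sphere2} (hx : x ∈ W)
    (hy : y ∈ W) (hxy : x ≠ y) : ∃ w : UnitTangent x, arc x w (sphDist x y) = y ∧
      ∀ t ∈ Icc 0 (sphDist x y), arc x w t ∈ W := by
  have h0 : 0 < sphDist x y :=
    (sphDist_nonneg x y).lt_of_ne fun h => hxy (eq_of_sphDist_eq_zero h.symm)
  have hπ := h.1 x hx y hy
  obtain ⟨w, hw⟩ := exists_arc_eq h0 hπ
  have hs := sin_pos_of_pos_of_lt_pi h0 hπ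
  refine ⟨w, hw, fun t ht => h.2 x hx y hy _ (sin (sphDist x y - t) / sin (sphDist x y))
    (sin t / sin (sphDist x y)) (div_nonneg (sin_nonneg_of_nonneg_of_le_pi ?_ ?_) hs.le)
    (div_nonneg (sin_nonneg_of_nonneg_of_le_pi ht.1 (ht.2.trans hπ.le)) hs.le) ?_⟩
  · linarith [ht.2]
  · linarith [ht.1]
  · rw [coe_arc_eq_combination w hs t, hw]

lemma SphConvex.isPreconnected {W : Set Sphere2} (h : SphConvex W) : IsPreconnected W := by
  refine isPreconnected_of_forall_pair fun x hx y hy => ?_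
  by_cases hxy : x = y
  · subst hxy
    exact ⟨{x}, by simpa using hx, rfl, rfl, isPreconnected_singleton⟩
  · obtain ⟨w, hw, hW⟩ := h.exists_arc hx hy hxy
    refine ⟨arc x w '' Icc 0 (sphDist x y), ?_, ⟨0, ⟨le_rfl, sphDist_nonneg _ _⟩, arc_zero w⟩,
      ⟨_, ⟨sphDist_nonneg _ _, le_rfl⟩, hw⟩,
      isPreconnected_Icc.image _ (continuous_arc w).continuousOn⟩
    rintro _ ⟨t, ht, rfl⟩
    exact hW t ht

/-! ### Local isometries on spherically convex sets -/

section LocalIsometry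
variable {X : Type*} [MetricSpace X]

/-- `c` preserves the distances of points of `W` that are close to any given point of `W`. -/
def LocallyIsometricOn (c : Sphere2 → X) (W : Set Sphere2) : Prop :=
  ∀ p ∈ W, ∃ ε > 0, ∀ x ∈ W, ∀ y ∈ W, sphDist p x < ε → sphDist p y < ε →
    dist (c x) (c y) = sphDist x y

lemma LocallyIsometricOn.mono {c : Sphere2 → X} {W W' : Set Sphere2}
    (h : LocallyIsometricOn c W) (hW : W' ⊆ W) : LocallyIsometricOn c W' := fun p hp => by
  obtain ⟨ε, hε, h⟩ := h p (hW hp)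
  exact ⟨ε, hε, fun x hx y hy => h x (hW hx) y (hW hy)⟩

/-- A path that is locally nonexpanding is nonexpanding. -/
lemma dist_le_of_locally {f : ℝ → X} {L : ℝ} (hL : 0 ≤ L)
    (hf : ∀ t ∈ Icc 0 L, ∃ ε > 0, ∀ s ∈ Icc 0 L, |s - t| < ε → dist (f t) (f s) ≤ |s - t|) :
    dist (f 0) (f L) ≤ L := by
  have hcont : ContinuousOn f (Icc 0 L) := by
    intro t ht
    obtain ⟨ε, hε, h⟩ := hf t ht
    rw [ContinuousWithinAt, tendsto_iff_dist_tendsto_zero]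
    have h0 : Tendsto (fun s : ℝ => |s - t|) (𝓝[Icc 0 L] t) (𝓝 0) := by
      have : Continuous fun s : ℝ => |s - t| := by fun_prop
      simpa using (this.tendsto t).mono_left nhdsWithin_le_nhds
    refine squeeze_zero' (Eventually.of_forall fun _ => dist_nonneg) ?_ h0
    filter_upwards [self_mem_nhdsWithin, h0.eventually_lt_const hε] with s hs hlt
    rw [dist_comm]
    exact h s hs hlt
  have hsub : Icc 0 L ⊆ {t | t ∈ Icc 0 L ∧ dist (f 0) (f t) ≤ t} := by
    refine IsClosed.Icc_subset_of_forall_exists_gt ?_ ⟨⟨le_rfl, hL⟩, by simp⟩ ?_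
    · have hcl : ContinuousOn (fun t => dist (f 0) (f t) - t) (Icc 0 L) :=
        (continuous_dist.comp_continuousOn (continuousOn_const.prodMk hcont)).sub continuousOn_id
      have := hcl.preimage_isClosed_of_isClosed isClosed_Icc (isClosed_Iic (a := (0 : ℝ)))
      convert this using 1
      ext t
      simp only [mem_inter_iff, mem_ofPred_eq, mem_preimage, mem_Iic,
        sub_nonpos]
      tauto
    · rintro t ⟨⟨ht, hd⟩, ht'⟩ y hy
      obtain ⟨ε, hε, h⟩ := hf t ht
      set s := min (min y L) (t + ε / 2) with hs
      have hts : t < s := lt_min (lt_min hy ht'.2) (by linarith)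
      have hsL : s ≤ L := (min_le_left _ _).trans (min_le_right _ _)
      have hs' : s ≤ t + ε / 2 := min_le_right _ _
      have hsI : s ∈ Icc 0 L := ⟨ht.1.trans hts.le, hsL⟩
      refine ⟨s, ⟨hsI, ?_⟩, hts, (min_le_left _ _).trans (min_le_left _ _)⟩
      have habs : |s - t| = s - t := abs_of_pos (by linarith)
      have h1 := h s hsI (by rw [habs]; linarith)
      have h2 := dist_triangle (f 0) (f t) (f s)
      linarith
  exact (hsub ⟨hL, le_rfl⟩).2

/-- A spherically convex set contains the great circle arc between two of its points, and a local
isometry does not increase the length of the arc. -/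
lemma LocallyIsometricOn.dist_le {c : Sphere2 → X} {W : Set Sphere2}
    (h : LocallyIsometricOn c W) (hW : SphConvex W) {x y : Sphere2} (hx : x ∈ W) (hy : y ∈ W) :
    dist (c x) (c y) ≤ sphDist x y := by
  by_cases hxy : x = y
  · subst hxy; simp [sphDist_nonneg]
  obtain ⟨w, hw, harc⟩ := hW.exists_arc hx hy hxy
  have hπ := hW.1 x hx y hy
  have key := dist_le_of_locally (f := fun t => c (arc x w t)) (sphDist_nonneg x y) (by
    intro t ht
    obtain ⟨ε, hε, hc⟩ := h _ (harc t ht)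
    refine ⟨ε, hε, fun s hs hst => ?_⟩
    have habs : |t - s| ≤ π := abs_le.2 ⟨by linarith [ht.1, hs.2], by linarith [ht.2, hs.1]⟩
    have h1 := sphDist_arc_arc w habs
    rw [abs_sub_comm] at hst
    rw [abs_sub_comm s t, ← h1]
    exact (hc _ (harc t ht) _ (harc s hs) (by rw [sphDist_self]; exact hε)
      (by rw [h1]; exact hst)).le)
  simp only [arc_zero, hw] at key
  exact key

/-- A local isometry on a spherically convex set has limits at the boundary. -/
lemma LocallyIsometricOn.exists_limit [CompactSpace X] {c : Sphere2 → X} {W : Set Sphere2}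
    (h : LocallyIsometricOn c W) (hW : SphConvex W) {p : Sphere2} (hp : p ∈ closure W) :
    ∃ q : X, ∀ x ∈ W, dist q (c x) ≤ sphDist p x := by
  obtain ⟨u, huW, hu⟩ := mem_closure_iff_seq_limit.1 hp
  obtain ⟨q, -, φ, hφ, hq⟩ := isCompact_univ.tendsto_subseq fun n => mem_univ (c (u n))
  refine ⟨q, fun x hx => ?_⟩
  have h1 : Tendsto (fun n => dist (c (u (φ n))) (c x)) atTop (𝓝 (dist q (c x))) :=
    hq.dist tendsto_const_nhds
  have h2 : Tendsto (fun n => sphDist (u (φ n)) x) atTop (𝓝 (sphDist p x)) := by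
    simp only [sphDist_comm _ x]
    exact ((continuous_sphDist_right x).tendsto p).comp (hu.comp hφ.tendsto_atTop)
  exact le_of_tendsto_of_tendsto' h1 h2 fun n => h.dist_le hW (huW _) hx

/-- The local statement `exists_cos_rad_eq_sdot` globalizes on a connected set. -/
lemma LocallyIsometricOn.exists_cos_rad_eq {α r : ℝ} [Fact (0 < α)] [Fact (0 < r ∧ r ≤ π / 2)]
    {c : Sphere2 → ConeDisk α r} {W : Set Sphere2} (h : LocallyIsometricOn c W)
    (hW : IsPreconnected W) (hWo : IsOpen W) : ∃ n, ∀ x ∈ W, cos (c x).rad = sdot n x := by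
  refine exists_eq_sdot hW (fun x => cos (c x).rad) fun x hx => ?_
  obtain ⟨ε, hε, hc⟩ := h x hx
  exact exists_cos_rad_eq_sdot (U := W ∩ {y | sphDist x y < ε})
    (inter_mem (hWo.mem_nhds hx) (eventually_sphDist_lt x hε)) c
    fun y hy z hz => hc y hy.1 z hz.1 hy.2 hz.2

/-- The ball of radius `ε` about `p` is isometric to a disk about the apex of a spherical cone. -/
def IsConicalBall (p : X) (ε : ℝ) : Prop := ∃ α : ℝ, 0 < α ∧ 0 < ε ∧ ε ≤ π / 2 ∧
  ∃ κ : ConeDisk α ε → X, κ (ConeDisk.apex α ε) = p ∧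
    (∀ x y, dist (κ x) (κ y) = coneDist α x y) ∧ ∀ q, dist p q < ε → q ∈ range κ

/-- Near a point of the closure that is mapped to `w`, the cosine of the distance from `w` is a
linear function of the point of the sphere. -/
lemma LocallyIsometricOn.exists_cos_dist_eq {w : X} {ε : ℝ} (hw : IsConicalBall w ε)
    {c : Sphere2 → X} {W : Set Sphere2} (h : LocallyIsometricOn c W)
    (hW : IsPreconnected W) (hWo : IsOpen W) (hball : ∀ x ∈ W, dist w (c x) < ε) :
    ∃ n, ∀ x ∈ W, cos (dist w (c x)) = sdot n x := by
  obtain ⟨α, hα, hε, hε', κ, hκ, hκd, hκr⟩ := hw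
  have : Fact (0 < α) := ⟨hα⟩
  have : Fact (0 < ε ∧ ε ≤ π / 2) := ⟨hε, hε'⟩
  have hpre : ∀ x, ∃ y, x ∈ W → κ y = c x := fun x => by
    by_cases hx : x ∈ W
    · obtain ⟨y, hy⟩ := hκr _ (hball x hx)
      exact ⟨y, fun _ => hy⟩
    · exact ⟨ConeDisk.apex α ε, fun h => absurd h hx⟩
  choose g hg using hpre
  have hgl : LocallyIsometricOn g W := fun p hp => by
    obtain ⟨δ, hδ, hc⟩ := h p hp
    refine ⟨δ, hδ, fun x hx y hy h1 h2 => ?_⟩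
    rw [← hc x hx y hy h1 h2, ← hg x hx, ← hg y hy, hκd]
    rfl
  obtain ⟨n, hn⟩ := hgl.exists_cos_rad_eq hW hWo
  refine ⟨n, fun x hx => ?_⟩
  rw [← hn x hx, ← hg x hx, ← hκ, hκd, ← ConeDisk.dist_eq_coneDist, ConeDisk.dist_apex]

/-- At most one boundary point of a connected open set of the sphere is mapped by a local isometry
to a given point that has a conical neighbourhood. -/
lemma LocallyIsometricOn.eq_of_limit_eq {w : X} {ε : ℝ} (hw : IsConicalBall w ε)
    {c : Sphere2 → X} {W : Set Sphere2} (h : LocallyIsometricOn c W)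
    (hW : IsPreconnected W) (hWo : IsOpen W) (hball : ∀ x ∈ W, dist w (c x) < ε) {p p' : Sphere2}
    (hp : p ∈ closure W) (hp' : p' ∈ closure W) (hpw : ∀ x ∈ W, dist w (c x) ≤ sphDist p x)
    (hpw' : ∀ x ∈ W, dist w (c x) ≤ sphDist p' x) : p = p' := by
  obtain ⟨n, hn⟩ := h.exists_cos_dist_eq hw hW hWo hball
  have key : ∀ p ∈ closure W, (∀ x ∈ W, dist w (c x) ≤ sphDist p x) → n = p := by
    intro p hp hpw
    have hle : ∀ x ∈ W, sdot p x ≤ sdot n x := fun x hx => by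
      rw [← hn x hx, ← cos_sphDist]
      exact cos_le_cos_of_nonneg_of_le_pi dist_nonneg (sphDist_le_pi _ _) (hpw x hx)
    have hcl : closure W ⊆ {x | sdot p x ≤ sdot n x} :=
      closure_minimal hle (isClosed_le (continuous_sdot_right p) (continuous_sdot_right n))
    have h1 : sdot p p ≤ sdot n p := hcl hp
    rw [sdot_self] at h1
    exact eq_of_sdot_eq_one (le_antisymm (sdot_le_one _ _) h1)
  exact (key p hp hpw).symm.trans (key p' hp' hpw')

/-- The boundary points that a local isometry on a convex set maps to a finite set `M` are
isolated. -/
lemma LocallyIsometricOn.exists_isolated [CompactSpace X] (hX : ∀ w : X, ∃ ε, IsConicalBall w ε)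
    {M : Set X} (hM : M.Finite) {c : Sphere2 → X} {W : Set Sphere2} (h : LocallyIsometricOn c W)
    (hW : SphConvex W) (hWo : IsOpen W) {p : Sphere2} (hp : p ∈ closure W) :
    ∃ δ > 0, ∀ p' ∈ closure W, p' ≠ p → sphDist p p' < δ →
      ∀ q' : X, (∀ x ∈ W, dist q' (c x) ≤ sphDist p' x) → q' ∉ M := by
  obtain ⟨q, hq⟩ := h.exists_limit hW hp
  obtain ⟨ε, hε⟩ := hX q
  obtain ⟨-, -, hε0, hεπ, -⟩ := id hε
  obtain ⟨η, hη, hηM⟩ : ∃ η > 0, ∀ q' ∈ M, dist q q' < η → q' = q := by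
    have : (M \ {q})ᶜ ∈ 𝓝 q :=
      (hM.subset sdiff_subset).isClosed.isOpen_compl.mem_nhds (by simp)
    obtain ⟨η, hη, hsub⟩ := Metric.mem_nhds_iff.1 this
    refine ⟨η, hη, fun q' hq' hd => ?_⟩
    by_contra hne
    exact hsub (by rwa [Metric.mem_ball, dist_comm]) ⟨hq', hne⟩
  set δ := min ε η with hδ
  have hδ0 : 0 < δ := lt_min hε0 hη
  refine ⟨δ, hδ0, fun p' hp' hne hd q' hq' hqM => hne ?_⟩
  have hcl : ∀ p' ∈ closure W, sphDist p p' < δ → p' ∈ closure (W ∩ sphDisk p δ) := by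
    intro p' hp' hd
    exact mem_closure_iff_nhds.2 fun t ht => by
      obtain ⟨x, hx, hxW⟩ := mem_closure_iff_nhds.1 hp' _
        (inter_mem ht ((isOpen_sphDisk p δ).mem_nhds hd))
      exact ⟨x, hx.1, hxW, hx.2⟩
  -- the limit is continuous in the boundary point, and missed points are isolated
  have hqq : q' = q := by
    refine hηM q' hqM ?_
    by_contra! hle
    have hgap : 0 < δ - sphDist p p' := by linarith
    obtain ⟨x, hx, hxd⟩ := exists_sphDist_lt_of_mem_closure hp' (half_pos hgap)
    have h1 := dist_triangle_right q q' (c x)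
    have h2 := sphDist_triangle p p' x
    have := min_le_right ε η
    linarith [hq x hx, hq' x hx]
  subst hqq
  have hV : SphConvex (W ∩ sphDisk p δ) :=
    hW.inter (sphConvex_sphDisk p hδ0 ((min_le_left _ _).trans hεπ))
  exact ((h.mono inter_subset_left).eq_of_limit_eq hε hV.isPreconnected
    (hWo.inter (isOpen_sphDisk p δ))
    (fun x hx => (hq x hx.1).trans_lt (lt_of_lt_of_le hx.2 (min_le_left _ _)))
    (hcl p hp (by rwa [sphDist_self])) (hcl p' hp' hd)
    (fun x hx => hq x hx.1) (fun x hx => hq' x hx.1)).symm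

end LocalIsometry

end CirclePatterns

namespace CirclePatterns

/-! ### Two crossing disks in the sphere -/

/-- Two disks of radii less than `π / 2` in the sphere whose boundary circles cross at an exterior
angle of at most `π / 2`, i.e. whose intersection is a bigon of angle at most `π / 2`. -/
structure CrossingDisks (o o' : Sphere2) (r r' : ℝ) : Prop where
  pos : 0 < r
  lt : r < π / 2
  pos' : 0 < r'
  lt' : r' < π / 2
  sdot_le : sdot o o' ≤ cos r * cos r'
  lt_sdot : cos (r + r') < sdot o o'

/-- The orthogonal frame of a point of the sphere and a tangent direction. -/
lemma exists_frame {o : Sphere2} (w : UnitTangent o) : ∃ e : UnitTangent o,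
    inner ℝ w.1 e.1 = (0 : ℝ) ∧ ∀ v : Space3, v = inner ℝ (o : Space3) v • (o : Space3) +
      inner ℝ w.1 v • w.1 + inner ℝ e.1 v • e.1 := by
  have h1 : inner ℝ (o : Space3) o = (1 : ℝ) := sdot_self o
  have horth : Orthonormal ℝ (({0, 1} : Set (Fin 3)).domRestrict ![(o : Space3), w.1, 0]) := by
    constructor
    · rintro ⟨i, rfl | rfl⟩
      · exact o.norm_eq
      · exact w.2.1
    · rintro ⟨i, rfl | rfl⟩ ⟨j, rfl | rfl⟩ hij
      · exact absurd rfl hij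
      · exact w.2.2
      · exact (real_inner_comm _ _).trans w.2.2
      · exact absurd rfl hij
  obtain ⟨b, hb⟩ := horth.exists_orthonormalBasis_extension_of_card_eq (by simp)
  have b0 : b 0 = o := hb 0 (by simp)
  have b1 : b 1 = w.1 := hb 1 (by simp)
  refine ⟨⟨b 2, b.norm_eq_one 2, ?_⟩, ?_, fun v => ?_⟩
  · rw [← b0]; exact b.inner_eq_zero (by decide)
  · rw [← b1]; exact b.inner_eq_zero (by decide)
  · have := b.sum_repr' v
    rw [Fin.sum_univ_three, b0, b1] at this
    exact this.symm

/-- The unit tangent vector that makes the angle `β` with `w` in an orthonormal frame `w`, `e`. -/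
noncomputable def UnitTangent.rotate {o : Sphere2} (w e : UnitTangent o)
    (h : inner ℝ w.1 e.1 = (0 : ℝ)) (β : ℝ) : UnitTangent o :=
  ⟨cos β • w.1 + sin β • e.1, by
    have h1 : inner ℝ w.1 w.1 = (1 : ℝ) := by rw [real_inner_self_eq_norm_sq, w.2.1, one_pow]
    have h2 : inner ℝ e.1 e.1 = (1 : ℝ) := by rw [real_inner_self_eq_norm_sq, e.2.1, one_pow]
    refine ⟨(pow_eq_one_iff_of_nonneg (norm_nonneg _) two_ne_zero).1 ?_, ?_⟩
    · rw [← real_inner_self_eq_norm_sq]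
      simp only [inner_add_left, inner_add_right, real_inner_smul_left, real_inner_smul_right,
        h1, h2, h, real_inner_comm w.1 e.1]
      linear_combination sin_sq_add_cos_sq β
    · simp [inner_add_right, real_inner_smul_right, w.2.2, e.2.2]⟩

lemma UnitTangent.coe_rotate {o : Sphere2} (w e : UnitTangent o)
    (h : inner ℝ w.1 e.1 = (0 : ℝ)) (β : ℝ) :
    (w.rotate e h β).1 = cos β • w.1 + sin β • e.1 := rfl

lemma inner_rotate_rotate {o : Sphere2} (w e : UnitTangent o)
    (h : inner ℝ w.1 e.1 = (0 : ℝ)) (β γ : ℝ) :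
    inner ℝ (w.rotate e h β).1 (w.rotate e h γ).1 = cos (β - γ) := by
  have h1 : inner ℝ w.1 w.1 = (1 : ℝ) := by rw [real_inner_self_eq_norm_sq, w.2.1, one_pow]
  have h2 : inner ℝ e.1 e.1 = (1 : ℝ) := by rw [real_inner_self_eq_norm_sq, e.2.1, one_pow]
  have h3 : inner ℝ e.1 w.1 = (0 : ℝ) := by rw [real_inner_comm, h]
  simp only [UnitTangent.coe_rotate, inner_add_left, inner_add_right, real_inner_smul_left,
    real_inner_smul_right, h1, h2, h, h3, cos_sub]
  ring

lemma sdot_arc_arc_of_inner {o : Sphere2} (w w' : UnitTangent o) (s t : ℝ) :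
    sdot (arc o w s) (arc o w' t) = cos s * cos t + sin s * sin t * inner ℝ w.1 w'.1 := by
  rw [sdot_arc, sdot_comm, sdot_center_arc, coe_arc, inner_add_left, real_inner_smul_left,
    real_inner_smul_left, w'.2.2]
  ring

lemma continuous_arc_rotate {o : Sphere2} (w e : UnitTangent o)
    (h : inner ℝ w.1 e.1 = (0 : ℝ)) (r : ℝ) :
    Continuous fun β => arc o (w.rotate e h β) r := by
  refine Continuous.subtype_mk ?_ _
  simp only [UnitTangent.coe_rotate]
  fun_prop

/-- A circle in the sphere that shares infinitely many points with the circle of centre `o` and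
radius `r` coincides with it. -/
lemma eq_of_infinite_inter {o p : Sphere2} {r s : ℝ} (hr : 0 < r) (hr' : r < π / 2) (hs : 0 < s)
    (hs' : s < π / 2) (w e : UnitTangent o) (h : inner ℝ w.1 e.1 = (0 : ℝ))
    (hframe : ∀ v : Space3, v = inner ℝ (o : Space3) v • (o : Space3) +
      inner ℝ w.1 v • w.1 + inner ℝ e.1 v • e.1) {B : Set ℝ} (hB : B ⊆ Ioo 0 π)
    (hinf : {β ∈ B | sdot p (arc o (w.rotate e h β) r) = cos s}.Infinite) : p = o ∧ s = r := by
  obtain ⟨t, ht, hcard⟩ := hinf.exists_subset_card_eq 3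
  obtain ⟨x, y, z, hxy, hxz, hyz, rfl⟩ := Finset.card_eq_three.1 hcard
  have hsr : sin r ≠ 0 := (sin_pos_of_pos_of_lt_pi hr (by linarith [pi_pos])).ne'
  set A := inner ℝ (p : Space3) w.1 with hA
  set C := inner ℝ (p : Space3) e.1 with hC
  have heq : ∀ β, sdot p (arc o (w.rotate e h β) r) =
      cos r * sdot p o + sin r * (cos β * A + sin β * C) := fun β => by
    rw [sdot_arc, UnitTangent.coe_rotate, inner_add_right, real_inner_smul_right,
      real_inner_smul_right]
  have hmid : ∀ a b : ℝ, a ∈ B → b ∈ B → a ≠ b →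
      sdot p (arc o (w.rotate e h a) r) = cos s → sdot p (arc o (w.rotate e h b) r) = cos s →
      C * cos ((a + b) / 2) = A * sin ((a + b) / 2) := by
    intro a b ha hb hab h1 h2
    rw [heq] at h1 h2
    have h3 : sin r * ((cos a - cos b) * A + (sin a - sin b) * C) = 0 := by linarith
    have h4 := (mul_eq_zero.1 h3).resolve_left hsr
    rw [cos_sub_cos, sin_sub_sin] at h4
    have h5 : 2 * sin ((a - b) / 2) * (C * cos ((a + b) / 2) - A * sin ((a + b) / 2)) = 0 := by
      linarith
    have h6 : sin ((a - b) / 2) ≠ 0 := by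
      have := hB ha; have := hB hb
      intro h0
      rw [sin_eq_zero_iff_of_lt_of_lt (by linarith [this.1, (hB ha).1, pi_pos, this.2])
        (by linarith [this.1, (hB ha).2, pi_pos])] at h0
      exact hab (by linarith)
    exact sub_eq_zero.1 ((mul_eq_zero.1 h5).resolve_left (by simpa using h6))
  have hx := ht (show x ∈ ((({x, y, z} : Finset ℝ)) : Set ℝ) by simp)
  have hy := ht (show y ∈ ((({x, y, z} : Finset ℝ)) : Set ℝ) by simp)
  have hz := ht (show z ∈ ((({x, y, z} : Finset ℝ)) : Set ℝ) by simp)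
  have m1 := hmid x y hx.1 hy.1 hxy hx.2 hy.2
  have m2 := hmid x z hx.1 hz.1 hxz hx.2 hz.2
  have hd : sin ((x + y) / 2 - (x + z) / 2) ≠ 0 := by
    have k1 := hB hy.1; have k2 := hB hz.1
    intro h0
    rw [sin_eq_zero_iff_of_lt_of_lt (by linarith [k1.1, k2.2, pi_pos])
      (by linarith [k1.2, k2.1, pi_pos])] at h0
    exact hyz (by linarith)
  rw [sin_sub] at hd
  have hA0 : A = 0 := by
    have : A * (sin ((x + y) / 2) * cos ((x + z) / 2) - cos ((x + y) / 2) * sin ((x + z) / 2)) =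
        0 := by linear_combination (-cos ((x + z) / 2)) * m1 + cos ((x + y) / 2) * m2
    exact (mul_eq_zero.1 this).resolve_right hd
  have hC0 : C = 0 := by
    have : C * (sin ((x + y) / 2) * cos ((x + z) / 2) - cos ((x + y) / 2) * sin ((x + z) / 2)) =
        0 := by linear_combination (-sin ((x + z) / 2)) * m1 + sin ((x + y) / 2) * m2
    exact (mul_eq_zero.1 this).resolve_right hd
  have hp := hframe p
  rw [real_inner_comm, real_inner_comm (p : Space3) w.1, real_inner_comm (p : Space3) e.1,
    ← hA, ← hC, hA0, hC0, zero_smul, zero_smul, add_zero, add_zero] at hp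
  have hval := hx.2
  rw [heq, hA0, hC0] at hval
  have hcr : 0 < cos r := cos_pos_of_mem_Ioo ⟨by linarith, hr'⟩
  have hcs : 0 < cos s := cos_pos_of_mem_Ioo ⟨by linarith, hs'⟩
  have hpos : 0 < sdot p o := by
    by_contra! hle
    nlinarith
  have hn : |sdot p o| = 1 := by
    have := congrArg norm hp
    rw [norm_smul, p.norm_eq, o.norm_eq, mul_one] at this
    exact this.symm
  rw [abs_of_pos hpos] at hn
  refine ⟨eq_of_sdot_eq_one hn, ?_⟩
  rw [hn] at hval
  exact injOn_cos ⟨hs.le, by linarith⟩ ⟨hr.le, by linarith⟩ (by linarith)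

namespace CrossingDisks
variable {o o' : Sphere2} {r r' : ℝ} (h : CrossingDisks o o' r r')
include h

lemma symm : CrossingDisks o' o r' r :=
  ⟨h.pos', h.lt', h.pos, h.lt, by rw [sdot_comm, mul_comm]; exact h.sdot_le,
    by rw [sdot_comm, add_comm]; exact h.lt_sdot⟩

lemma cos_pos : 0 < cos r := cos_pos_of_mem_Ioo ⟨by linarith [h.pos, pi_pos], h.lt⟩

lemma sin_pos : 0 < sin r := sin_pos_of_pos_of_lt_pi h.pos (by linarith [h.lt, pi_pos])

lemma cos_lt_one : cos r < 1 := by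
  have := sin_sq_add_cos_sq r
  nlinarith [h.sin_pos, h.cos_pos]

lemma lt_pi : r ≤ π := by linarith [h.lt, pi_pos]

lemma mem_right_iff {x : Sphere2} : x ∈ sphDisk o' r' ↔ cos r' < sdot o' x :=
  mem_sphDisk h.pos'.le h.symm.lt_pi

lemma center_notMem : o ∉ sphDisk o' r' := by
  rw [h.mem_right_iff, sdot_comm]
  have := h.sdot_le
  have := h.cos_lt_one
  have := h.symm.cos_pos
  nlinarith

lemma lt_dist : r < sphDist o o' := by
  have h1 : cos (sphDist o o') < cos r := by
    rw [cos_sphDist]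
    have := h.sdot_le
    have := h.symm.cos_lt_one
    have := h.cos_pos
    nlinarith
  by_contra! hle
  exact absurd (cos_le_cos_of_nonneg_of_le_pi (sphDist_nonneg _ _) h.lt_pi hle) (not_le.2 h1)

lemma dist_lt : sphDist o o' < r + r' := by
  have h1 := h.lt_sdot
  rw [← cos_sphDist] at h1
  by_contra! hle
  exact absurd (cos_le_cos_of_nonneg_of_le_pi (by linarith [h.pos, h.pos'])
    (sphDist_le_pi _ _) hle) (not_le.2 h1)

lemma dist_lt_pi : sphDist o o' < π := by linarith [h.dist_lt, h.lt, h.lt']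

lemma ne : o ≠ o' := by
  rintro rfl
  have := h.lt_dist
  rw [sphDist_self] at this
  linarith [h.pos]

lemma region_convex : SphConvex (sphDisk o r ∩ sphDisk o' r') :=
  (sphConvex_sphDisk o h.pos h.lt.le).inter (sphConvex_sphDisk o' h.pos' h.lt'.le)

omit h in
lemma isOpen_region : IsOpen (sphDisk o r ∩ sphDisk o' r') :=
  (isOpen_sphDisk o r).inter (isOpen_sphDisk o' r')

/-- The centre of the first disk has the greater power with respect to the first disk. -/
lemma cos_mul_sdot_lt : cos r * sdot o' o < cos r' := by
  have h1 : cos r * sdot o' o ≤ cos r * (cos r * cos r') :=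
    mul_le_mul_of_nonneg_left (by rw [sdot_comm]; exact h.sdot_le) h.cos_pos.le
  have h2 : 0 < sin r ^ 2 * cos r' := mul_pos (pow_pos h.sin_pos 2) h.symm.cos_pos
  rw [sin_sq] at h2
  nlinarith

/-- A ray from the centre of the first disk does not leave the second disk before it leaves the
first one: the angle of the bigon is at most `π / 2`. -/
lemma arc_mem (w : UnitTangent o) {ρ t : ℝ} (hρ : 0 < ρ) (ht : ρ ≤ t) (htr : t ≤ r)
    (hmem : arc o w ρ ∈ sphDisk o' r') : arc o w t ∈ sphDisk o' r' := by
  rw [h.mem_right_iff, sdot_arc] at hmem ⊢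
  set c := sdot o' o with hc
  set b := inner ℝ (o' : Space3) w.1
  have hcle : c ≤ cos r * cos r' := by rw [hc, sdot_comm]; exact h.sdot_le
  have hltr := h.lt
  have hcr := h.cos_pos
  have hcr' := h.symm.cos_pos
  have hsρ : 0 < sin ρ := sin_pos_of_pos_of_lt_pi hρ (by linarith [pi_pos])
  have hcρ : 0 < cos ρ := cos_pos_of_mem_Ioo ⟨by linarith [pi_pos], by linarith⟩
  have hst : sin ρ ≤ sin t := sin_le_sin_of_le_of_le_pi_div_two (by linarith [pi_pos])
    (by linarith) ht
  have hct : cos t ≤ cos ρ := cos_le_cos_of_nonneg_of_le_pi hρ.le (by linarith [pi_pos]) ht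
  have hcrt : cos r ≤ cos t := cos_le_cos_of_nonneg_of_le_pi (by linarith) h.lt_pi htr
  -- the slope of the function in question exceeds that of the extremal case
  have hkey : c * (1 - cos ρ * cos r) < b * (sin ρ * cos r) := by nlinarith
  have hb : 0 < b := by
    rcases le_or_gt 0 c with h0 | h0
    · have : 0 ≤ c * (1 - cos ρ * cos r) := mul_nonneg h0 (by
        nlinarith [cos_le_one ρ, cos_le_one r])
      by_contra! hb
      nlinarith [mul_pos hsρ hcr]
    · by_contra! hb
      nlinarith
  suffices 0 ≤ c * (cos t - cos ρ) + b * (sin t - sin ρ) by linarith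
  rcases le_or_gt c 0 with h0 | h0
  · nlinarith
  · have e : sin ρ = sin t * cos (t - ρ) - cos t * sin (t - ρ) := by
      rw [← sin_sub]; congr 1; ring
    have hsin : 0 ≤ sin (t - ρ) :=
      sin_nonneg_of_nonneg_of_le_pi (by linarith) (by linarith [pi_pos])
    have h1 : 0 ≤ sin t - sin ρ - cos r * sin (t - ρ) := by
      have : 0 ≤ sin t * (1 - cos (t - ρ)) :=
        mul_nonneg (by linarith) (by linarith [cos_le_one (t - ρ)])
      nlinarith
    have h2 : (1 - cos ρ * cos r) * (sin t - sin ρ) - sin ρ * cos r * (cos ρ - cos t) =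
        sin t - sin ρ - cos r * sin (t - ρ) := by rw [sin_sub]; ring
    have h3 : 0 ≤ (sin ρ * cos r) * (c * (cos t - cos ρ) + b * (sin t - sin ρ)) := by
      nlinarith [mul_nonneg (sub_nonneg.2 hkey.le) (sub_nonneg.2 hst),
        mul_nonneg h0.le h1]
    by_contra! hneg
    nlinarith [mul_pos hsρ hcr]

/-- Along a ray from the centre of the first disk, the power with respect to the second disk
overtakes the power with respect to the first one at most once. -/
lemma power_mono (w : UnitTangent o) {ρ t : ℝ} (hρ : 0 < ρ) (ht : ρ ≤ t) (htr : t ≤ π / 2)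
    (hle : cos r' * sdot o (arc o w ρ) ≤ cos r * sdot o' (arc o w ρ)) :
    cos r' * sdot o (arc o w t) ≤ cos r * sdot o' (arc o w t) := by
  rw [sdot_center_arc, sdot_arc] at hle ⊢
  have hA : 0 < cos r' - cos r * sdot o' o := sub_pos.2 h.cos_mul_sdot_lt
  have hsρ : 0 < sin ρ := sin_pos_of_pos_of_lt_pi hρ (by linarith [pi_pos])
  have hst : sin ρ ≤ sin t := sin_le_sin_of_le_of_le_pi_div_two (by linarith [pi_pos])
    (by linarith) ht
  have hct : cos t ≤ cos ρ := cos_le_cos_of_nonneg_of_le_pi hρ.le (by linarith [pi_pos]) ht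
  have hcρ : 0 ≤ cos ρ := cos_nonneg_of_mem_Icc ⟨by linarith [pi_pos], by linarith⟩
  have h1 : (cos r' - cos r * sdot o' o) * cos ρ ≤ cos r * inner ℝ (o' : Space3) w.1 * sin ρ := by
    linarith
  have hb : 0 ≤ cos r * inner ℝ (o' : Space3) w.1 := by
    by_contra! hb
    nlinarith [mul_nonneg hA.le hcρ]
  nlinarith

/-- If the two powers agree at a point of a ray from the centre `o`, then `o` has the larger power at
the points of the ray before it. -/
lemma power_strict (w : UnitTangent o) {ρ t : ℝ} (ht0 : 0 ≤ t) (ht : t < ρ) (hρ : ρ < π / 2)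
    (hle : cos r' * sdot o (arc o w ρ) = cos r * sdot o' (arc o w ρ)) :
    cos r * sdot o' (arc o w t) < cos r' * sdot o (arc o w t) := by
  by_contra! hlt
  rcases ht0.eq_or_lt with rfl | ht0
  · rw [arc_zero, sdot_self] at hlt
    linarith [h.cos_mul_sdot_lt]
  · rw [sdot_center_arc, sdot_arc] at hle hlt
    have hA : 0 < cos r' - cos r * sdot o' o := sub_pos.2 h.cos_mul_sdot_lt
    have hsρ : 0 < sin ρ := sin_pos_of_pos_of_lt_pi (by linarith) (by linarith [pi_pos])
    have hst : sin t ≤ sin ρ := sin_le_sin_of_le_of_le_pi_div_two (by linarith [pi_pos])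
      (by linarith) ht.le
    have hct : cos ρ < cos t := cos_lt_cos_of_nonneg_of_le_pi ht0.le (by linarith [pi_pos]) ht
    have hcρ : 0 < cos ρ := cos_pos_of_mem_Ioo ⟨by linarith [pi_pos], by linarith⟩
    have h1 : (cos r' - cos r * sdot o' o) * cos ρ = cos r * inner ℝ (o' : Space3) w.1 * sin ρ := by
      linarith
    have hb : 0 ≤ cos r * inner ℝ (o' : Space3) w.1 := by
      by_contra! hb
      nlinarith [mul_nonneg hA.le hcρ.le]
    nlinarith

lemma exists_arc_of_mem {x : Sphere2} (hx : x ∈ sphDisk o r ∩ sphDisk o' r') :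
    0 < sphDist o x ∧ sphDist o x < r ∧ ∃ w : UnitTangent o, arc o w (sphDist o x) = x := by
  have h0 : 0 < sphDist o x := by
    refine (sphDist_nonneg o x).lt_of_ne fun he => h.center_notMem ?_
    rw [eq_of_sphDist_eq_zero he.symm]; exact hx.2
  have hlt : sphDist o x < r := hx.1
  exact ⟨h0, hlt, exists_arc_eq h0 (hlt.trans_le h.lt_pi)⟩

/-- A ray from the first centre whose end point on the first circle lies in the second disk meets
the bigon. -/
lemma exists_arc_mem (w : UnitTangent o) (hw : cos r' < sdot o' (arc o w r)) {s : ℝ} (hs : s < r) :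
    ∃ ρ, s < ρ ∧ 0 < ρ ∧ ρ < r ∧ arc o w ρ ∈ sphDisk o r ∩ sphDisk o' r' := by
  have hcont : Continuous fun ρ => sdot o' (arc o w ρ) :=
    (continuous_sdot_right o').comp (continuous_arc w)
  have hev : ∀ᶠ ρ in 𝓝[<] r, cos r' < sdot o' (arc o w ρ) :=
    (hcont.continuousAt.eventually (lt_mem_nhds hw)).filter_mono nhdsWithin_le_nhds
  obtain ⟨ρ, h1, h2⟩ := (hev.and (Ioo_mem_nhdsLT (max_lt hs h.pos))).exists
  have hρ0 : 0 < ρ := (le_max_right _ _).trans_lt h2.1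
  refine ⟨ρ, (le_max_left _ _).trans_lt h2.1, hρ0, h2.2, ?_, h.mem_right_iff.2 h1⟩
  rw [sphDisk, mem_ofPred_eq, sphDist_center_arc w hρ0.le (h2.2.le.trans h.lt_pi)]
  exact h2.2

lemma arc_mem_closure (w : UnitTangent o) (hw : cos r' < sdot o' (arc o w r)) :
    arc o w r ∈ closure (sphDisk o r ∩ sphDisk o' r') := by
  have hlim : Tendsto (arc o w) (𝓝 r) (𝓝 (arc o w r)) := (continuous_arc w).tendsto r
  rw [mem_closure_iff_nhds]
  intro U hU
  obtain ⟨ε, hε, hεU⟩ := Metric.mem_nhds_iff.1 (hlim hU)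
  obtain ⟨ρ, h1, -, h2, h3⟩ := h.exists_arc_mem w hw (show r - ε < r by linarith)
  exact ⟨arc o w ρ, hεU (by rw [Metric.mem_ball, Real.dist_eq, abs_lt]; constructor <;> linarith),
    h3⟩

lemma arc_notMem (w : UnitTangent o) : arc o w r ∉ sphDisk o r ∩ sphDisk o' r' := fun hmem => by
  have : sphDist o (arc o w r) < r := hmem.1
  rw [sphDist_center_arc w h.pos.le h.lt_pi] at this
  exact lt_irrefl _ this

end CrossingDisks
end CirclePatterns

namespace CirclePatterns

/-! ### Patterns of disks with bigonal overlap -/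

lemma mem_or_of_encard_le_two {Z : Type*} {s : Set Z} (hs : s.encard ≤ 2) {a b c : Z} (ha : a ∈ s)
    (hb : b ∈ s) (hc : c ∈ s) (hab : a ≠ b) : c = a ∨ c = b := by
  by_contra! h
  have h3 : ({a, b, c} : Set Z).encard = 3 :=
    Set.encard_eq_three.2 ⟨a, b, c, hab, h.1.symm, h.2.symm, rfl⟩
  have h1 : ({a, b, c} : Set Z) ⊆ s := by
    rintro z (rfl | rfl | rfl) <;> assumption
  have := (Set.encard_le_encard h1).trans hs
  rw [h3] at this
  exact absurd this (by decide)

lemma exists_ne_of_encard_eq_two {Z : Type*} {s : Set Z} (hs : s.encard = 2) :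
    ∃ a b, a ∈ s ∧ b ∈ s ∧ a ≠ b := by
  obtain ⟨a, b, hab, rfl⟩ := Set.encard_eq_two.1 hs
  exact ⟨a, b, by simp, by simp, hab⟩

lemma encard_eq_two_of_ne {Z : Type*} {s : Set Z} (hs : s.encard ≤ 2) {a b : Z} (ha : a ∈ s)
    (hb : b ∈ s) (hab : a ≠ b) : s.encard = 2 := by
  refine le_antisymm hs ?_
  rw [← Set.encard_pair hab]
  exact Set.encard_le_encard (by rintro z (rfl | rfl) <;> assumption)

/-- A circle pattern on a metric space whose overlap consists of bigons of angles at most `π / 2`: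
a local isometry from the disjoint union of the cone disks of radii `radius f`, which is at most
two-to-one and misses only finitely many points, and for each `e : E` an isometric chart of a
component of the overlap by the intersection of the disks of centres `center e i` and radii
`rad e i`, `i : Bool`, in the sphere. The values of `chart e` outside this intersection are
irrelevant. -/
structure BigonPattern (X E F : Type*) [MetricSpace X] where
  coneAngle : F → ℝ
  radius : F → ℝ
  coneAngle_pos : ∀ f, 0 < coneAngle f
  radius_pos : ∀ f, 0 < radius f
  radius_lt : ∀ f, radius f < π / 2
  immersion : (f : F) → ConeDisk (coneAngle f) (radius f) → X
  isLocalIsometry : ∀ f, IsLocalIsometry (coneDist (coneAngle f)) dist (immersion f)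
  finite_missed : ((⋃ f, range (immersion f))ᶜ).Finite
  two_to_one : ∀ q : X,
    {x : (f : F) × ConeDisk (coneAngle f) (radius f) | immersion x.1 x.2 = q}.encard ≤ 2
  exists_isConicalBall : ∀ p : X, ∃ ε, IsConicalBall p ε
  center : E → Bool → Sphere2
  rad : E → Bool → ℝ
  crossing : ∀ e i, CrossingDisks (center e i) (center e !i) (rad e i) (rad e !i)
  region : E → Set Sphere2
  region_eq : ∀ e i, region e = sphDisk (center e i) (rad e i) ∩ sphDisk (center e !i) (rad e !i)
  chart : E → Sphere2 → X
  chart_isometric : ∀ e, ∀ p ∈ region e, ∃ ε > 0, (∀ x ∈ region e, ∀ y ∈ region e,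
    sphDist p x < ε → sphDist p y < ε → dist (chart e x) (chart e y) = sphDist x y) ∧
    ∀ z, dist (chart e p) z < ε → ∃ x ∈ region e, sphDist p x < ε ∧ chart e x = z
  chart_injOn : ∀ e, InjOn (chart e) (region e)
  overlap : Set X
  overlap_eq : overlap =
    {q | {x : (f : F) × ConeDisk (coneAngle f) (radius f) | immersion x.1 x.2 = q}.encard = 2}
  component : ∀ e, ∃ q ∈ overlap, chart e '' region e = connectedComponentIn overlap q
  component_injective : ∀ e e', chart e '' region e = chart e' '' region e' → e = e'
  component_surjective : ∀ q ∈ overlap, ∃ e, q ∈ chart e '' region e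

namespace BigonPattern
variable {X E F : Type*} [MetricSpace X] (D : BigonPattern X E F)

instance (f : F) : Fact (0 < D.coneAngle f) := ⟨D.coneAngle_pos f⟩

instance (f : F) : Fact (0 < D.radius f ∧ D.radius f ≤ π / 2) :=
  ⟨D.radius_pos f, (D.radius_lt f).le⟩

/-- The disjoint union of the disks of the pattern. -/
abbrev Disks : Type _ := (f : F) × ConeDisk (D.coneAngle f) (D.radius f)

/-- The immersion of the disjoint union of the disks. -/
def map (z : D.Disks) : X := D.immersion z.1 z.2

lemma exists_isometric (f : F) (p : ConeDisk (D.coneAngle f) (D.radius f)) : ∃ ε > 0,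
    (∀ x y, dist p x < ε → dist p y < ε →
      dist (D.immersion f x) (D.immersion f y) = dist x y) ∧
    ∀ δ ≤ ε, ∀ z, dist (D.immersion f p) z < δ → ∃ x, dist p x < δ ∧ D.immersion f x = z := by
  obtain ⟨ε, hε, h1, h2⟩ := D.isLocalIsometry f p
  refine ⟨ε, hε, fun x y => h1 x y, fun δ hδ z hz => ?_⟩
  obtain ⟨x, hx, rfl⟩ := h2 z (hz.trans_le hδ)
  refine ⟨x, ?_, rfl⟩
  rwa [h1 p x (by rw [← ConeDisk.dist_eq_coneDist, dist_self]; exact hε) hx] at hz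

lemma continuous_immersion (f : F) : Continuous (D.immersion f) := by
  refine Metric.continuous_iff.2 fun p η hη => ?_
  obtain ⟨ε, hε, h, -⟩ := D.exists_isometric f p
  refine ⟨min ε η, lt_min hε hη, fun x hx => ?_⟩
  rw [dist_comm] at hx ⊢
  rw [h p x (by rwa [dist_self]) (hx.trans_le (min_le_left _ _))]
  exact hx.trans_le (min_le_right _ _)

lemma isOpenMap_immersion (f : F) : IsOpenMap (D.immersion f) := by
  refine isOpenMap_iff_nhds_le.2 fun p U hU => ?_
  obtain ⟨ε, hε, -, h⟩ := D.exists_isometric f p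
  obtain ⟨η, hη, hηU⟩ := Metric.mem_nhds_iff.1 hU
  refine Metric.mem_nhds_iff.2 ⟨min ε η, lt_min hε hη, fun z hz => ?_⟩
  rw [Metric.mem_ball, dist_comm] at hz
  obtain ⟨x, hx, rfl⟩ := h _ (min_le_left _ _) z hz
  refine hηU (?_ : x ∈ _)
  rw [Metric.mem_ball, dist_comm]
  exact hx.trans_le (min_le_right _ _)

lemma continuous_map : Continuous D.map := continuous_sigma D.continuous_immersion

lemma isOpenMap_map : IsOpenMap D.map := isOpenMap_sigma.2 D.isOpenMap_immersion

lemma exists_injOn_map (z : D.Disks) : ∃ U, IsOpen U ∧ z ∈ U ∧ InjOn D.map U := by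
  obtain ⟨f, y⟩ := z
  obtain ⟨ε, hε, h, -⟩ := D.exists_isometric f y
  refine ⟨Sigma.mk f '' Metric.ball y ε, isOpenMap_sigmaMk _ Metric.isOpen_ball,
    ⟨y, Metric.mem_ball_self hε, rfl⟩, ?_⟩
  rintro _ ⟨a, ha, rfl⟩ _ ⟨b, hb, rfl⟩ hab
  rw [Metric.mem_ball, dist_comm] at ha hb
  have h1 := h a b ha hb
  have h2 : D.immersion f a = D.immersion f b := hab
  rw [h2, dist_self] at h1
  rw [dist_eq_zero.1 h1.symm]

lemma eq_or_eq_of_map_eq {a b c : D.Disks} {q : X} (ha : D.map a = q) (hb : D.map b = q)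
    (hc : D.map c = q) (hab : a ≠ b) : c = a ∨ c = b :=
  mem_or_of_encard_le_two (D.two_to_one q) ha hb hc hab

lemma mem_overlap {q : X} : q ∈ D.overlap ↔ ∃ a b, D.map a = q ∧ D.map b = q ∧ a ≠ b := by
  rw [D.overlap_eq]
  exact ⟨fun h => exists_ne_of_encard_eq_two h,
    fun ⟨a, b, ha, hb, hab⟩ => encard_eq_two_of_ne (D.two_to_one q) ha hb hab⟩

lemma isOpen_region (e : E) : IsOpen (D.region e) := by
  rw [D.region_eq e true]; exact CrossingDisks.isOpen_region

lemma sphConvex_region (e : E) : SphConvex (D.region e) := by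
  rw [D.region_eq e true]; exact (D.crossing e true).region_convex

lemma locallyIsometricOn_chart (e : E) : LocallyIsometricOn (D.chart e) (D.region e) :=
  fun p hp => by
    obtain ⟨ε, hε, h, -⟩ := D.chart_isometric e p hp
    exact ⟨ε, hε, h⟩

lemma chart_mem_overlap {e : E} {x : Sphere2} (hx : x ∈ D.region e) : D.chart e x ∈ D.overlap := by
  obtain ⟨q, -, h⟩ := D.component e
  exact connectedComponentIn_subset _ _ (h ▸ mem_image_of_mem _ hx)

/-- Corresponding neighbourhoods of a point of a bigon and of a point of a disk over it. -/
lemma exists_correspondence {e : E} {x : Sphere2} (hx : x ∈ D.region e) {f : F}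
    {y : ConeDisk (D.coneAngle f) (D.radius f)} (hxy : D.immersion f y = D.chart e x) :
    ∃ ε > 0, ∀ δ ≤ ε,
      (∀ x' ∈ D.region e, sphDist x x' < δ → ∃ y', dist y y' < δ ∧
        D.immersion f y' = D.chart e x') ∧
      (∀ y', dist y y' < δ → ∃ x' ∈ D.region e, sphDist x x' < δ ∧
        D.immersion f y' = D.chart e x') ∧
      ∀ x' ∈ D.region e, ∀ x'' ∈ D.region e, ∀ y' y'', sphDist x x' < δ → sphDist x x'' < δ →
        dist y y' < δ → dist y y'' < δ → D.immersion f y' = D.chart e x' →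
        D.immersion f y'' = D.chart e x'' → dist y' y'' = sphDist x' x'' := by
  obtain ⟨ε₁, hε₁, h1, h2⟩ := D.exists_isometric f y
  obtain ⟨ε₂, hε₂, h3, h4⟩ := D.chart_isometric e x hx
  refine ⟨min ε₁ ε₂, lt_min hε₁ hε₂, fun δ hδ => ⟨fun x' hx' hd => ?_, fun y' hd => ?_, ?_⟩⟩
  · refine h2 δ (hδ.trans (min_le_left _ _)) _ ?_
    rwa [hxy, h3 x hx x' hx' (by rwa [sphDist_self]) (hd.trans_le (hδ.trans (min_le_right _ _)))]
  · have h5 := h1 y y' (by rwa [dist_self]) (hd.trans_le (hδ.trans (min_le_left _ _)))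
    obtain ⟨x', hx', hd', he⟩ := h4 (D.immersion f y')
      (by rw [← hxy, h5]; exact hd.trans_le (hδ.trans (min_le_right _ _)))
    refine ⟨x', hx', ?_, he.symm⟩
    rwa [← h3 x hx x' hx' (by rwa [sphDist_self]) hd', he, ← hxy, h5]
  · intro x' hx' x'' hx'' y' y'' hd' hd'' hc' hc'' he he'
    rw [← h3 x' hx' x'' hx'' (hd'.trans_le (hδ.trans (min_le_right _ _)))
      (hd''.trans_le (hδ.trans (min_le_right _ _))), ← he, ← he',
      h1 y' y'' (hc'.trans_le (hδ.trans (min_le_left _ _)))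
      (hc''.trans_le (hδ.trans (min_le_left _ _)))]

/-- `o` is the centre, in the chart of the bigon `e`, of the disk that contains `z`: the distance
from the apex near `z` is the distance from `o` near the corresponding point of the chart. -/
def IsCenterAt (e : E) (z : D.Disks) (o : Sphere2) : Prop :=
  ∀ᶠ z' in 𝓝 z, ∃ x ∈ D.region e, D.map z' = D.chart e x ∧ sdot o x = cos z'.2.rad

variable {D}

lemma IsCenterAt.eventually {e : E} {z : D.Disks} {o : Sphere2} (h : D.IsCenterAt e z o) :
    ∀ᶠ z' in 𝓝 z, D.IsCenterAt e z' o := eventually_eventually_nhds.2 h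

lemma IsCenterAt.sdot_eq {e : E} {z : D.Disks} {o x : Sphere2} (h : D.IsCenterAt e z o)
    (hx : x ∈ D.region e) (hz : D.map z = D.chart e x) : sdot o x = cos z.2.rad := by
  obtain ⟨x', hx', he, hs⟩ := h.self_of_nhds
  rwa [D.chart_injOn e hx hx' (hz.symm.trans he)]

/-- Both the chart of the bigon and the disk are local isometries, so they differ by a local
isometry from the sphere to the cone, and `exists_cos_rad_eq_sdot` applies. -/
lemma exists_isCenterAt {e : E} {z : D.Disks} {x : Sphere2} (hx : x ∈ D.region e)
    (hz : D.map z = D.chart e x) : ∃ o, D.IsCenterAt e z o := by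
  obtain ⟨f, y⟩ := z
  obtain ⟨ε, hε, h⟩ := D.exists_correspondence hx (show D.immersion f y = _ from hz)
  obtain ⟨h1, -, h3⟩ := h ε le_rfl
  have hpre : ∀ x', ∃ y', x' ∈ D.region e → sphDist x x' < ε →
      dist y y' < ε ∧ D.immersion f y' = D.chart e x' := fun x' => by
    by_cases hx' : x' ∈ D.region e ∧ sphDist x x' < ε
    · obtain ⟨y', hy'⟩ := h1 x' hx'.1 hx'.2
      exact ⟨y', fun _ _ => hy'⟩
    · exact ⟨y, fun a b => absurd ⟨a, b⟩ hx'⟩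
  choose g hg using hpre
  obtain ⟨n, hn⟩ := exists_cos_rad_eq_sdot (U := D.region e ∩ {x' | sphDist x x' < ε})
    (inter_mem ((D.isOpen_region e).mem_nhds hx) (eventually_sphDist_lt x hε)) g
    (fun a ha b hb => h3 a ha.1 b hb.1 _ _ ha.2 hb.2 (hg a ha.1 ha.2).1 (hg b hb.1 hb.2).1
      (hg a ha.1 ha.2).2 (hg b hb.1 hb.2).2)
  refine ⟨n, ?_⟩
  obtain ⟨η, hη, hη'⟩ := exists_sphDist_lt_subset hn
  rw [IsCenterAt, Sigma.nhds_mk, eventually_map]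
  filter_upwards [Metric.ball_mem_nhds y (lt_min hε hη)] with y' hy'
  rw [Metric.mem_ball, dist_comm] at hy'
  obtain ⟨-, h2, -⟩ := h _ (min_le_left ε η)
  obtain ⟨x', hx', hd, he⟩ := h2 y' hy'
  have hdε := hd.trans_le (min_le_left _ _)
  refine ⟨x', hx', he, ?_⟩
  have : y' = g x' := by
    have := h3 x' hx' x' hx' y' (g x') hdε hdε (hy'.trans_le (min_le_left _ _))
      (hg x' hx' hdε).1 he (hg x' hx' hdε).2
    rw [sphDist_self] at this
    exact dist_eq_zero.1 this
  change sdot n x' = cos y'.rad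
  rw [this]
  exact (hη' x' (hd.trans_le (min_le_right _ _))).symm

lemma IsCenterAt.unique {e : E} {z : D.Disks} {o o' : Sphere2} (h : D.IsCenterAt e z o)
    (h' : D.IsCenterAt e z o') : o = o' := by
  obtain ⟨f, y⟩ := z
  obtain ⟨x, hx, he, -⟩ := h.self_of_nhds
  obtain ⟨ε, hε, hcorr⟩ := D.exists_correspondence hx (show D.immersion f y = _ from he)
  have hboth := h.and h'
  rw [Sigma.nhds_mk, eventually_map] at hboth
  obtain ⟨η, hη, hη'⟩ := Metric.eventually_nhds_iff.1 hboth
  refine eq_of_eventually_sdot_eq (x := x) ?_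
  filter_upwards [(D.isOpen_region e).mem_nhds hx, eventually_sphDist_lt x (lt_min hε hη)]
    with x' hx' hd
  obtain ⟨y', hy', he'⟩ := (hcorr _ (min_le_left ε η)).1 x' hx' hd
  obtain ⟨⟨x₁, hx₁, e₁, s₁⟩, x₂, hx₂, e₂, s₂⟩ := hη'
    (show dist y' y < η by rw [dist_comm]; exact hy'.trans_le (min_le_right _ _))
  rw [D.chart_injOn e hx' hx₁ (he'.symm.trans e₁), s₁,
    ← D.chart_injOn e hx' hx₁ (he'.symm.trans e₁), D.chart_injOn e hx' hx₂ (he'.symm.trans e₂), s₂]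

lemma tendsto_chart {e : E} {x : Sphere2} (hx : x ∈ D.region e) :
    Tendsto (D.chart e) (𝓝 x) (𝓝 (D.chart e x)) := by
  obtain ⟨ε, hε, h, -⟩ := D.chart_isometric e x hx
  refine Metric.tendsto_nhds.2 fun η hη => ?_
  filter_upwards [(D.isOpen_region e).mem_nhds hx, eventually_sphDist_lt x (lt_min hε hη)]
    with x' hx' hd
  rw [dist_comm, h x hx x' hx' (by rwa [sphDist_self]) (hd.trans_le (min_le_left _ _))]
  exact hd.trans_le (min_le_right _ _)

/-- Near a point of a bigon with preimages `a ≠ b`, the preimages are the points near `a` and near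
`b`. -/
lemma eventually_fiber_eq {e : E} {x : Sphere2} (hx : x ∈ D.region e) {a b : D.Disks}
    (ha : D.map a = D.chart e x) (hb : D.map b = D.chart e x) (hab : a ≠ b) {U V : Set D.Disks}
    (hU : U ∈ 𝓝 a) (hV : V ∈ 𝓝 b) : ∀ᶠ x' in 𝓝 x, ∃ a' ∈ U, ∃ b' ∈ V, a' ≠ b' ∧
      D.map ⁻¹' {D.chart e x'} = {a', b'} := by
  obtain ⟨U', V', hU', hV', haU, hbV, hdisj⟩ := t2_separation hab
  have h1 : D.map '' (U ∩ U') ∈ 𝓝 (D.chart e x) :=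
    ha ▸ D.isOpenMap_map.image_mem_nhds (inter_mem hU (hU'.mem_nhds haU))
  have h2 : D.map '' (V ∩ V') ∈ 𝓝 (D.chart e x) :=
    hb ▸ D.isOpenMap_map.image_mem_nhds (inter_mem hV (hV'.mem_nhds hbV))
  filter_upwards [tendsto_chart hx h1, tendsto_chart hx h2] with x' h1 h2
  obtain ⟨a', ha', hea⟩ := h1
  obtain ⟨b', hb', heb⟩ := h2
  have hne : a' ≠ b' := fun h => disjoint_left.1 hdisj ha'.2 (h ▸ hb'.2)
  refine ⟨a', ha'.1, b', hb'.1, hne, ?_⟩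
  ext z
  constructor
  · exact fun hz => D.eq_or_eq_of_map_eq hea heb hz hne
  · rintro (rfl | rfl)
    · exact hea
    · exact heb

variable (D)

open Classical in
/-- The face of a point of a disk, and the centre of this disk in the chart of the bigon `e`. -/
noncomputable def label (e : E) (z : D.Disks) : F × Sphere2 :=
  (z.1, if h : ∃ o, D.IsCenterAt e z o then h.choose else D.center e true)

/-- The labels of the two points over a point of a bigon. -/
def labels (e : E) (x : Sphere2) : Set (F × Sphere2) :=
  D.label e '' (D.map ⁻¹' {D.chart e x})

variable {D}

lemma IsCenterAt.label_eq {e : E} {z : D.Disks} {o : Sphere2} (h : D.IsCenterAt e z o) :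
    D.label e z = (z.1, o) := by
  have h' : ∃ o, D.IsCenterAt e z o := ⟨o, h⟩
  rw [label, dif_pos h', h'.choose_spec.unique h]

/-- The labels are locally constant and a bigon is connected. -/
lemma labels_eq {e : E} {x y : Sphere2} (hx : x ∈ D.region e) (hy : y ∈ D.region e) :
    D.labels e x = D.labels e y := by
  refine (D.sphConvex_region e).isPreconnected.induction₂' (fun x y => D.labels e x = D.labels e y)
    (fun x hx => ?_) (fun _ _ _ _ _ _ => Eq.trans) hx hy
  obtain ⟨a, b, ha, hb, hab⟩ := D.mem_overlap.1 (D.chart_mem_overlap hx)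
  have hev : ∀ a, D.map a = D.chart e x → ∀ᶠ a' in 𝓝 a, D.label e a' = D.label e a := by
    rintro ⟨f, a⟩ ha
    obtain ⟨o, ho⟩ := exists_isCenterAt hx ha
    have h1 : range (Sigma.mk f) ∈ 𝓝 (⟨f, a⟩ : D.Disks) :=
      isOpen_range_sigmaMk.mem_nhds ⟨a, rfl⟩
    filter_upwards [ho.eventually, h1] with a' ha' hf
    obtain ⟨a', rfl⟩ := hf
    rw [ha'.label_eq, ho.label_eq]
  have hfib : D.map ⁻¹' {D.chart e x} = {a, b} := by
    ext z
    constructor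
    · exact fun hz => D.eq_or_eq_of_map_eq ha hb hz hab
    · rintro (rfl | rfl)
      · exact ha
      · exact hb
  have := eventually_fiber_eq hx ha hb hab (hev a ha) (hev b hb)
  filter_upwards [this.filter_mono nhdsWithin_le_nhds] with x' hx'
  obtain ⟨a', ha', b', hb', -, hf⟩ := hx'
  have : D.labels e x = D.labels e x' := by
    rw [labels, labels, hf, hfib, image_pair, image_pair, ha', hb']
  exact ⟨this, this.symm⟩

/-- The limit of the chart at a boundary point of a bigon is not in the overlap. -/
lemma notMem_overlap_of_limit {e : E} {p : Sphere2} (hp : p ∈ closure (D.region e))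
    (hp' : p ∉ D.region e) {q : X} (hq : ∀ x ∈ D.region e, dist q (D.chart e x) ≤ sphDist p x) :
    q ∉ D.overlap := by
  intro hqo
  have hcl : q ∈ closure (D.chart e '' D.region e) := by
    refine Metric.mem_closure_iff.2 fun ε hε => ?_
    obtain ⟨x, hx, hd⟩ := exists_sphDist_lt_of_mem_closure hp hε
    exact ⟨_, mem_image_of_mem _ hx, (hq x hx).trans_lt hd⟩
  obtain ⟨q₀, hq₀, hcomp⟩ := D.component e
  have hmem : q ∈ D.chart e '' D.region e := by
    have hpre : IsPreconnected (insert q (connectedComponentIn D.overlap q₀)) := by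
      refine isPreconnected_connectedComponentIn.subset_closure (subset_insert _ _) ?_
      rw [← hcomp]
      exact insert_subset hcl subset_closure
    rw [hcomp]
    exact hpre.subset_connectedComponentIn (mem_insert_of_mem _ (mem_connectedComponentIn hq₀))
      (insert_subset hqo (connectedComponentIn_subset _ _)) (mem_insert _ _)
  obtain ⟨x, hx, rfl⟩ := hmem
  obtain ⟨ε, hε, h1, h2⟩ := D.chart_isometric e x hx
  have hpx : 0 < sphDist x p := (sphDist_nonneg _ _).lt_of_ne fun h =>
    hp' (eq_of_sphDist_eq_zero h.symm ▸ hx)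
  obtain ⟨y, hy, hd⟩ := exists_sphDist_lt_of_mem_closure hp
    (lt_min hε (half_pos hpx) : 0 < min ε (sphDist x p / 2))
  obtain ⟨y', hy', hd', he⟩ := h2 (D.chart e y)
    ((hq y hy).trans_lt (hd.trans_le (min_le_left _ _)))
  rw [D.chart_injOn e hy' hy he] at hd'
  have h3 := h1 x hx y hy (by rwa [sphDist_self]) hd'
  have h4 := hq y hy
  have h5 := sphDist_triangle x y p
  rw [sphDist_comm y p] at h5
  have := hd.trans_le (min_le_right _ _)
  linarith

/-- The label of a point over a bigon determines the distance from the apex. -/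
lemma exists_of_mem_labels {e : E} {x : Sphere2} (hx : x ∈ D.region e) {l : F × Sphere2}
    (hl : l ∈ D.labels e x) : ∃ y : ConeDisk (D.coneAngle l.1) (D.radius l.1),
      D.immersion l.1 y = D.chart e x ∧ D.IsCenterAt e ⟨l.1, y⟩ l.2 ∧ sdot l.2 x = cos y.rad := by
  obtain ⟨⟨f, y⟩, hz, rfl⟩ := hl
  obtain ⟨o, ho⟩ := exists_isCenterAt hx hz
  rw [ho.label_eq]
  exact ⟨y, hz, ho, ho.sdot_eq hx hz⟩

lemma labels_finite {e : E} {x : Sphere2} : (D.labels e x).Finite := by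
  refine Finite.image _ (Set.finite_of_encard_le_coe (k := 2) ?_)
  exact D.two_to_one _

/-- If the limit of the chart at a boundary point of a bigon lies in a disk, then the boundary
point lies on the boundary circle of one of the two disks over the bigon: otherwise the two points
over a nearby point of the bigon would both be close to the only point over the limit. -/
lemma exists_label_of_limit {e : E} {p : Sphere2} (hp : p ∈ closure (D.region e))
    (hp' : p ∉ D.region e) {q : X} (hq : ∀ x ∈ D.region e, dist q (D.chart e x) ≤ sphDist p x)
    (hqm : q ∈ range D.map) {x₀ : Sphere2} (hx₀ : x₀ ∈ D.region e) :
    ∃ l ∈ D.labels e x₀, sdot l.2 p = cos (D.radius l.1) := by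
  by_contra! hne
  obtain ⟨z, hz⟩ := hqm
  obtain ⟨U, hU, hzU, hinj⟩ := D.exists_injOn_map z
  have hlt : ∀ l ∈ D.labels e x₀, cos (D.radius l.1) < sdot l.2 p := by
    intro l hl
    refine lt_of_le_of_ne ?_ (hne l hl).symm
    have hle : ∀ x ∈ D.region e, cos (D.radius l.1) ≤ sdot l.2 x := fun x hx => by
      rw [labels_eq hx₀ hx] at hl
      obtain ⟨y, -, -, hs⟩ := exists_of_mem_labels hx hl
      rw [hs]
      exact cos_le_cos_of_nonneg_of_le_pi y.rad_nonneg
        (by linarith [D.radius_lt l.1, pi_pos]) (y.rad_lt (D.radius_pos _)).le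
    exact closure_minimal hle (isClosed_le continuous_const (continuous_sdot_right l.2)) hp
  -- the points over the bigon near `p` stay in a compact part `K` of the disks
  let s : F × Sphere2 → ℝ := fun l => arccos ((cos (D.radius l.1) + sdot l.2 p) / 2)
  let K : Set D.Disks := ⋃ l ∈ D.labels e x₀, Sigma.mk l.1 '' {y | y.rad ≤ s l}
  have hK : IsCompact K := by
    refine labels_finite.isCompact_biUnion fun l hl => ?_
    refine (ConeDisk.isCompact_rad_le ?_).image continuous_sigmaMk
    have h1 := hlt l hl
    have h2 := D.radius_pos l.1
    have h3 := D.radius_lt l.1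
    calc s l < arccos (cos (D.radius l.1)) := by
          refine arccos_lt_arccos (neg_one_le_cos _) (by linarith) ?_
          linarith [sdot_le_one l.2 p]
      _ = D.radius l.1 := arccos_cos h2.le (by linarith [pi_pos])
  have hKU : IsCompact (D.map '' (K \ U)) := (hK.diff hU).image D.continuous_map
  -- `q` is not in the overlap, so `z` is the only point over it
  have hqK : q ∉ D.map '' (K \ U) := by
    rintro ⟨z', ⟨-, hz'U⟩, hz'⟩
    exact notMem_overlap_of_limit hp hp' hq
      (D.mem_overlap.2 ⟨z, z', hz, hz', fun h => hz'U (h ▸ hzU)⟩)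
  obtain ⟨δ, hδ, hδK⟩ := Metric.mem_nhds_iff.1 (hKU.isClosed.isOpen_compl.mem_nhds hqK)
  have hnear : ∀ᶠ x in 𝓝 p, sphDist p x < δ ∧ ∀ l ∈ D.labels e x₀,
      (cos (D.radius l.1) + sdot l.2 p) / 2 < sdot l.2 x := by
    refine (eventually_sphDist_lt p hδ).and (labels_finite.eventually_all.2 fun l hl => ?_)
    exact (continuous_sdot_right l.2).continuousAt.eventually
      (lt_mem_nhds (by linarith [hlt l hl]))
  obtain ⟨x, ⟨hxd, hxs⟩, hx⟩ := mem_closure_iff_nhds.1 hp _ hnear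
  obtain ⟨a, b, ha, hb, hab⟩ := D.mem_overlap.1 (D.chart_mem_overlap hx)
  have hmem : ∀ a, D.map a = D.chart e x → a ∈ U := by
    intro a ha
    obtain ⟨o, ho⟩ := exists_isCenterAt hx ha
    have hl : D.label e a ∈ D.labels e x₀ := by
      rw [labels_eq hx₀ hx]; exact mem_image_of_mem _ ha
    rw [ho.label_eq] at hl
    by_contra haU
    have haK : a ∈ K := by
      refine mem_biUnion hl ⟨a.2, ?_, rfl⟩
      have h1 := hxs _ hl
      rw [ho.sdot_eq hx ha] at h1
      calc a.2.rad = arccos (cos a.2.rad) := (arccos_cos a.2.rad_nonneg a.2.rad_le_pi).symm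
        _ ≤ s (a.1, o) := arccos_le_arccos h1.le
    refine hδK (show D.chart e x ∈ Metric.ball q δ from ?_) ⟨a, ⟨haK, haU⟩, ha⟩
    rw [Metric.mem_ball, dist_comm]
    exact (hq x hx).trans_lt hxd
  exact hab (hinj (hmem a ha) (hmem b hb) (ha.trans hb.symm))

end BigonPattern
end CirclePatterns

namespace CirclePatterns
namespace BigonPattern
variable {X E F : Type*} [MetricSpace X] {D : BigonPattern X E F}

/-! ### The two disks over a bigon -/

lemma center_injective (D : BigonPattern X E F) {e : E} {i j : Bool}
    (h : D.center e i = D.center e j) : i = j := by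
  by_contra hne
  rw [Bool.eq_not_of_ne (Ne.symm hne)] at h
  exact (D.crossing e i).ne h

lemma exists_direction (D : BigonPattern X E F) (e : E) (i : Bool) :
    ∃ w : UnitTangent (D.center e i),
      arc (D.center e i) w (sphDist (D.center e i) (D.center e !i)) = D.center e !i :=
  exists_arc_eq ((D.crossing e i).pos.trans (D.crossing e i).lt_dist) (D.crossing e i).dist_lt_pi

lemma sdot_rotate {e : E} {i : Bool} {w w' : UnitTangent (D.center e i)}
    (hw : arc (D.center e i) w (sphDist (D.center e i) (D.center e !i)) = D.center e !i)
    (h : inner ℝ w.1 w'.1 = (0 : ℝ)) (β t : ℝ) :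
    sdot (D.center e !i) (arc (D.center e i) (w.rotate w' h β) t) =
      cos (sphDist (D.center e i) (D.center e !i)) * cos t +
        sin (sphDist (D.center e i) (D.center e !i)) * sin t * cos β := by
  conv_lhs => rw [← hw]
  rw [sdot_arc_arc_of_inner, UnitTangent.coe_rotate, inner_add_right, real_inner_smul_right,
    real_inner_smul_right, h, real_inner_self_eq_norm_sq, w.2.1]
  ring

/-- Each of the two boundary circles of a bigon is the boundary circle of a disk over it: only
finitely many points of the circle are missed by the pattern. -/
lemma exists_label_center [CompactSpace X] (D : BigonPattern X E F) (e : E) (i : Bool)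
    {x₀ : Sphere2} (hx₀ : x₀ ∈ D.region e) :
    ∃ f, (f, D.center e i) ∈ D.labels e x₀ ∧ D.radius f = D.rad e i := by
  have hcr := D.crossing e i
  obtain ⟨w, hw⟩ := D.exists_direction e i
  obtain ⟨w', h, hframe⟩ := exists_frame w
  set P : ℝ → Sphere2 := fun β => arc (D.center e i) (w.rotate w' h β) (D.rad e i) with hP
  have hPc : Continuous P := continuous_arc_rotate w w' h _
  have hR := D.region_eq e i
  have h0 : cos (D.rad e !i) < sdot (D.center e !i) (P 0) := by
    rw [hP]
    simp only [sdot_rotate hw, cos_zero, mul_one, ← cos_sub]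
    have h1 := hcr.lt_dist
    have h2 := hcr.dist_lt
    exact cos_lt_cos_of_nonneg_of_le_pi (by linarith) (by linarith [hcr.lt', pi_pos])
      (by linarith)
  have hcl : ∀ β, cos (D.rad e !i) < sdot (D.center e !i) (P β) → P β ∈ closure (D.region e) :=
    fun β hβ => by rw [hR]; exact hcr.arc_mem_closure _ hβ
  have hnot : ∀ β, P β ∉ D.region e := fun β => by rw [hR]; exact hcr.arc_notMem _
  obtain ⟨δ, hδ, hiso⟩ := (D.locallyIsometricOn_chart e).exists_isolated D.exists_isConicalBall
    D.finite_missed (D.sphConvex_region e) (D.isOpen_region e) (hcl 0 h0)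
  have hev : ∀ᶠ β in 𝓝[>] (0 : ℝ), (cos (D.rad e !i) < sdot (D.center e !i) (P β) ∧
      sphDist (P 0) (P β) < δ) ∧ β ∈ Ioo 0 π :=
    (((((continuous_sdot_right _).comp hPc).continuousAt.eventually (lt_mem_nhds h0)).and
      (hPc.continuousAt.eventually (eventually_sphDist_lt (P 0) hδ))).filter_mono
      nhdsWithin_le_nhds).and (Ioo_mem_nhdsGT pi_pos)
  obtain ⟨b, hb0, hb⟩ := mem_nhdsGT_iff_exists_Ioo_subset.1 hev
  have hne : ∀ β ∈ Ioo 0 b, P β ≠ P 0 := by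
    intro β hβ heq
    have h1 : sdot (D.center e !i) (P β) = sdot (D.center e !i) (P 0) := by rw [heq]
    rw [hP] at h1
    simp only [sdot_rotate hw, cos_zero] at h1
    have h2 : 0 < sin (sphDist (D.center e i) (D.center e !i)) :=
      sin_pos_of_pos_of_lt_pi (hcr.pos.trans hcr.lt_dist) hcr.dist_lt_pi
    have h3 : cos β < cos 0 :=
      cos_lt_cos_of_nonneg_of_le_pi le_rfl (hb hβ).2.2.le hβ.1
    rw [cos_zero] at h3
    nlinarith [mul_pos h2 hcr.sin_pos]
  -- the boundary points `P β` are not mapped to missed points, so some sheet ends there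
  have hlab : ∀ β ∈ Ioo 0 b, ∃ l ∈ D.labels e x₀, sdot l.2 (P β) = cos (D.radius l.1) := by
    intro β hβ
    obtain ⟨⟨h1, h2⟩, -⟩ := hb hβ
    obtain ⟨q, hq⟩ := (D.locallyIsometricOn_chart e).exists_limit (D.sphConvex_region e) (hcl β h1)
    have hqm := hiso (P β) (hcl β h1) (hne β hβ) h2 q hq
    rw [mem_compl_iff, not_not] at hqm
    obtain ⟨f, y, hy⟩ := mem_iUnion.1 hqm
    exact exists_label_of_limit (hcl β h1) (hnot β) hq ⟨⟨f, y⟩, hy⟩ hx₀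
  -- one of the finitely many boundary circles contains infinitely many of these points
  have hinf : (⋃ l ∈ D.labels e x₀,
      {β ∈ Ioo 0 b | sdot l.2 (P β) = cos (D.radius l.1)}).Infinite := by
    refine (Ioo_infinite hb0).mono fun β hβ => ?_
    obtain ⟨l, hl, hs⟩ := hlab β hβ
    exact mem_biUnion hl ⟨hβ, hs⟩
  obtain ⟨l, hl, hlinf⟩ : ∃ l ∈ D.labels e x₀,
      {β ∈ Ioo 0 b | sdot l.2 (P β) = cos (D.radius l.1)}.Infinite := by
    by_contra! hfin
    exact hinf (labels_finite.biUnion fun l hl => hfin l hl)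
  obtain ⟨h1, h2⟩ := eq_of_infinite_inter hcr.pos hcr.lt (D.radius_pos l.1) (D.radius_lt l.1) w w' h
    hframe (fun β hβ => (hb hβ).2) hlinf
  exact ⟨l.1, h1 ▸ hl, h2⟩

lemma region_nonempty (D : BigonPattern X E F) (e : E) : (D.region e).Nonempty := by
  obtain ⟨q, hq, h⟩ := D.component e
  have : (D.chart e '' D.region e).Nonempty := h ▸ ⟨q, mem_connectedComponentIn hq⟩
  exact image_nonempty.1 this

/-- The structure of a bigon: it consists of the points common to two pieces of disks, which
are developed onto the sphere around the two centres. -/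
lemma exists_lift [CompactSpace X] (D : BigonPattern X E F) (e : E) : ∃ f : Bool → F,
    (∀ i, D.radius (f i) = D.rad e i) ∧
    ∃ ζ : (i : Bool) → Sphere2 → ConeDisk (D.coneAngle (f i)) (D.radius (f i)),
      ∀ x ∈ D.region e, (∀ i, D.immersion (f i) (ζ i x) = D.chart e x ∧
        D.IsCenterAt e ⟨f i, ζ i x⟩ (D.center e i)) ∧
        ∀ z, D.map z = D.chart e x → ∃ i, z = ⟨f i, ζ i x⟩ := by
  obtain ⟨x₀, hx₀⟩ := D.region_nonempty e
  choose f hf hr using fun i => D.exists_label_center e i hx₀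
  have hpre : ∀ i x, ∃ y : ConeDisk (D.coneAngle (f i)) (D.radius (f i)), x ∈ D.region e →
      D.immersion (f i) y = D.chart e x ∧ D.IsCenterAt e ⟨f i, y⟩ (D.center e i) := by
    intro i x
    by_cases hx : x ∈ D.region e
    · obtain ⟨y, h1, h2, -⟩ := exists_of_mem_labels hx (labels_eq hx₀ hx ▸ hf i)
      exact ⟨y, fun _ => ⟨h1, h2⟩⟩
    · exact ⟨ConeDisk.apex _ _, fun h => absurd h hx⟩
  choose ζ hζ using hpre
  refine ⟨f, hr, ζ, fun x hx => ⟨fun i => hζ i x hx, fun z hz => ?_⟩⟩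
  -- the two sheets are distinct because they have distinct centres, and there are no others
  have hne : (⟨f true, ζ true x⟩ : D.Disks) ≠ ⟨f false, ζ false x⟩ := by
    intro h
    have h1 := (hζ true x hx).2
    rw [h] at h1
    exact (D.crossing e true).ne (h1.unique (hζ false x hx).2)
  rcases D.eq_or_eq_of_map_eq (a := ⟨f true, ζ true x⟩) (b := ⟨f false, ζ false x⟩)
    (hζ true x hx).1 (hζ false x hx).1 hz hne with h | h
  · exact ⟨true, h⟩
  · exact ⟨false, h⟩

section
variable [CompactSpace X] (D)

/-- The face of the disk on side `i` of the bigon `e`. -/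
noncomputable def faceOf (e : E) (i : Bool) : F := (D.exists_lift e).choose i

lemma radius_faceOf (e : E) (i : Bool) : D.radius (D.faceOf e i) = D.rad e i :=
  (D.exists_lift e).choose_spec.1 i

/-- The lift of the bigon `e` to the disk on its side `i`. -/
noncomputable def lift (e : E) (i : Bool) :
    Sphere2 → ConeDisk (D.coneAngle (D.faceOf e i)) (D.radius (D.faceOf e i)) :=
  (D.exists_lift e).choose_spec.2.choose i

variable {D} {e : E} {x : Sphere2}

lemma immersion_lift (hx : x ∈ D.region e) (i : Bool) :
    D.immersion (D.faceOf e i) (D.lift e i x) = D.chart e x :=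
  (((D.exists_lift e).choose_spec.2.choose_spec x hx).1 i).1

lemma isCenterAt_lift (hx : x ∈ D.region e) (i : Bool) :
    D.IsCenterAt e ⟨D.faceOf e i, D.lift e i x⟩ (D.center e i) :=
  (((D.exists_lift e).choose_spec.2.choose_spec x hx).1 i).2

lemma exists_eq_lift (hx : x ∈ D.region e) {z : D.Disks} (hz : D.map z = D.chart e x) :
    ∃ i, z = ⟨D.faceOf e i, D.lift e i x⟩ :=
  ((D.exists_lift e).choose_spec.2.choose_spec x hx).2 z hz

lemma lift_eq_of_isCenterAt (hx : x ∈ D.region e) {i : Bool}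
    {y : ConeDisk (D.coneAngle (D.faceOf e i)) (D.radius (D.faceOf e i))}
    (hy : D.immersion _ y = D.chart e x) (h : D.IsCenterAt e ⟨D.faceOf e i, y⟩ (D.center e i)) :
    y = D.lift e i x := by
  obtain ⟨j, hj⟩ := exists_eq_lift hx (z := ⟨D.faceOf e i, y⟩) hy
  obtain rfl : i = j := D.center_injective ((hj ▸ h).unique (isCenterAt_lift hx j))
  simpa using hj

lemma rad_lift (hx : x ∈ D.region e) (i : Bool) :
    (D.lift e i x).rad = sphDist (D.center e i) x := by
  have := (isCenterAt_lift hx i).sdot_eq hx (immersion_lift hx i)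
  rw [sphDist_eq_arccos, this]
  exact (arccos_cos (D.lift e i x).rad_nonneg (D.lift e i x).rad_le_pi).symm

/-- The lifts have the prescribed centre, so by continuity no jump between the two disks occurs. -/
lemma locallyIsometricOn_lift (D : BigonPattern X E F) (e : E) (i : Bool) :
    LocallyIsometricOn (D.lift e i) (D.region e) := by
  intro x hx
  obtain ⟨ε, hε, h⟩ := D.exists_correspondence hx (immersion_lift hx i)
  have hc := (isCenterAt_lift hx i).eventually
  rw [Sigma.nhds_mk, eventually_map] at hc
  obtain ⟨η, hη, hη'⟩ := Metric.eventually_nhds_iff.1 hc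
  have key : ∀ x' ∈ D.region e, sphDist x x' < min ε η →
      dist (D.lift e i x) (D.lift e i x') < ε := by
    intro x' hx' hd
    obtain ⟨y, hy, he⟩ := (h _ (min_le_left ε η)).1 x' hx' hd
    rw [← lift_eq_of_isCenterAt hx' he
      (hη' (by rw [dist_comm]; exact hy.trans_le (min_le_right _ _)))]
    exact hy.trans_le (min_le_left _ _)
  refine ⟨min ε η, lt_min hε hη, fun x' hx' x'' hx'' hd hd' => ?_⟩
  exact (h ε le_rfl).2.2 x' hx' x'' hx'' _ _ (hd.trans_le (min_le_left _ _))
    (hd'.trans_le (min_le_left _ _)) (key x' hx' hd) (key x'' hx'' hd') (immersion_lift hx' i)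
    (immersion_lift hx'' i)

/-- Different sides of bigons have different lifts. -/
lemma eq_of_lift_eq {e' : E} {i i' : Bool} {x' : Sphere2} (hx : x ∈ D.region e)
    (hx' : x' ∈ D.region e')
    (h : (⟨D.faceOf e i, D.lift e i x⟩ : D.Disks) = ⟨D.faceOf e' i', D.lift e' i' x'⟩) :
    e = e' ∧ i = i' ∧ x = x' := by
  have hchart : D.chart e x = D.chart e' x' := by
    rw [← immersion_lift hx i, ← immersion_lift hx' i']
    exact congrArg D.map h
  obtain ⟨q, hq, hc⟩ := D.component e
  obtain ⟨q', hq', hc'⟩ := D.component e'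
  have he : e = e' := by
    refine D.component_injective e e' ?_
    have h1 : D.chart e x ∈ connectedComponentIn D.overlap q := hc ▸ mem_image_of_mem _ hx
    have h2 : D.chart e x ∈ connectedComponentIn D.overlap q' :=
      hchart ▸ hc' ▸ mem_image_of_mem _ hx'
    rw [hc, hc', connectedComponentIn_eq h1, connectedComponentIn_eq h2]
  subst he
  obtain rfl := D.chart_injOn e hx hx' hchart
  refine ⟨rfl, ?_, rfl⟩
  have h1 := isCenterAt_lift hx i
  rw [h] at h1
  exact D.center_injective (h1.unique (isCenterAt_lift hx i'))

/-- Along a ray from a centre, the lift of a bigon has constant angle. -/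
lemma ang_lift_arc {i : Bool} (w : UnitTangent (D.center e i)) {ρ t : ℝ} (hρ : 0 < ρ) (ht : ρ ≤ t)
    (htr : t < D.rad e i) (hx : arc (D.center e i) w ρ ∈ D.region e) :
    arc (D.center e i) w t ∈ D.region e ∧
      (D.lift e i (arc (D.center e i) w t)).ang = (D.lift e i (arc (D.center e i) w ρ)).ang := by
  have hcr := D.crossing e i
  have hmem : ∀ s ∈ Ico ρ (D.rad e i), arc (D.center e i) w s ∈ D.region e := by
    intro s hs
    rw [D.region_eq e i] at hx ⊢
    refine ⟨?_, hcr.arc_mem w hρ hs.1 hs.2.le hx.2⟩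
    rw [sphDisk, mem_ofPred_eq, sphDist_center_arc w (hρ.le.trans hs.1) (hs.2.le.trans hcr.lt_pi)]
    exact hs.2
  refine ⟨hmem t ⟨ht, htr⟩, ?_⟩
  refine isPreconnected_Ico.induction₂' (fun s t =>
    (D.lift e i (arc (D.center e i) w s)).ang = (D.lift e i (arc (D.center e i) w t)).ang)
    (fun s hs => ?_) (fun _ _ _ _ _ _ => Eq.trans) ⟨ht, htr⟩ ⟨le_rfl, ht.trans_lt htr⟩
  obtain ⟨ε, hε, h⟩ := D.locallyIsometricOn_lift e i _ (hmem s hs)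
  have hev : ∀ᶠ s' in 𝓝 s, sphDist (arc (D.center e i) w s) (arc (D.center e i) w s') < ε :=
    (continuous_arc w).continuousAt.eventually (eventually_sphDist_lt _ hε)
  filter_upwards [self_mem_nhdsWithin, hev.filter_mono nhdsWithin_le_nhds] with s' hs' hd
  have hrad : ∀ s ∈ Ico ρ (D.rad e i), (D.lift e i (arc (D.center e i) w s)).rad = s := by
    intro s hs
    rw [rad_lift (hmem s hs),
      sphDist_center_arc w (hρ.le.trans hs.1) (hs.2.le.trans hcr.lt_pi)]
  have habs : |s - s'| ≤ π := abs_le.2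
    ⟨by linarith [hs.1, hs'.2, hcr.lt_pi], by linarith [hs'.1, hs.2, hcr.lt_pi]⟩
  have h1 := h _ (hmem s hs) _ (hmem s' hs') (by rwa [sphDist_self]) hd
  rw [sphDist_arc_arc w habs] at h1
  have h2 := ConeDisk.ang_eq_of_dist_eq (by rw [hrad s hs]; linarith [hs.1])
    (by rw [hrad s' hs']; linarith [hs'.1]) (h1.trans (by rw [hrad s hs, hrad s' hs']))
  exact ⟨h2, h2.symm⟩

end

end BigonPattern
end CirclePatterns

namespace CirclePatterns

/-! ### Wedges of the sphere -/

lemma UnitTangent.exists_rotate_eq {o : Sphere2} (w w' v : UnitTangent o)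
    (h : inner ℝ w.1 w'.1 = (0 : ℝ)) (hframe : ∀ v : Space3, v = inner ℝ (o : Space3) v • (o : Space3)
      + inner ℝ w.1 v • w.1 + inner ℝ w'.1 v • w'.1) : ∃ β ∈ Ioc (-π) π, w.rotate w' h β = v := by
  have hv := hframe v.1
  rw [v.2.2, zero_smul, zero_add] at hv
  set a := inner ℝ w.1 v.1
  set b := inner ℝ w'.1 v.1
  have hab : a ^ 2 + b ^ 2 = 1 := by
    have h1 : inner ℝ w.1 w.1 = (1 : ℝ) := by rw [real_inner_self_eq_norm_sq, w.2.1, one_pow]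
    have h2 : inner ℝ w'.1 w'.1 = (1 : ℝ) := by rw [real_inner_self_eq_norm_sq, w'.2.1, one_pow]
    have h3 : inner ℝ w'.1 w.1 = (0 : ℝ) := by rw [real_inner_comm, h]
    have h4 : inner ℝ v.1 v.1 = (1 : ℝ) := by rw [real_inner_self_eq_norm_sq, v.2.1, one_pow]
    rw [hv] at h4
    simp only [inner_add_left, inner_add_right, real_inner_smul_left, real_inner_smul_right, h1, h2,
      h, h3] at h4
    linarith
  let z : ℂ := ⟨a, b⟩
  have hz : ‖z‖ = 1 := by
    rw [Complex.norm_def, Complex.normSq_mk, ← sq, ← sq, hab, sqrt_one]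
  have hz0 : z ≠ 0 := by rw [← norm_ne_zero_iff, hz]; exact one_ne_zero
  refine ⟨z.arg, Complex.arg_mem_Ioc z, Subtype.ext ?_⟩
  rw [UnitTangent.coe_rotate, Complex.cos_arg hz0, Complex.sin_arg, hz, div_one, div_one]
  exact hv.symm

lemma sdot_arc_rotate {o : Sphere2} (w w' : UnitTangent o) (h : inner ℝ w.1 w'.1 = (0 : ℝ))
    (ρ φ ρ' φ' : ℝ) : sdot (arc o (w.rotate w' h φ) ρ) (arc o (w.rotate w' h φ') ρ') =
      cos ρ * cos ρ' + sin ρ * sin ρ' * cos (φ - φ') := by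
  rw [sdot_arc_arc_of_inner, inner_rotate_rotate]

/-- The wedge `0 < ρ < r`, `|φ| < η` in suitable polar coordinates `ρ`, `φ` on the sphere. -/
lemma exists_wedge {r η : ℝ} (hr : 0 < r) (hr' : r ≤ π / 2) (hη : 0 < η) (hη' : η ≤ π / 2) :
    ∃ P : ℝ → ℝ → Sphere2, (∀ ρ φ ρ' φ', sdot (P ρ φ) (P ρ' φ') =
      cos ρ * cos ρ' + sin ρ * sin ρ' * cos (φ - φ')) ∧
      ∃ W, SphConvex W ∧ IsOpen W ∧ (∀ x ∈ W, ∃ ρ ∈ Ioo 0 r, ∃ φ ∈ Ioo (-η) η, x = P ρ φ) ∧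
        ∀ ρ ∈ Ioo 0 r, ∀ φ ∈ Ioo (-η) η, P ρ φ ∈ W := by
  let o : Sphere2 := ⟨stdVertex, by simp [norm_stdVertex]⟩
  let w : UnitTangent o := ⟨!₂[1, 0, 0], by simp [EuclideanSpace.norm_eq, Fin.sum_univ_three],
    by simp [o, stdVertex, PiLp.inner_apply, Fin.sum_univ_three]⟩
  obtain ⟨w', h, hframe⟩ := exists_frame w
  refine ⟨fun ρ φ => arc o (w.rotate w' h φ) ρ, fun ρ φ ρ' φ' => sdot_arc_rotate w w' h ρ φ ρ' φ',
    ?_⟩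
  set P : ℝ → ℝ → Sphere2 := fun ρ φ => arc o (w.rotate w' h φ) ρ with hP
  have hsd : ∀ c ρ φ, sdot (P (π / 2) c) (P ρ φ) = sin ρ * cos (c - φ) := fun c ρ φ => by
    rw [hP]; simp only [sdot_arc_rotate, cos_pi_div_two, sin_pi_div_two]; ring
  have hmem : ∀ c x, x ∈ sphDisk (P (π / 2) c) (π / 2) ↔ 0 < sdot (P (π / 2) c) x := fun c x => by
    rw [mem_sphDisk (by linarith [pi_pos]) (by linarith [pi_pos]), cos_pi_div_two]
  refine ⟨sphDisk o r ∩ (sphDisk (P (π / 2) (η - π / 2)) (π / 2) ∩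
    sphDisk (P (π / 2) (π / 2 - η)) (π / 2)), ?_, ?_, ?_, ?_⟩
  · exact (sphConvex_sphDisk o hr hr').inter ((sphConvex_sphDisk _ (by linarith) le_rfl).inter
      (sphConvex_sphDisk _ (by linarith) le_rfl))
  · exact (isOpen_sphDisk _ _).inter ((isOpen_sphDisk _ _).inter (isOpen_sphDisk _ _))
  · rintro x ⟨hx1, hx2, hx3⟩
    rw [hmem] at hx2 hx3
    have hxr : sphDist o x < r := hx1
    have h0 : 0 < sphDist o x := by
      refine (sphDist_nonneg o x).lt_of_ne fun he => ?_
      have : x = P 0 0 := by rw [hP]; simp only [arc_zero]; exact (eq_of_sphDist_eq_zero he.symm).symm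
      rw [this, hsd, sin_zero, zero_mul] at hx2
      exact lt_irrefl _ hx2
    obtain ⟨v, hv⟩ := exists_arc_eq h0 (by linarith [pi_pos])
    obtain ⟨β, hβ, rfl⟩ := UnitTangent.exists_rotate_eq w w' v h hframe
    have hs : 0 < sin (sphDist o x) := sin_pos_of_pos_of_lt_pi h0 (by linarith [pi_pos])
    refine ⟨sphDist o x, ⟨h0, hxr⟩, β, ?_, hv.symm⟩
    have hx : x = P (sphDist o x) β := hv.symm
    rw [hx, hsd] at hx2 hx3
    have h2 := (pos_iff_pos_of_mul_pos hx2).1 hs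
    have h3 := (pos_iff_pos_of_mul_pos hx3).1 hs
    rw [show η - π / 2 - β = (η - β) - π / 2 by ring, cos_sub_pi_div_two] at h2
    rw [show π / 2 - η - β = π / 2 - (η + β) by ring, cos_pi_div_two_sub] at h3
    constructor
    · by_contra! hle
      exact absurd (sin_nonpos_of_nonpos_of_neg_pi_le (by linarith : η + β ≤ 0)
        (by linarith [hβ.1, hβ.2])) (not_le.2 h3)
    · by_contra! hle
      exact absurd (sin_nonpos_of_nonpos_of_neg_pi_le (by linarith : η - β ≤ 0)
        (by linarith [hβ.1, hβ.2])) (not_le.2 h2)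
  · intro ρ hρ φ hφ
    have hs : 0 < sin ρ := sin_pos_of_pos_of_lt_pi hρ.1 (by linarith [hρ.2, pi_pos])
    refine ⟨?_, (hmem _ _).2 ?_, (hmem _ _).2 ?_⟩
    · rw [sphDisk, mem_ofPred_eq, hP, sphDist_center_arc _ hρ.1.le (by linarith [hρ.2, pi_pos])]
      exact hρ.2
    · rw [hsd]
      refine mul_pos hs (cos_pos_of_mem_Ioo ⟨?_, ?_⟩) <;> linarith [hφ.1, hφ.2]
    · rw [hsd]
      refine mul_pos hs (cos_pos_of_mem_Ioo ⟨?_, ?_⟩) <;> linarith [hφ.1, hφ.2]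

/-! ### Local isometries of intervals -/

/-- A local isometry of an interval is affine with slope `±1`. -/
lemma hasDerivAt_of_abs_sub_eq {A : ℝ → ℝ} {β ε : ℝ} (hε : 0 < ε)
    (h : ∀ x y, |x - β| < ε → |y - β| < ε → |A x - A y| = |x - y|) :
    ∃ s : ℝ, |s| = 1 ∧ HasDerivAt A s β := by
  have hβ : |β - β| < ε := by simpa using hε
  have hβ₁ : |β + ε / 2 - β| < ε := by
    rw [add_sub_cancel_left, abs_of_pos (by positivity)]; linarith
  have h1 := h (β + ε / 2) β hβ₁ hβ
  rw [add_sub_cancel_left, abs_of_pos (by positivity : 0 < ε / 2)] at h1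
  obtain ⟨s, hs, hsA⟩ : ∃ s : ℝ, (s = 1 ∨ s = -1) ∧ A (β + ε / 2) - A β = s * (ε / 2) := by
    rcases (abs_eq (by positivity)).1 h1 with h | h
    · exact ⟨1, Or.inl rfl, by linarith⟩
    · exact ⟨-1, Or.inr rfl, by linarith⟩
  refine ⟨s, by rcases hs with rfl | rfl <;> simp, ?_⟩
  have hlin : HasDerivAt (fun x => A β + s * (x - β)) s β := by
    simpa using (((hasDerivAt_id β).sub_const β).const_mul s).const_add (A β)
  refine hlin.congr_of_eventuallyEq ?_
  filter_upwards [Metric.ball_mem_nhds β (half_pos hε)] with x hx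
  rw [Metric.mem_ball, Real.dist_eq] at hx
  have h2 := h x β (by linarith) hβ
  have h3 := h x (β + ε / 2) (by linarith) hβ₁
  rw [abs_lt] at hx
  rw [abs_sub_comm x, abs_of_pos (by linarith : 0 < β + ε / 2 - x)] at h3
  rcases hs with rfl | rfl <;> grind

open MeasureTheory in
/-- An injective local isometry between open subsets of the line preserves lengths, by the change of
variables formula. -/
lemma volume_image_of_locally_isometric {A : ℝ → ℝ} {U : Set ℝ} (hU : IsOpen U)
    (h : ∀ β ∈ U, ∃ ε > 0, ∀ x y, |x - β| < ε → |y - β| < ε → |A x - A y| = |x - y|)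
    (hinj : InjOn A U) : MeasurableSet (A '' U) ∧ volume (A '' U) = volume U := by
  have hder : ∀ β, ∃ s : ℝ, β ∈ U → |s| = 1 ∧ HasDerivAt A s β := fun β => by
    by_cases hβ : β ∈ U
    · obtain ⟨ε, hε, hA⟩ := h β hβ
      obtain ⟨s, hs⟩ := hasDerivAt_of_abs_sub_eq hε hA
      exact ⟨s, fun _ => hs⟩
    · exact ⟨0, fun h => absurd h hβ⟩
  choose s hs using hder
  have hd : ∀ β ∈ U, HasDerivWithinAt A (s β) U β := fun β hβ => (hs β hβ).2.hasDerivWithinAt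
  refine ⟨hU.measurableSet.image_of_continuousOn_injOn
    (fun β hβ => (hd β hβ).continuousWithinAt) hinj, ?_⟩
  have := lintegral_image_eq_lintegral_abs_deriv_mul hU.measurableSet hd hinj fun _ => 1
  rw [setLIntegral_one] at this
  rw [this, ← setLIntegral_one U]
  refine setLIntegral_congr_fun hU.measurableSet fun β hβ => ?_
  simp [(hs β hβ).1]

lemma abs_sub_eq_of_circDist {α a b c : ℝ} (ha : a ∈ Ioo 0 α) (hb : b ∈ Ico 0 α)
    (hc : c ∈ Ico 0 α) (hab : circDist α a b < min a (α - a) / 2)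
    (hac : circDist α a c < min a (α - a) / 2) : circDist α b c = |b - c| := by
  obtain ⟨a1, a2⟩ := ha
  obtain ⟨b1, b2⟩ := hb
  obtain ⟨c1, c2⟩ := hc
  have key : ∀ b, 0 ≤ b → b < α → circDist α a b < min a (α - a) / 2 →
      |a - b| < min a (α - a) / 2 := by
    intro b b1 b2 hab
    unfold circDist at hab
    have h1 := min_le_left a (α - a)
    have h2 := min_le_right a (α - a)
    rcases min_lt_iff.1 hab with h | h
    · exact h
    · rcases abs_cases (a - b) with ⟨e, _⟩ | ⟨e, _⟩ <;> rw [e] at h ⊢ <;> linarith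
  have h1 := abs_lt.1 (key b b1 b2 hab)
  have h2 := abs_lt.1 (key c c1 c2 hac)
  have h3 := min_le_left a (α - a)
  have h4 := min_le_right a (α - a)
  refine min_eq_left ?_
  have : |b - c| ≤ α / 2 := abs_le.2 ⟨by linarith, by linarith⟩
  linarith

lemma circDist_eq_abs_sub {α φ φ' : ℝ} (h : |φ - φ'| ≤ α / 2) : circDist α φ φ' = |φ - φ'| :=
  min_eq_left (by linarith)

lemma ConeDisk.continuous_rad {α r : ℝ} [Fact (0 < α)] [Fact (0 < r ∧ r ≤ π / 2)] :
    Continuous (ConeDisk.rad : ConeDisk α r → ℝ) := by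
  refine continuous_iff_continuousAt.2 fun x => ?_
  rw [ContinuousAt, tendsto_iff_dist_tendsto_zero]
  exact squeeze_zero (fun _ => dist_nonneg) (fun y => abs_rad_sub_le y x)
    (tendsto_iff_dist_tendsto_zero.1 tendsto_id)

namespace BigonPattern
variable {X E F : Type*} [MetricSpace X] [CompactSpace X] {D : BigonPattern X E F}

/-! ### The angles of a disk covered by the bigons -/

variable (D) in
/-- The angles of the rays of the disk of the face `f` that end in the lift of a bigon. -/
def coveredAngles (f : F) : Set ℝ :=
  {φ | ∃ e i, D.faceOf e i = f ∧ ∃ x ∈ D.region e, (D.lift e i x).ang = φ}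

/-- A ray of a disk whose end point lies in a disk ends in the overlap. -/
lemma mem_coveredAngles_of_tendsto {f : F} {φ : ℝ} (hφ : φ ∈ Ico 0 (D.coneAngle f)) {q : X}
    (hq : q ∈ range D.map) (hlim : ∀ ε > 0, ∃ s < D.radius f, ∀ ρ (h : 0 < ρ) (h' : ρ < D.radius f),
      s < ρ → dist q (D.immersion f (ConeDisk.mk ρ φ h h' hφ)) < ε) : φ ∈ D.coveredAngles f := by
  obtain ⟨⟨g, y₀⟩, rfl⟩ := hq
  set m := (y₀.rad + D.radius g) / 2 with hm
  have hy₀ : y₀.rad < D.radius g := y₀.rad_lt (D.radius_pos g)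
  have hV : D.map '' (Sigma.mk g '' {y | y.rad < m}) ∈ 𝓝 (D.map ⟨g, y₀⟩) := by
    refine D.isOpenMap_map.image_mem_nhds
      ((isOpenMap_sigmaMk _ (isOpen_lt ConeDisk.continuous_rad continuous_const)).mem_nhds
        ⟨y₀, ?_, rfl⟩)
    rw [mem_ofPred_eq]; linarith
  obtain ⟨ε, hε, hεV⟩ := Metric.mem_nhds_iff.1 hV
  obtain ⟨s, hs, hsε⟩ := hlim ε hε
  -- if the end point of the ray lies in the same disk, a point of the ray farther from the apex than
  -- the neighbourhood of `y₀` is needed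
  obtain ⟨ρ, hρ1, hρ2, hρ3, hρg⟩ : ∃ ρ, 0 < ρ ∧ ρ < D.radius f ∧ s < ρ ∧ (g = f → m < ρ) := by
    by_cases hgf : g = f
    · have hmf : m < D.radius f := by rw [← hgf]; linarith
      obtain ⟨ρ, h1, h2⟩ := exists_between (max_lt (max_lt (D.radius_pos f) hs) hmf)
      simp only [max_lt_iff] at h1
      exact ⟨ρ, h1.1.1, h2, h1.1.2, fun _ => h1.2⟩
    · obtain ⟨ρ, h1, h2⟩ := exists_between (max_lt (D.radius_pos f) hs)
      rw [max_lt_iff] at h1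
      exact ⟨ρ, h1.1, h2, h1.2, fun h => absurd h hgf⟩
  set y := ConeDisk.mk ρ φ hρ1 hρ2 hφ with hy
  have hd := hsε ρ hρ1 hρ2 hρ3
  obtain ⟨_, ⟨y', hy', rfl⟩, he⟩ := hεV (show D.immersion f y ∈ Metric.ball _ ε by
    rw [Metric.mem_ball, dist_comm]; exact hd)
  have hne : (⟨g, y'⟩ : D.Disks) ≠ ⟨f, y⟩ := by
    intro h
    have hg : g = f := congrArg Sigma.fst h
    subst hg
    have : y' = y := by simpa using h
    rw [mem_ofPred_eq, this] at hy'
    exact absurd (hρg rfl) (not_lt.2 hy'.le)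
  obtain ⟨e, x, hx, hxe⟩ := D.component_surjective _ (D.mem_overlap.2 ⟨_, ⟨f, y⟩, he, rfl, hne⟩)
  obtain ⟨i, hi⟩ := exists_eq_lift hx (z := ⟨f, y⟩) hxe.symm
  refine ⟨e, i, (congrArg Sigma.fst hi).symm, x, hx, ?_⟩
  have : (D.lift e i x).ang = (⟨f, y⟩ : D.Disks).2.ang := by rw [hi]
  exact this

/-- Almost all rays of a disk end in the overlap: the other end points are isolated. -/
lemma eventually_mem_coveredAngles {f : F} {φ₀ : ℝ} (hφ₀ : φ₀ ∈ Ioo 0 (D.coneAngle f)) :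
    ∀ᶠ φ in 𝓝[≠] φ₀, φ ∈ D.coveredAngles f := by
  set α := D.coneAngle f with hα
  set r := D.radius f with hr
  have hr0 : 0 < r := D.radius_pos f
  have hrπ : r < π / 2 := D.radius_lt f
  set η := min (min φ₀ (α - φ₀) / 2) (π / 2) with hη
  have hm : 0 < min φ₀ (α - φ₀) := lt_min hφ₀.1 (sub_pos.2 hφ₀.2)
  have hη0 : 0 < η := lt_min (by positivity) (by positivity)
  have hη1 : η ≤ φ₀ / 2 := (min_le_left _ _).trans (by gcongr; exact min_le_left _ _)
  have hη2 : η ≤ (α - φ₀) / 2 := (min_le_left _ _).trans (by gcongr; exact min_le_right _ _)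
  have hη3 : η ≤ π / 2 := min_le_right _ _
  obtain ⟨P, hP, W, hW, hWo, hWP, hPW⟩ := exists_wedge hr0 hrπ.le hη0 hη3
  have hang : ∀ φ ∈ Ioo (-η) η, φ₀ + φ ∈ Ico 0 α := fun φ hφ =>
    ⟨by linarith [hφ.1, hφ₀.1], by linarith [hφ.2, hφ₀.2]⟩
  -- the isometry from the wedge to the cone
  have hκ : ∀ x, ∃ y : ConeDisk α r, x ∈ W → ∃ ρ ∈ Ioo 0 r, ∃ φ ∈ Ioo (-η) η, x = P ρ φ ∧
      y.rad = ρ ∧ y.ang = φ₀ + φ := fun x => by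
    by_cases hx : x ∈ W
    · obtain ⟨ρ, hρ, φ, hφ, he⟩ := hWP x hx
      exact ⟨ConeDisk.mk ρ (φ₀ + φ) hρ.1 hρ.2 (hang φ hφ), fun _ => ⟨ρ, hρ, φ, hφ, he, rfl, rfl⟩⟩
    · exact ⟨ConeDisk.apex _ _, fun h => absurd h hx⟩
  choose κ hκ using hκ
  have hdist : ∀ (y y' : ConeDisk α r) (ρ φ ρ' φ' : ℝ), φ ∈ Ioo (-η) η → φ' ∈ Ioo (-η) η →
      y.rad = ρ → y.ang = φ₀ + φ → y'.rad = ρ' → y'.ang = φ₀ + φ' →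
      dist y y' = sphDist (P ρ φ) (P ρ' φ') := by
    rintro y y' _ φ _ φ' hφ hφ' rfl ha rfl ha'
    have habs : |φ - φ'| ≤ 2 * η :=
      abs_le.2 ⟨by linarith [hφ.1, hφ'.2], by linarith [hφ.2, hφ'.1]⟩
    have hsub : y.ang - y'.ang = φ - φ' := by rw [ha, ha']; ring
    rw [ConeDisk.dist_eq, circDist_eq_abs_sub (by rw [hsub]; linarith), hsub,
      min_eq_right (by linarith), thirdSide, sphDist_eq_arccos, hP, cos_abs]
  have hκd : ∀ x ∈ W, ∀ y ∈ W, dist (κ x) (κ y) = sphDist x y := by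
    intro x hx y hy
    obtain ⟨ρ, -, φ, hφ, he, h1, h2⟩ := hκ x hx
    obtain ⟨ρ', -, φ', hφ', he', h1', h2'⟩ := hκ y hy
    conv_rhs => rw [he, he']
    exact hdist _ _ _ _ _ _ hφ hφ' h1 h2 h1' h2'
  -- the wedge is mapped by a local isometry, whose boundary points near the ray of angle `φ₀`, but not
  -- on it, are not mapped to missed points
  set c : Sphere2 → X := fun x => D.immersion f (κ x) with hc
  have hcl : LocallyIsometricOn c W := fun p hp => by
    obtain ⟨ε, hε, h, -⟩ := D.exists_isometric f (κ p)
    refine ⟨ε, hε, fun x hx y hy hdx hdy => ?_⟩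
    rw [hc]
    simp only
    rw [h _ _ (by rwa [hκd p hp x hx]) (by rwa [hκd p hp y hy]), hκd x hx y hy]
  have hcmk : ∀ ρ (h : 0 < ρ) (h' : ρ < r) φ (hφ : φ ∈ Ioo (-η) η),
      c (P ρ φ) = D.immersion f (ConeDisk.mk ρ (φ₀ + φ) h h' (hang φ hφ)) := by
    intro ρ h h' φ hφ
    obtain ⟨ρ', -, φ', hφ', he, h1, h2⟩ := hκ _ (hPW ρ ⟨h, h'⟩ φ hφ)
    rw [hc]
    simp only
    congr 1
    have := hdist _ (ConeDisk.mk ρ (φ₀ + φ) h h' (hang φ hφ)) ρ' φ' ρ φ hφ' hφ h1 h2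
      rfl rfl
    rw [← he, sphDist_self] at this
    exact dist_eq_zero.1 this
  have hPdist : ∀ φ ρ ρ', |ρ - ρ'| ≤ π → sphDist (P ρ φ) (P ρ' φ) = |ρ - ρ'| := by
    intro φ ρ ρ' h
    refine sphDist_eq_of_sdot (abs_nonneg _) h ?_
    rw [hP, cos_abs, sub_self, cos_zero, cos_sub]; ring
  have hclos : ∀ φ ∈ Ioo (-η) η, P r φ ∈ closure W := by
    intro φ hφ
    refine mem_closure_iff_nhds.2 fun t ht => ?_
    obtain ⟨ε, hε, hεt⟩ := exists_sphDist_lt_subset ht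
    obtain ⟨ρ, h1, h2⟩ := exists_between
      (max_lt hr0 (by linarith : r - ε < r))
    rw [max_lt_iff] at h1
    refine ⟨P ρ φ, hεt _ ?_, hPW ρ ⟨h1.1, h2⟩ φ hφ⟩
    rw [hPdist φ r ρ (abs_le.2 ⟨by linarith [pi_pos], by linarith [pi_pos]⟩),
      abs_of_pos (by linarith)]
    linarith
  have h00 : (0 : ℝ) ∈ Ioo (-η) η := ⟨by linarith, hη0⟩
  obtain ⟨δ, hδ, hiso⟩ := hcl.exists_isolated D.exists_isConicalBall D.finite_missed hW hWo
    (hclos 0 h00)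
  have hsr : 0 < sin r := sin_pos_of_pos_of_lt_pi hr0 (by linarith [pi_pos])
  have hnear : ∀ᶠ φ in 𝓝 (0 : ℝ), sphDist (P r 0) (P r φ) < δ := by
    have hcont : Continuous fun φ => sphDist (P r 0) (P r φ) := by
      simp only [sphDist_eq_arccos, hP]
      exact continuous_arccos.comp (by fun_prop)
    exact hcont.continuousAt.eventually (gt_mem_nhds (by
      change sphDist (P r 0) (P r 0) < δ; rwa [sphDist_self]))
  have hev : ∀ᶠ φ in 𝓝[≠] (0 : ℝ), φ₀ + φ ∈ D.coveredAngles f := by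
    filter_upwards [hnear.filter_mono nhdsWithin_le_nhds, self_mem_nhdsWithin,
      mem_nhdsWithin_of_mem_nhds (Ioo_mem_nhds h00.1 h00.2)] with φ hφδ hφ0 hφ
    obtain ⟨q, hq⟩ := hcl.exists_limit hW (hclos φ hφ)
    have hPne : P r φ ≠ P r 0 := by
      intro he
      have h1 := hP r φ r 0
      rw [he, sdot_self, sub_zero] at h1
      have h2 := sin_sq_add_cos_sq r
      have h3 : sin r * sin r * (1 - cos φ) = 0 := by linarith
      have h4 : cos φ = 1 := by
        rcases mul_eq_zero.1 h3 with h3 | h3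
        · exact absurd h3 (by positivity)
        · linarith
      exact hφ0 ((cos_eq_one_iff_of_lt_of_lt (by linarith [hφ.1, pi_pos])
        (by linarith [hφ.2, pi_pos])).1 h4)
    have hqm := hiso _ (hclos φ hφ) hPne hφδ q hq
    rw [mem_compl_iff, not_not] at hqm
    obtain ⟨g, y, hy⟩ := mem_iUnion.1 hqm
    refine mem_coveredAngles_of_tendsto (hang φ hφ) ⟨⟨g, y⟩, hy⟩ fun ε hε =>
      ⟨r - ε, by linarith, fun ρ h h' hρ => ?_⟩
    rw [← hcmk ρ h h' φ hφ]
    refine (hq _ (hPW ρ ⟨h, h'⟩ φ hφ)).trans_lt ?_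
    rw [hPdist φ r ρ (abs_le.2 ⟨by linarith [pi_pos], by linarith [pi_pos]⟩),
      abs_of_pos (sub_pos.2 h')]
    linarith
  have hshift : Tendsto (fun φ => φ - φ₀) (𝓝[≠] φ₀) (𝓝[≠] 0) := by
    refine tendsto_nhdsWithin_iff.2 ⟨?_, ?_⟩
    · have : Continuous fun φ => φ - φ₀ := by fun_prop
      simpa using (this.tendsto φ₀).mono_left nhdsWithin_le_nhds
    · filter_upwards [self_mem_nhdsWithin] with φ hφ
      exact sub_ne_zero.2 hφ
  filter_upwards [hshift.eventually hev] with φ hφ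
  rwa [add_sub_cancel] at hφ

open MeasureTheory in
/-- The exceptional angles, of rays that end in missed points, are isolated. -/
lemma volume_diff_coveredAngles (f : F) :
    volume (Ioo 0 (D.coneAngle f) \ D.coveredAngles f) = 0 := by
  refine measure_null_of_locally_null _ fun φ hφ => ⟨{φ}, ?_, volume_singleton⟩
  have h := eventually_mem_coveredAngles hφ.1
  rw [eventually_nhdsWithin_iff] at h
  filter_upwards [h.filter_mono nhdsWithin_le_nhds, self_mem_nhdsWithin] with ψ h1 h2
  by_contra hne
  exact h2.2 (h1 hne)

end BigonPattern
end CirclePatterns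

namespace CirclePatterns
namespace BigonPattern
variable {X E F : Type*} [MetricSpace X] (D : BigonPattern X E F)

/-! ### The sum of the angles of the sectors of a disk -/

/-- Half of the angle of the sector of the disk `i` that is spanned by the bigon `e`. -/
noncomputable def halfAngle (e : E) (i : Bool) : ℝ :=
  arccos ((cos (D.rad e !i) - cos (D.rad e i) * sdot (D.center e !i) (D.center e i)) /
    (sin (D.rad e i) * sin (sphDist (D.center e i) (D.center e !i))))

lemma sin_dist_pos (e : E) (i : Bool) : 0 < sin (sphDist (D.center e i) (D.center e !i)) :=
  sin_pos_of_pos_of_lt_pi ((D.crossing e i).pos.trans (D.crossing e i).lt_dist)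
    (D.crossing e i).dist_lt_pi

lemma halfAngle_ratio (e : E) (i : Bool) :
    0 < (cos (D.rad e !i) - cos (D.rad e i) * sdot (D.center e !i) (D.center e i)) /
      (sin (D.rad e i) * sin (sphDist (D.center e i) (D.center e !i))) ∧
    (cos (D.rad e !i) - cos (D.rad e i) * sdot (D.center e !i) (D.center e i)) /
      (sin (D.rad e i) * sin (sphDist (D.center e i) (D.center e !i))) < 1 := by
  have hcr := D.crossing e i
  have hs := mul_pos hcr.sin_pos (D.sin_dist_pos e i)
  refine ⟨div_pos (sub_pos.2 hcr.cos_mul_sdot_lt) hs, (div_lt_one hs).2 ?_⟩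
  have h1 := hcr.lt_dist
  have h2 := hcr.dist_lt
  have h3 : cos (D.rad e !i) < cos (sphDist (D.center e i) (D.center e !i) - D.rad e i) :=
    cos_lt_cos_of_nonneg_of_le_pi (by linarith) (by linarith [hcr.lt', pi_pos]) (by linarith)
  rw [cos_sub, cos_sphDist, sdot_comm] at h3
  linarith

lemma cos_halfAngle (e : E) (i : Bool) : cos (D.halfAngle e i) =
    (cos (D.rad e !i) - cos (D.rad e i) * sdot (D.center e !i) (D.center e i)) /
      (sin (D.rad e i) * sin (sphDist (D.center e i) (D.center e !i))) :=
  cos_arccos (by linarith [(D.halfAngle_ratio e i).1]) (D.halfAngle_ratio e i).2.le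

lemma halfAngle_pos (e : E) (i : Bool) : 0 < D.halfAngle e i :=
  arccos_pos.2 (D.halfAngle_ratio e i).2

lemma halfAngle_lt (e : E) (i : Bool) : D.halfAngle e i < π / 2 :=
  arccos_lt_pi_div_two.2 (D.halfAngle_ratio e i).1

variable {D}

lemma cos_halfAngle_lt_iff {e : E} {i : Bool} {w w' : UnitTangent (D.center e i)}
    (hw : arc (D.center e i) w (sphDist (D.center e i) (D.center e !i)) = D.center e !i)
    (h : inner ℝ w.1 w'.1 = (0 : ℝ)) (β : ℝ) : cos (D.halfAngle e i) < cos β ↔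
      cos (D.rad e !i) < sdot (D.center e !i) (arc (D.center e i) (w.rotate w' h β) (D.rad e i)) := by
  rw [sdot_rotate hw, cos_halfAngle,
    div_lt_iff₀ (mul_pos (D.crossing e i).sin_pos (D.sin_dist_pos e i)), cos_sphDist,
    sdot_comm (D.center e i)]
  constructor <;> intro h <;> linarith

variable [CompactSpace X]

lemma ang_lift_arc_eq {e : E} {i : Bool} (w : UnitTangent (D.center e i)) {ρ t : ℝ}
    (hρ : ρ ∈ Ioo 0 (D.rad e i)) (ht : t ∈ Ioo 0 (D.rad e i))
    (hx : arc (D.center e i) w ρ ∈ D.region e) (hy : arc (D.center e i) w t ∈ D.region e) :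
    (D.lift e i (arc (D.center e i) w t)).ang = (D.lift e i (arc (D.center e i) w ρ)).ang := by
  rcases le_total ρ t with h | h
  · exact (ang_lift_arc w hρ.1 h ht.2 hx).2
  · exact (ang_lift_arc w ht.1 h hρ.2 hy).2.symm

/-- The lift of a bigon in polar coordinates `ρ`, `β` about the centre of one of its disks: it is
`(ρ, β) ↦ (ρ, A β)`, where `A` is a local isometry from an interval to a circle. -/
lemma exists_angle_map (D : BigonPattern X E F) (e : E) (i : Bool) :
    ∃ (P : ℝ → ℝ → Sphere2) (A : ℝ → ℝ), (∀ ρ φ ρ' φ', sdot (P ρ φ) (P ρ' φ') =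
        cos ρ * cos ρ' + sin ρ * sin ρ' * cos (φ - φ')) ∧
      (∀ β ∈ Ioo (-D.halfAngle e i) (D.halfAngle e i), ∃ s, 0 < s ∧ s < D.rad e i ∧
        ∀ t, s ≤ t → t < D.rad e i → P t β ∈ D.region e ∧ (D.lift e i (P t β)).rad = t ∧
          (D.lift e i (P t β)).ang = A β) ∧
      (∀ x ∈ D.region e, ∃ β ∈ Ioo (-D.halfAngle e i) (D.halfAngle e i),
        (D.lift e i x).ang = A β) ∧
      ∀ β ∈ Ioo (-D.halfAngle e i) (D.halfAngle e i), ∃ ε > 0, ∀ β' β'', |β' - β| < ε →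
        |β'' - β| < ε → β' ∈ Ioo (-D.halfAngle e i) (D.halfAngle e i) ∧
          circDist (D.coneAngle (D.faceOf e i)) (A β') (A β'') = |β' - β''| := by
  have hcr := D.crossing e i
  have hR := D.region_eq e i
  obtain ⟨w, hw⟩ := D.exists_direction e i
  obtain ⟨w', h, hframe⟩ := exists_frame w
  have hφ := D.halfAngle_lt e i
  set φ₁ := D.halfAngle e i with hφ₁
  set P : ℝ → ℝ → Sphere2 := fun ρ β => arc (D.center e i) (w.rotate w' h β) ρ with hP
  have hPs : ∀ ρ φ ρ' φ', sdot (P ρ φ) (P ρ' φ') =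
      cos ρ * cos ρ' + sin ρ * sin ρ' * cos (φ - φ') := sdot_arc_rotate w w' h
  have hstart : ∀ β ∈ Ioo (-φ₁) φ₁, ∃ s ∈ Ioo 0 (D.rad e i), P s β ∈ D.region e := by
    intro β hβ
    have hcos : cos φ₁ < cos β := by
      rw [← cos_abs β]
      exact cos_lt_cos_of_nonneg_of_le_pi (abs_nonneg _) (by linarith [pi_pos]) (abs_lt.2 hβ)
    obtain ⟨ρ, -, h1, h2, h3⟩ := hcr.exists_arc_mem (w.rotate w' h β)
      ((cos_halfAngle_lt_iff hw h β).1 hcos) hcr.pos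
    exact ⟨ρ, ⟨h1, h2⟩, hR ▸ h3⟩
  choose! s hs hsR using hstart
  -- the angle does not depend on the chosen point `s β` of the ray
  set A : ℝ → ℝ := fun β => (D.lift e i (P (s β) β)).ang with hA
  have hAeq : ∀ β ∈ Ioo (-φ₁) φ₁, ∀ t ∈ Ioo 0 (D.rad e i), P t β ∈ D.region e →
      (D.lift e i (P t β)).ang = A β := fun β hβ t ht htR =>
    ang_lift_arc_eq _ (hs β hβ) ht (hsR β hβ) htR
  have hrad : ∀ β, ∀ t ∈ Ioo 0 (D.rad e i), P t β ∈ D.region e → (D.lift e i (P t β)).rad = t := by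
    intro β t ht htR
    rw [rad_lift htR, hP, sphDist_center_arc _ ht.1.le (ht.2.le.trans hcr.lt_pi)]
  refine ⟨P, A, hPs, fun β hβ => ⟨s β, (hs β hβ).1, (hs β hβ).2, fun t ht htr => ?_⟩,
    fun x hx => ?_, fun β hβ => ?_⟩
  · have ht0 := (hs β hβ).1.trans_le ht
    have htR := (ang_lift_arc _ (hs β hβ).1 ht htr (hsR β hβ)).1
    exact ⟨htR, hrad β t ⟨ht0, htr⟩ htR, hAeq β hβ t ⟨ht0, htr⟩ htR⟩
  · obtain ⟨h0, h1, v, hv⟩ := hcr.exists_arc_of_mem (hR ▸ hx)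
    obtain ⟨β, hβ, rfl⟩ := UnitTangent.exists_rotate_eq w w' v h hframe
    have hend := hcr.arc_mem (w.rotate w' h β) h0 h1.le le_rfl
      (by rw [hv]; rw [hR] at hx; exact hx.2)
    rw [hcr.mem_right_iff, ← cos_halfAngle_lt_iff hw h, ← hφ₁] at hend
    have hβ' : β ∈ Ioo (-φ₁) φ₁ := by
      rw [mem_Ioo, ← abs_lt]
      by_contra! hle
      rw [← cos_abs β] at hend
      exact absurd (cos_le_cos_of_nonneg_of_le_pi (D.halfAngle_pos e i).le
        (abs_le.2 ⟨by linarith [hβ.1], hβ.2⟩) hle) (not_le.2 hend)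
    refine ⟨β, hβ', ?_⟩
    have hx' : x = P (sphDist (D.center e i) x) β := hv.symm
    rw [← hAeq β hβ' _ ⟨h0, h1⟩ (hx' ▸ hx), ← hx']
  · obtain ⟨ε, hε, hiso⟩ := D.locallyIsometricOn_lift e i _ (hsR β hβ)
    have hc : Continuous fun β' => P (s β) β' := continuous_arc_rotate w w' h _
    have hev : ∀ᶠ β' in 𝓝 β, (P (s β) β' ∈ D.region e ∧
        sphDist (P (s β) β) (P (s β) β') < ε) ∧ β' ∈ Ioo (-φ₁) φ₁ :=
      ((hc.continuousAt.eventually ((D.isOpen_region e).mem_nhds (hsR β hβ))).and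
        (hc.continuousAt.eventually (eventually_sphDist_lt _ hε))).and (Ioo_mem_nhds hβ.1 hβ.2)
    obtain ⟨η, hη, hη'⟩ := Metric.eventually_nhds_iff.1 hev
    refine ⟨η, hη, fun β' β'' h1 h2 => ?_⟩
    obtain ⟨⟨m1, d1⟩, i1⟩ := hη' (show dist β' β < η from h1)
    obtain ⟨⟨m2, d2⟩, i2⟩ := hη' (show dist β'' β < η from h2)
    refine ⟨i1, ?_⟩
    have hst := hs β hβ
    have hsin : 0 < sin (s β) :=
      sin_pos_of_pos_of_lt_pi hst.1 (by linarith [hst.2, hcr.lt, pi_pos])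
    have hd := congrArg cos (hiso _ m1 _ m2 d1 d2)
    rw [ConeDisk.dist_eq, cos_thirdSide, cos_sphDist, hPs, hrad β' _ hst m1, hrad β'' _ hst m2,
      hAeq β' i1 _ hst m1, hAeq β'' i2 _ hst m2, ← cos_abs (β' - β'')] at hd
    have hd' := mul_left_cancel₀ (mul_pos hsin hsin).ne' (add_left_cancel hd)
    have habs : |β' - β''| < π :=
      abs_lt.2 ⟨by linarith [i1.1, i2.2], by linarith [i1.2, i2.1]⟩
    have hgap := ConeDisk.gap_mem (D.lift e i (P (s β) β')) (D.lift e i (P (s β) β''))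
    rw [hAeq β' i1 _ hst m1, hAeq β'' i2 _ hst m2] at hgap
    have := injOn_cos hgap ⟨abs_nonneg _, habs.le⟩ hd'
    have hlt : min π (circDist (D.coneAngle (D.faceOf e i)) (A β') (A β'')) < π := by rwa [this]
    rwa [min_eq_right (min_lt_iff.1 hlt |>.resolve_left (lt_irrefl _)).le] at this

omit [CompactSpace X] in
lemma disks_ext {z z' : D.Disks} (h : z.1 = z'.1) (hr : z.2.rad = z'.2.rad)
    (ha : z.2.ang = z'.2.ang) : z = z' := by
  obtain ⟨f, y⟩ := z
  obtain ⟨f', y'⟩ := z'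
  obtain rfl : f = f' := h
  exact congrArg _ (ConeDisk.ext_of_rad_ang hr ha)

open MeasureTheory in
/-- The angles of the rays of a disk that end in a given bigon form an interval on the circle, up
to the cut of the circle, of the length of the sector. -/
lemma exists_sector (D : BigonPattern X E F) : ∃ I : E × Bool → Set ℝ,
    (∀ p, I p ⊆ Ioo 0 (D.coneAngle (D.faceOf p.1 p.2))) ∧ (∀ p, MeasurableSet (I p)) ∧
    (∀ p, volume (I p) = ENNReal.ofReal (2 * D.halfAngle p.1 p.2)) ∧
    (∀ f, ∀ φ ∈ D.coveredAngles f, φ ≠ 0 → ∃ p, D.faceOf p.1 p.2 = f ∧ φ ∈ I p) ∧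
    ∀ p q, D.faceOf p.1 p.2 = D.faceOf q.1 q.2 → p ≠ q → Disjoint (I p) (I q) := by
  choose P A hP hray hsurj hloc using fun p : E × Bool => D.exists_angle_map p.1 p.2
  -- rays of equal angle lie in the same bigon, as their outer parts are lifts of the same points
  have hmeet : ∀ p q, D.faceOf p.1 p.2 = D.faceOf q.1 q.2 →
      ∀ β ∈ Ioo (-D.halfAngle p.1 p.2) (D.halfAngle p.1 p.2),
      ∀ γ ∈ Ioo (-D.halfAngle q.1 q.2) (D.halfAngle q.1 q.2), A p β = A q γ →
      p = q ∧ ∃ t ∈ Ioo 0 (D.rad p.1 p.2), P p t β = P q t γ := by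
    intro p q hpq β hβ γ hγ hA
    obtain ⟨s, hs0, hs, h1⟩ := hray p β hβ
    obtain ⟨s', hs0', hs', h2⟩ := hray q γ hγ
    have hr : D.rad p.1 p.2 = D.rad q.1 q.2 := by rw [← radius_faceOf, hpq, radius_faceOf]
    have ht : max s s' < D.rad p.1 p.2 := max_lt hs (hr ▸ hs')
    obtain ⟨a1, a2, a3⟩ := h1 (max s s') (le_max_left _ _) ht
    obtain ⟨b1, b2, b3⟩ := h2 (max s s') (le_max_right _ _) (hr ▸ ht)
    obtain ⟨c1, c2, c3⟩ := eq_of_lift_eq a1 b1 (disks_ext (z := ⟨_, D.lift p.1 p.2 _⟩)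
      (z' := ⟨_, D.lift q.1 q.2 _⟩) hpq (a2.trans b2.symm) (a3.trans (hA.trans b3.symm)))
    exact ⟨Prod.ext c1 c2, _, ⟨hs0.trans_le (le_max_left _ _), ht⟩, c3⟩
  have hinj : ∀ p, InjOn (A p) (Ioo (-D.halfAngle p.1 p.2) (D.halfAngle p.1 p.2)) := by
    intro p β hβ γ hγ hA
    obtain ⟨-, t, ht, hPt⟩ := hmeet p p rfl β hβ γ hγ hA
    have h1 := hP p t β t γ
    rw [hPt, sdot_self] at h1
    have hsin : 0 < sin t := sin_pos_of_pos_of_lt_pi ht.1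
      (by linarith [ht.2, (D.crossing p.1 p.2).lt, pi_pos])
    have h2 := sin_sq_add_cos_sq t
    have h3 : sin t * sin t * (1 - cos (β - γ)) = 0 := by linarith
    have h4 : cos (β - γ) = 1 := by
      rcases mul_eq_zero.1 h3 with h3 | h3
      · exact absurd h3 (by positivity)
      · linarith
    have hφ := D.halfAngle_lt p.1 p.2
    have := (cos_eq_one_iff_of_lt_of_lt (by linarith [hβ.1, hγ.2, pi_pos])
      (by linarith [hβ.2, hγ.1, pi_pos])).1 h4
    linarith
  have hAmem : ∀ p, ∀ β ∈ Ioo (-D.halfAngle p.1 p.2) (D.halfAngle p.1 p.2),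
      A p β ∈ Ico 0 (D.coneAngle (D.faceOf p.1 p.2)) := by
    intro p β hβ
    obtain ⟨s, hs0, hs, h1⟩ := hray p β hβ
    rw [← (h1 s le_rfl hs).2.2]
    exact ConeDisk.ang_mem (D.coneAngle_pos _) _
  -- the angle `0`, at which the circle is cut, is removed
  let Z : E × Bool → Set ℝ := fun p =>
    {β ∈ Ioo (-D.halfAngle p.1 p.2) (D.halfAngle p.1 p.2) | A p β = 0}
  have hZ : ∀ p, (Z p).Subsingleton := fun p β hβ γ hγ =>
    hinj p hβ.1 hγ.1 (hβ.2.trans hγ.2.symm)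
  let U : E × Bool → Set ℝ := fun p => Ioo (-D.halfAngle p.1 p.2) (D.halfAngle p.1 p.2) \ Z p
  have hU : ∀ p, IsOpen (U p) := fun p => isOpen_Ioo.sdiff (hZ p).finite.isClosed
  have hApos : ∀ p, ∀ β ∈ U p, A p β ∈ Ioo 0 (D.coneAngle (D.faceOf p.1 p.2)) := by
    intro p β hβ
    have h1 := hAmem p β hβ.1
    exact ⟨h1.1.lt_of_ne fun h => hβ.2 ⟨hβ.1, h.symm⟩, h1.2⟩
  have hvol := fun p => volume_image_of_locally_isometric (A := A p) (hU p) (fun β hβ => by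
    obtain ⟨ε, hε, hiso⟩ := hloc p β hβ.1
    set m := min (A p β) (D.coneAngle (D.faceOf p.1 p.2) - A p β) / 2 with hm
    have hm0 : 0 < m := half_pos (lt_min (hApos p β hβ).1 (sub_pos.2 (hApos p β hβ).2))
    have hββ : |β - β| < min ε m := by simpa using lt_min hε hm0
    refine ⟨min ε m, lt_min hε hm0, fun x y hx hy => ?_⟩
    have key : ∀ x, |x - β| < min ε m → circDist _ (A p β) (A p x) < m := fun x hx => by
      rw [(hiso β x (hββ.trans_le (min_le_left _ _)) (hx.trans_le (min_le_left _ _))).2,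
        abs_sub_comm]
      exact hx.trans_le (min_le_right _ _)
    have hx' := hiso x y (hx.trans_le (min_le_left _ _)) (hy.trans_le (min_le_left _ _))
    have hy' := hiso y x (hy.trans_le (min_le_left _ _)) (hx.trans_le (min_le_left _ _))
    rw [← abs_sub_eq_of_circDist (hApos p β hβ) (hAmem p x hx'.1) (hAmem p y hy'.1) (key x hx)
      (key y hy)]
    exact hx'.2) ((hinj p).mono sdiff_subset)
  refine ⟨fun p => A p '' U p, ?_, fun p => (hvol p).1, fun p => ?_, ?_, ?_⟩
  · rintro p _ ⟨β, hβ, rfl⟩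
    exact hApos p β hβ
  · rw [(hvol p).2, measure_sdiff_null ((hZ p).finite.measure_zero _), Real.volume_Ioo]
    congr 1; ring
  · rintro f _ ⟨e, i, hf, x, hx, rfl⟩ hne
    obtain ⟨β, hβ, hA⟩ := hsurj (e, i) x hx
    exact ⟨(e, i), hf, β, ⟨hβ, fun h => hne (hA.trans h.2)⟩, hA.symm⟩
  · intro p q hpq hne
    rw [Set.disjoint_left]
    rintro _ ⟨β, hβ, rfl⟩ ⟨γ, hγ, hA⟩
    exact hne (hmeet p q hpq β hβ.1 γ hγ.1 hA.symm).1

open Classical MeasureTheory in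
/-- The cone angle of a disk is the sum of the angles of the sectors that its bigons span. -/
theorem coneAngle_eq_sum [Fintype E] (D : BigonPattern X E F) (f : F) :
    D.coneAngle f = ∑ p : E × Bool with D.faceOf p.1 p.2 = f, 2 * D.halfAngle p.1 p.2 := by
  obtain ⟨I, hI, hImeas, hIvol, hIcov, hIdisj⟩ := D.exists_sector
  set s : Finset (E × Bool) := Finset.univ.filter fun p => D.faceOf p.1 p.2 = f with hs
  have hmem : ∀ p ∈ s, D.faceOf p.1 p.2 = f := fun p hp => (Finset.mem_filter.1 hp).2
  have hvol : volume (Ioo 0 (D.coneAngle f)) = volume (⋃ p ∈ s, I p) := by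
    refine le_antisymm ?_ (measure_mono (iUnion₂_subset fun p hp => hmem p hp ▸ hI p))
    have hsub : Ioo 0 (D.coneAngle f) ⊆
        (⋃ p ∈ s, I p) ∪ (Ioo 0 (D.coneAngle f) \ D.coveredAngles f) := by
      intro φ hφ
      by_cases hc : φ ∈ D.coveredAngles f
      · obtain ⟨p, hp, hφI⟩ := hIcov f φ hc hφ.1.ne'
        exact Or.inl (mem_biUnion (Finset.mem_filter.2 ⟨Finset.mem_univ _, hp⟩) hφI)
      · exact Or.inr ⟨hφ, hc⟩
    calc volume (Ioo 0 (D.coneAngle f)) ≤ _ := measure_mono hsub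
      _ ≤ _ := measure_union_le _ _
      _ = _ := by rw [volume_diff_coveredAngles, add_zero]
  rw [measure_biUnion_finset (fun p hp q hq hpq => hIdisj p q ((hmem p hp).trans (hmem q hq).symm)
    hpq) fun p _ => hImeas p, Real.volume_Ioo, sub_zero, Finset.sum_congr rfl fun p _ => hIvol p,
    ← ENNReal.ofReal_sum_of_nonneg fun p _ => by
      have := D.halfAngle_pos p.1 p.2; positivity] at hvol
  exact (ENNReal.ofReal_eq_ofReal_iff (D.coneAngle_pos f).le (Finset.sum_nonneg fun p _ => by
    have := D.halfAngle_pos p.1 p.2; positivity)).1 hvol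

end BigonPattern
end CirclePatterns

namespace CirclePatterns

/-! ### Rays of a cone -/

/-- The ray of angle `φ` of a cone disk, as a map on the half-open interval of radii. -/
noncomputable def ConeDisk.ray {α : ℝ} (r : ℝ) {φ : ℝ} (hφ : φ ∈ Ico 0 α) (t : ℝ) :
    ConeDisk α r :=
  if h : 0 < t ∧ t < r then ConeDisk.mk t φ h.1 h.2 hφ else ConeDisk.apex α r

section Ray
variable {α r φ : ℝ} (hφ : φ ∈ Ico 0 α)
include hφ

lemma ConeDisk.rad_ray {t : ℝ} (ht : t ∈ Ico 0 r) : (ConeDisk.ray r hφ t).rad = t := by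
  rw [ConeDisk.ray]
  split_ifs with h
  · rfl
  · rw [ConeDisk.rad_apex]
    rcases ht.1.eq_or_lt with h0 | h0
    · exact h0
    · exact absurd ⟨h0, ht.2⟩ h

lemma ConeDisk.ang_ray {t : ℝ} (ht : t ∈ Ioo 0 r) : (ConeDisk.ray r hφ t).ang = φ := by
  have h : 0 < t ∧ t < r := ht
  rw [ConeDisk.ray, dif_pos h]; rfl

lemma ConeDisk.ray_zero : ConeDisk.ray r hφ 0 = ConeDisk.apex α r := by
  rw [ConeDisk.ray, dif_neg (by simp)]

lemma ConeDisk.continuousOn_ray [Fact (0 < α)] [hr : Fact (0 < r ∧ r ≤ π / 2)] :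
    ContinuousOn (ConeDisk.ray r hφ) (Ico 0 r) := by
  have hdist : ∀ s ∈ Ico 0 r, ∀ t ∈ Ico 0 r,
      dist (ConeDisk.ray r hφ s) (ConeDisk.ray r hφ t) = |s - t| := by
    intro s hs t ht
    have habs : |s - t| ≤ π := abs_le.2
      ⟨by linarith [hs.1, ht.2, hr.1.2, pi_pos], by linarith [ht.1, hs.2, hr.1.2, pi_pos]⟩
    rw [ConeDisk.dist_eq, ConeDisk.rad_ray hφ hs, ConeDisk.rad_ray hφ ht, thirdSide,
      ← arccos_cos (abs_nonneg (s - t)) habs, cos_abs, cos_sub]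
    congr 2
    rcases hs.1.eq_or_lt with h0 | h0
    · simp [← h0]
    rcases ht.1.eq_or_lt with h1 | h1
    · simp [← h1]
    rw [ConeDisk.ang_ray hφ ⟨h0, hs.2⟩, ConeDisk.ang_ray hφ ⟨h1, ht.2⟩]
    have : circDist α φ φ = 0 := by
      simp only [circDist, sub_self, abs_zero, sub_zero]
      exact min_eq_left (hφ.1.trans hφ.2.le)
    rw [this, min_eq_right pi_pos.le, cos_zero, mul_one]
  refine Metric.continuousOn_iff.2 fun s hs ε hε => ⟨ε, hε, fun t ht h => ?_⟩
  rwa [hdist t ht s hs]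

end Ray

namespace BigonPattern
variable {X E F : Type*} [MetricSpace X] [CompactSpace X] (D : BigonPattern X E F)

/-! ### The graph of a pattern -/

/-- A point of a disk is undominated if in every bigon that contains it, it has the greater power
with respect to this disk. The undominated points of a disk form the face of the graph of the
pattern that corresponds to the disk. -/
def IsUndominated (z : D.Disks) : Prop := ∀ e i, ∀ x ∈ D.region e,
  z = ⟨D.faceOf e i, D.lift e i x⟩ →
    cos (D.rad e i) * sdot (D.center e !i) x < cos (D.rad e !i) * sdot (D.center e i) x

variable {D}

/-- The undominated part of a disk is star-shaped. -/
lemma IsUndominated.ray {f : F} {y : ConeDisk (D.coneAngle f) (D.radius f)}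
    (h : D.IsUndominated ⟨f, y⟩) {t : ℝ} (ht : t ∈ Icc 0 y.rad) :
    D.IsUndominated ⟨f, ConeDisk.ray _ (y.ang_mem (D.coneAngle_pos f)) t⟩ := by
  intro e i x hx hz
  have hcr := D.crossing e i
  have hytlt := y.rad_lt (D.radius_pos f)
  have hf : f = D.faceOf e i := congrArg Sigma.fst hz
  obtain ⟨h0, h1, w, hw⟩ := hcr.exists_arc_of_mem (D.region_eq e i ▸ hx)
  have hrad : t = sphDist (D.center e i) x := by
    rw [← rad_lift hx i, ← ConeDisk.rad_ray (y.ang_mem (D.coneAngle_pos f))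
      ⟨ht.1, ht.2.trans_lt hytlt⟩]
    exact congrArg (fun z : D.Disks => z.2.rad) hz
  rw [← hrad] at h0 h1 hw
  have hang : y.ang = (D.lift e i x).ang := by
    rw [← ConeDisk.ang_ray (y.ang_mem (D.coneAngle_pos f)) ⟨h0, ht.2.trans_lt hytlt⟩]
    exact congrArg (fun z : D.Disks => z.2.ang) hz
  have hyr : y.rad < D.rad e i := by rw [← radius_faceOf, ← hf]; exact hytlt
  obtain ⟨hmem, hang'⟩ := ang_lift_arc w h0 ht.2 hyr (hw ▸ hx)
  have hlt := h e i _ hmem (disks_ext hf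
    (by rw [rad_lift hmem, sphDist_center_arc w y.rad_nonneg (hyr.le.trans hcr.lt_pi)])
    (by rw [hang', hw]; exact hang))
  by_contra! hle
  refine absurd (hcr.power_mono w h0 ht.2 (by linarith [hcr.lt]) ?_) (not_le.2 hlt)
  rwa [hw]

/-- The diagonals `diag e` of the bigons are edges of a graph whose vertices are the points missed
by the pattern, and the disk of `f : F` corresponds to the face `V f` of this graph. -/
structure IsGraph (D : BigonPattern X E F) (diag : E → Set Sphere2) (V : F → Set X) : Prop where
  subset_region : ∀ e, diag e ⊆ D.region e
  power_eq : ∀ e i, ∀ x ∈ diag e,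
    cos (D.rad e !i) * sdot (D.center e i) x = cos (D.rad e i) * sdot (D.center e !i) x
  nonempty : ∀ e, (diag e).Nonempty
  isOpen : ∀ f, IsOpen (V f)
  disjoint : ∀ f g, f ≠ g → Disjoint (V f) (V g)
  apex_mem : ∀ f, D.immersion f (ConeDisk.apex _ _) ∈ V f
  subset_of_isPreconnected : ∀ f (s : Set X), IsPreconnected s → (s ∩ V f).Nonempty →
    (∀ q ∈ s, q ∈ range D.map ∧ ∀ e, q ∉ D.chart e '' diag e) → s ⊆ V f

variable {diag : E → Set Sphere2} {V : F → Set X}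

/-- The undominated part of a disk is star-shaped about the apex and does not meet the edges, so it
lies in the face of the apex. -/
lemma IsGraph.mem_of_isUndominated (h : D.IsGraph diag V) {f : F}
    {y : ConeDisk (D.coneAngle f) (D.radius f)} (hy : D.IsUndominated ⟨f, y⟩) :
    D.immersion f y ∈ V f := by
  have hφ := y.ang_mem (D.coneAngle_pos f)
  have hlt := y.rad_lt (D.radius_pos f)
  have hend : ConeDisk.ray (D.radius f) hφ y.rad = y := by
    rcases y.rad_nonneg.eq_or_lt with h0 | h0
    · rw [← h0, ConeDisk.ray_zero]; exact (ConeDisk.eq_apex_of_rad_eq_zero h0.symm).symm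
    · exact ConeDisk.ext_of_rad_ang (ConeDisk.rad_ray hφ ⟨y.rad_nonneg, hlt⟩)
        (ConeDisk.ang_ray hφ ⟨h0, hlt⟩)
  have hpre : IsPreconnected
      ((fun t => D.immersion f (ConeDisk.ray (D.radius f) hφ t)) '' Icc 0 y.rad) := by
    refine isPreconnected_Icc.image _ ((D.continuous_immersion f).comp_continuousOn
      ((ConeDisk.continuousOn_ray hφ).mono fun t ht => ⟨ht.1, ht.2.trans_lt hlt⟩))
  refine h.subset_of_isPreconnected f _ hpre ⟨_, ⟨0, ⟨le_rfl, y.rad_nonneg⟩, rfl⟩, ?_⟩ ?_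
    ⟨y.rad, ⟨y.rad_nonneg, le_rfl⟩, congrArg (D.immersion f) hend⟩
  · simp only [ConeDisk.ray_zero]
    exact h.apex_mem f
  · rintro _ ⟨t, ht, rfl⟩
    refine ⟨⟨⟨f, _⟩, rfl⟩, fun e => ?_⟩
    rintro ⟨x, hx, hxe⟩
    have hxR := h.subset_region e hx
    obtain ⟨i, hi⟩ := exists_eq_lift hxR (z := ⟨f, _⟩) hxe.symm
    exact absurd (h.power_eq e i x hx) (hy.ray ht e i x hxR hi).ne'

/-- A point of a bigon with the greater power with respect to the disk on side `i` belongs to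
the face of this disk. -/
lemma IsGraph.chart_mem (h : D.IsGraph diag V) {e : E} {i : Bool} {x : Sphere2}
    (hx : x ∈ D.region e) (hlt : cos (D.rad e i) * sdot (D.center e !i) x <
      cos (D.rad e !i) * sdot (D.center e i) x) : D.chart e x ∈ V (D.faceOf e i) := by
  rw [← immersion_lift hx i]
  refine h.mem_of_isUndominated fun e' i' x' hx' hz => ?_
  obtain ⟨rfl, rfl, rfl⟩ := eq_of_lift_eq hx hx' hz
  exact hlt

/-- The edge of a bigon is adjacent to the faces of both disks of the bigon. -/
lemma IsGraph.closure_inter_nonempty (h : D.IsGraph diag V) (e : E) (i : Bool) :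
    (closure (V (D.faceOf e i)) ∩ D.chart e '' diag e).Nonempty := by
  obtain ⟨x, hx⟩ := h.nonempty e
  have hxR := h.subset_region e hx
  have hcr := D.crossing e i
  refine ⟨D.chart e x, ?_, mem_image_of_mem _ hx⟩
  obtain ⟨h0, h1, w, hw⟩ := hcr.exists_arc_of_mem (D.region_eq e i ▸ hxR)
  set ρ := sphDist (D.center e i) x
  have hlim : Tendsto (fun t => arc (D.center e i) w t) (𝓝[<] ρ) (𝓝 x) := by
    have := (continuous_arc w).tendsto ρ
    rw [hw] at this
    exact this.mono_left nhdsWithin_le_nhds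
  refine mem_closure_of_tendsto ((tendsto_chart hxR).comp hlim) ?_
  filter_upwards [hlim ((D.isOpen_region e).mem_nhds hxR), Ioo_mem_nhdsLT h0] with t ht ht'
  refine h.chart_mem ht (hcr.power_strict w ht'.1.le ht'.2 (h1.trans hcr.lt) ?_)
  rw [hw]
  exact h.power_eq e i x hx

/-- The edge of a bigon is adjacent to the faces of the two disks of the bigon only. -/
lemma IsGraph.exists_eq_faceOf (h : D.IsGraph diag V) {e : E} {f : F}
    (hf : (closure (V f) ∩ D.chart e '' diag e).Nonempty) : ∃ i, D.faceOf e i = f := by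
  by_contra! hne
  obtain ⟨_, hcl, x₀, hx₀, rfl⟩ := hf
  have hx₀R := h.subset_region e hx₀
  obtain ⟨ε, hε, -, hsurj⟩ := D.chart_isometric e x₀ hx₀R
  obtain ⟨q, hqV, hq⟩ := Metric.mem_closure_iff.1 hcl ε hε
  obtain ⟨x, hx, -, rfl⟩ := hsurj q hq
  have hcr : CrossingDisks (D.center e true) (D.center e false) (D.rad e true) (D.rad e false) :=
    D.crossing e true
  have hzero : cos (D.rad e false) • (D.center e true : Space3) -
      cos (D.rad e true) • (D.center e false : Space3) = 0 := by
    refine eq_zero_of_eventually_inner_eq_zero (x := x) ?_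
    filter_upwards [(D.isOpen_region e).mem_nhds hx, tendsto_chart hx ((h.isOpen f).mem_nhds hqV)]
      with x' hx' hV
    have hnot : ∀ i, ¬ cos (D.rad e i) * sdot (D.center e !i) x' <
        cos (D.rad e !i) * sdot (D.center e i) x' := fun i hlt =>
      disjoint_left.1 (h.disjoint _ _ (hne i)) (h.chart_mem hx' hlt) hV
    have h1 := not_lt.1 (hnot true)
    have h2 := not_lt.1 (hnot false)
    rw [inner_sub_left, real_inner_smul_left, real_inner_smul_left]
    exact sub_eq_zero.2 (le_antisymm h1 h2)
  have heq := sub_eq_zero.1 hzero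
  have hn := congrArg norm heq
  rw [norm_smul, norm_smul, Sphere2.norm_eq, Sphere2.norm_eq, mul_one, mul_one,
    norm_of_nonneg hcr.symm.cos_pos.le, norm_of_nonneg hcr.cos_pos.le] at hn
  rw [show cos (D.rad e false) = cos (D.rad e true) from hn] at heq
  exact hcr.ne (Subtype.ext (smul_right_injective _ hcr.cos_pos.ne' heq))

end BigonPattern
end CirclePatterns

namespace CirclePatterns

/-! ### The bigons of a realization -/

namespace Bigon

/-- The centres of the two disks of a bigon. -/
def center (b : Bigon) : Bool → Sphere2
  | true => b.o₁
  | false => b.o₂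

/-- The radii of the two disks of a bigon. -/
def rad (b : Bigon) : Bool → ℝ
  | true => b.r₁
  | false => b.r₂

variable (b : Bigon)

lemma rad_pos : ∀ i, 0 < b.rad i
  | true => b.r₁_pos
  | false => b.r₂_pos

lemma rad_lt : ∀ i, b.rad i < π / 2
  | true => b.r₁_lt
  | false => b.r₂_lt

lemma sdot_center_v (i : Bool) : sdot (b.center i) b.v = cos (b.rad i) := by
  rw [← cos_sphDist]
  cases i
  · exact congrArg cos b.dist_o₂_v
  · exact congrArg cos b.dist_o₁_v

lemma sdot_center_v' (i : Bool) : sdot (b.center i) b.v' = cos (b.rad i) := by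
  rw [← cos_sphDist]
  cases i
  · exact congrArg cos b.dist_o₂_v'
  · exact congrArg cos b.dist_o₁_v'

lemma region_eq (i : Bool) :
    b.region = sphDisk (b.center i) (b.rad i) ∩ sphDisk (b.center !i) (b.rad !i) := by
  cases i
  · exact inter_comm _ _
  · rfl

variable {b} {θ : ℝ} (hb : b.angle = θ)
include hb

/-- The spherical law of cosines for the triangle formed by the two centres and a vertex. -/
lemma sdot_center (i : Bool) : sdot (b.center i) (b.center !i) =
    cos (b.rad i) * cos (b.rad !i) - sin (b.rad i) * sin (b.rad !i) * cos θ := by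
  have key : sdot b.o₁ b.o₂ = cos b.r₁ * cos b.r₂ - sin b.r₁ * sin b.r₂ * cos θ := by
    have h1 : inner ℝ (b.o₁ : Space3) b.v = cos b.r₁ := b.sdot_center_v true
    have h2 : inner ℝ (b.o₂ : Space3) b.v = cos b.r₂ := b.sdot_center_v false
    have hs₁ : 0 ≤ sin b.r₁ :=
      (sin_pos_of_pos_of_lt_pi b.r₁_pos (by linarith [b.r₁_lt, pi_pos])).le
    have hs₂ : 0 ≤ sin b.r₂ :=
      (sin_pos_of_pos_of_lt_pi b.r₂_pos (by linarith [b.r₂_lt, pi_pos])).le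
    have hang : sphAngle b.v b.o₁ b.o₂ = π - θ := by rw [← hb, angle]; ring
    have h3 := InnerProductGeometry.cos_angle_mul_norm_mul_norm
      (tangentTo (b.v : Space3) b.o₁) (tangentTo (b.v : Space3) b.o₂)
    rw [norm_tangentTo _ _ b.v.norm_eq b.o₁.norm_eq, norm_tangentTo _ _ b.v.norm_eq b.o₂.norm_eq,
      inner_tangentTo _ _ _ b.v.norm_eq, h1, h2, ← sin_sq, ← sin_sq, sqrt_sq hs₁, sqrt_sq hs₂,
      ← sphAngle, hang, cos_pi_sub] at h3
    rw [sdot]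
    linarith
  cases i
  · rw [sdot_comm]
    refine key.trans ?_
    simp only [rad, Bool.not_false]
    ring
  · exact key

variable (hθ : 0 < θ) (hθ' : θ ≤ π / 2)
include hθ hθ'

lemma crossingDisks (i : Bool) :
    CrossingDisks (b.center i) (b.center !i) (b.rad i) (b.rad !i) := by
  have hs : ∀ i, 0 < sin (b.rad i) := fun i =>
    sin_pos_of_pos_of_lt_pi (b.rad_pos i) (by linarith [b.rad_lt i, pi_pos])
  have h0 := mul_pos (hs i) (hs !i)
  refine ⟨b.rad_pos i, b.rad_lt i, b.rad_pos _, b.rad_lt _, ?_, ?_⟩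
  · rw [sdot_center hb]
    have := cos_nonneg_of_bigon hθ hθ'
    nlinarith
  · rw [sdot_center hb, cos_add]
    have : cos θ < cos 0 := cos_lt_cos_of_nonneg_of_le_pi le_rfl (by linarith [pi_pos]) hθ
    rw [cos_zero] at this
    nlinarith

omit hb hθ hθ' in
lemma diagonal_nonempty : b.diagonal.Nonempty := by
  have h1 : 0 < ‖(b.v : Space3) + b.v'‖ := by
    refine norm_pos_iff.2 fun h0 => ?_
    have h2 : inner ℝ (b.o₁ : Space3) ((b.v : Space3) + b.v') = 2 * cos b.r₁ := by
      rw [inner_add_right]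
      have h3 : inner ℝ (b.o₁ : Space3) b.v = cos b.r₁ := b.sdot_center_v true
      have h4 : inner ℝ (b.o₁ : Space3) b.v' = cos b.r₁ := b.sdot_center_v' true
      rw [h3, h4]; ring
    rw [h0, inner_zero_right] at h2
    have : 0 < cos b.r₁ := cos_pos_of_mem_Ioo ⟨by linarith [b.r₁_pos, pi_pos], b.r₁_lt⟩
    linarith
  refine ⟨⟨‖(b.v : Space3) + b.v'‖⁻¹ • ((b.v : Space3) + b.v'), ?_⟩,
    ‖(b.v : Space3) + b.v'‖⁻¹, ‖(b.v : Space3) + b.v'‖⁻¹, inv_pos.2 h1, inv_pos.2 h1, smul_add _ _ _⟩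
  rw [mem_sphere_zero_iff_norm, norm_smul, norm_inv, norm_norm, inv_mul_cancel₀ h1.ne']

omit hb hθ hθ' in
lemma diagonal_subset : b.diagonal ⊆ b.region := by
  rintro x ⟨s, t, hs, ht, hx⟩
  have hst : 1 < s + t := by
    have h1 : sdot b.v b.v' < 1 :=
      lt_of_le_of_ne (sdot_le_one _ _) fun h => b.v_ne (eq_of_sdot_eq_one h)
    have h2 := sdot_of_coe_eq x hx
    rw [sdot_self, sdot_comm x, sdot_comm x, sdot_of_coe_eq _ hx, sdot_of_coe_eq _ hx,
      sdot_self, sdot_self, sdot_comm b.v' b.v] at h2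
    have h3 : 1 < (s + t) * (s + t) := by nlinarith [mul_pos hs ht]
    by_contra! hle
    nlinarith
  have hmem : ∀ i, x ∈ sphDisk (b.center i) (b.rad i) := fun i => by
    have hc : 0 < cos (b.rad i) :=
      cos_pos_of_mem_Ioo ⟨by linarith [b.rad_pos i, pi_pos], b.rad_lt i⟩
    rw [mem_sphDisk (b.rad_pos i).le (by linarith [b.rad_lt i, pi_pos]), sdot_of_coe_eq _ hx,
      sdot_center_v, sdot_center_v']
    nlinarith
  exact ⟨hmem true, hmem false⟩

omit hb hθ hθ' in
lemma power_eq_of_mem_diagonal {x : Sphere2} (hx : x ∈ b.diagonal) (i : Bool) :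
    cos (b.rad !i) * sdot (b.center i) x = cos (b.rad i) * sdot (b.center !i) x := by
  obtain ⟨s, t, hs, ht, hx⟩ := hx
  rw [sdot_of_coe_eq _ hx, sdot_of_coe_eq _ hx, sdot_center_v, sdot_center_v', sdot_center_v,
    sdot_center_v']
  ring

end Bigon

/-- The half angle of a sector as a function of the two radii and the angle of the bigon, by
spherical trigonometry in the triangle formed by the two centres and a vertex. -/
lemma BigonPattern.halfAngle_eq {X E F : Type*} [MetricSpace X] (D : BigonPattern X E F) {e : E}
    {b : Bigon} {θ : ℝ} (hb : b.angle = θ) (hθ : 0 < θ) (hθ' : θ ≤ π / 2)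
    (hc : ∀ i, D.center e i = b.center i) (hr : ∀ i, D.rad e i = b.rad i) (i : Bool) :
    D.halfAngle e i = arctan (sin θ * sin (D.rad e !i) /
      (sin (D.rad e i) * cos (D.rad e !i) + cos (D.rad e i) * sin (D.rad e !i) * cos θ)) := by
  have hv : ∀ i, inner ℝ (b.v : Space3) (b.center i) = cos (b.rad i) := fun i => by
    rw [real_inner_comm]; exact b.sdot_center_v i
  have hcr := D.crossing e i
  rw [hr, hr, ← sphAngle_eq_arctan (b.center i).norm_eq b.v.norm_eq (b.center !i).norm_eq
    (b.rad_pos i) (b.rad_lt i) (b.rad_pos _) (b.rad_lt _) hθ hθ' (hv i) (hv !i)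
    (by rw [real_inner_comm]; exact Bigon.sdot_center hb i),
    sphAngle, InnerProductGeometry.angle, inner_tangentTo _ _ _ (b.center i).norm_eq,
    norm_tangentTo _ _ (b.center i).norm_eq b.v.norm_eq,
    norm_tangentTo _ _ (b.center i).norm_eq (b.center !i).norm_eq, hv, hv]
  have h1 : inner ℝ (b.center !i : Space3) (b.center i) = sdot (D.center e !i) (D.center e i) := by
    rw [hc, hc]; rfl
  have h2 : √(1 - sdot (D.center e !i) (D.center e i) ^ 2) =
      sin (sphDist (D.center e i) (D.center e !i)) := by
    rw [sdot_comm, ← cos_sphDist, ← sin_sq, sqrt_sq (D.sin_dist_pos e i).le]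
  rw [h1, h2, ← hr, ← hr, ← sin_sq, sqrt_sq hcr.sin_pos.le, halfAngle]

/-! ### The cone angles of a realization -/

open Classical in
/-- In a realization of a graph, the two disks of a bigon are those of the two faces on the sides of
the corresponding edge, and the cone angle of a disk is the sum of the angles of the sectors
spanned by its bigons. -/
theorem Realization.exists_sides {S E F : Type*} [t : TopologicalSpace S] [CompactSpace S]
    [LocallyConnectedSpace S] [Fintype E] [Nonempty E] {G : CellularGraph S E F} {θ : E → ℝ}
    (hθ : ∀ e, 0 < θ e ∧ θ e ≤ π / 2) (P : Realization G θ) :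
    ∃ g : E → Bool → F, (∀ e, range (g e) = range (G.side e)) ∧
      ∀ f, P.pattern.coneAngle f = ∑ p : E × Bool with g p.1 p.2 = f,
        2 * arctan (sin (θ p.1) * sin (P.pattern.radius (g p.1 !p.2)) /
          (sin (P.pattern.radius (g p.1 p.2)) * cos (P.pattern.radius (g p.1 !p.2)) +
          cos (P.pattern.radius (g p.1 p.2)) * sin (P.pattern.radius (g p.1 !p.2)) *
            cos (θ p.1))) := by
  obtain ⟨⟨M, hM, hcon⟩, pat, b, chart, hchart, hinj, hangle, hcomp, hcompinj, hcompsurj, homeo, -,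
    hvert, hedge, hcenter⟩ := P
  subst hM
  obtain ⟨q₀, -⟩ := hcomp (Classical.arbitrary E)
  -- the chart of a bigon is extended to the sphere by an arbitrary value
  let chart' : E → Sphere2 → S := fun e x => if h : x ∈ (b e).region then chart e ⟨x, h⟩ else q₀
  have hch : ∀ e x (h : x ∈ (b e).region), chart' e x = chart e ⟨x, h⟩ := fun e x h => dif_pos h
  have himg : ∀ e, chart' e '' (b e).region = range (chart e) := by
    intro e
    ext q
    constructor
    · rintro ⟨x, hx, rfl⟩
      exact ⟨⟨x, hx⟩, (hch e x hx).symm⟩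
    · rintro ⟨⟨x, hx⟩, rfl⟩
      exact ⟨x, hx, hch e x hx⟩
  let D : BigonPattern S E F :=
    { coneAngle := pat.coneAngle
      radius := pat.radius
      coneAngle_pos := pat.coneAngle_pos
      radius_pos := pat.radius_pos
      radius_lt := pat.radius_lt
      immersion := pat.immersion
      isLocalIsometry := pat.isLocalIsometry
      finite_missed := pat.finite_missed
      two_to_one := pat.two_to_one
      exists_isConicalBall := fun p => by
        obtain ⟨α, ε, hα, hε, hε', φ, h⟩ := hcon p
        exact ⟨ε, α, hα, hε, hε', φ, h⟩
      center := fun e => (b e).center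
      rad := fun e => (b e).rad
      crossing := fun e => Bigon.crossingDisks (hangle e) (hθ e).1 (hθ e).2
      region := fun e => (b e).region
      region_eq := fun e => (b e).region_eq
      chart := chart'
      chart_isometric := fun e p hp => by
        obtain ⟨ε, hε, h1, h2⟩ := hchart e ⟨p, hp⟩
        refine ⟨ε, hε, fun x hx y hy hpx hpy => ?_, fun z hz => ?_⟩
        · rw [hch e x hx, hch e y hy]
          exact h1 ⟨x, hx⟩ ⟨y, hy⟩ hpx hpy
        · rw [hch e p hp] at hz
          obtain ⟨⟨x, hx⟩, hd, he⟩ := h2 z hz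
          exact ⟨x, hx, hd, (hch e x hx).trans he⟩
      chart_injOn := fun e x hx y hy h => by
        rw [hch e x hx, hch e y hy] at h
        exact congrArg Subtype.val (hinj e h)
      overlap := pat.overlap
      overlap_eq := rfl
      component := fun e => by rw [himg]; exact hcomp e
      component_injective := fun e e' h => hcompinj e e' (by rwa [himg, himg] at h)
      component_surjective := fun q hq => by
        obtain ⟨e, he⟩ := hcompsurj q hq
        exact ⟨e, by rwa [himg]⟩ }
  have hdiag : ∀ e, homeo '' (chart' e '' (b e).diagonal) = G.openEdge e := by
    intro e
    rw [← hedge e]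
    congr 1
    ext q
    constructor
    · rintro ⟨x, hx, rfl⟩
      exact ⟨⟨x, Bigon.diagonal_subset hx⟩, hx, (hch e x _).symm⟩
    · rintro ⟨⟨x, hxR⟩, hx, rfl⟩
      exact ⟨x, hx, hch e x hxR⟩
  have hgraph : D.IsGraph (fun e => (b e).diagonal) fun f => homeo ⁻¹' G.face f := by
    refine ⟨fun e => Bigon.diagonal_subset, fun e i x hx => Bigon.power_eq_of_mem_diagonal hx i,
      fun e => Bigon.diagonal_nonempty, fun f => (G.isOpen_face f).preimage homeo.continuous,
      fun f g hfg => ?_, hcenter, fun f s hs hsf hno => ?_⟩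
    · exact Set.disjoint_left.2 fun q hf hg => hfg (G.face_unique hf hg)
    · obtain ⟨q, hqs, hqf⟩ := hsf
      rw [← image_subset_iff]
      refine G.subset_face (hs.image _ homeo.continuous.continuousOn) ?_ (mem_image_of_mem _ hqs) hqf
      rintro _ ⟨q', hq', rfl⟩ hsup
      obtain ⟨⟨z, hz⟩, hnd⟩ := hno q' hq'
      rw [EmbeddedGraph.support_eq] at hsup
      rcases hsup with hsup | hsup
      · rw [← hvert] at hsup
        obtain ⟨q'', hq'', he⟩ := hsup
        rw [homeo.injective he] at hq''
        exact hq'' (mem_iUnion.2 ⟨z.1, z.2, hz⟩)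
      · obtain ⟨e, he⟩ := mem_iUnion.1 hsup
        rw [← hdiag e] at he
        obtain ⟨q'', hq'', he⟩ := he
        rw [homeo.injective he] at hq''
        exact hnd e hq''
  refine ⟨D.faceOf, fun e => ?_, fun f => ?_⟩
  · ext f
    have h1 : (closure (homeo ⁻¹' G.face f) ∩ chart' e '' (b e).diagonal).Nonempty ↔
        ∃ s, G.side e s = f := by
      rw [G.side_spec, ← hdiag e, ← homeo.preimage_closure]
      constructor
      · rintro ⟨q, hq, hq'⟩
        exact ⟨homeo q, hq, mem_image_of_mem _ hq'⟩
      · rintro ⟨_, hq, q, hq', rfl⟩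
        exact ⟨q, hq, hq'⟩
    rw [mem_range, mem_range, ← h1]
    constructor
    · rintro ⟨i, rfl⟩
      exact hgraph.closure_inter_nonempty e i
    · exact hgraph.exists_eq_faceOf
  · refine (D.coneAngle_eq_sum f).trans (Finset.sum_congr rfl fun p _ => ?_)
    rw [D.halfAngle_eq (hangle p.1) (hθ p.1).1 (hθ p.1).2 (fun _ => rfl) (fun _ => rfl),
      ← D.radius_faceOf, ← D.radius_faceOf]

/-! ### Critical points -/

lemma radiusOf_log_cot {r : ℝ} (hr : 0 < r) (hr' : r < π / 2) : radiusOf (log (cot r)) = r := by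
  have hs : 0 < sin r := sin_pos_of_pos_of_lt_pi hr (by linarith [pi_pos])
  have hc : 0 < cos r := cos_pos_of_mem_Ioo ⟨by linarith [pi_pos], hr'⟩
  have hcot : 0 < cot r := by rw [cot_eq_cos_div_sin]; positivity
  rw [radiusOf, exp_neg, exp_log hcot, cot_eq_cos_div_sin, inv_div, ← tan_eq_sin_div_cos,
    arctan_tan (by linarith [pi_pos]) hr']

/-- A sum over the two ends does not depend on which end is called the first. -/
lemma sum_bool_eq_of_range_eq {F M : Type*} [AddCommMonoid M] {u v : Bool → F}
    (h : range u = range v) (φ : F → F → M) :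
    ∑ i, φ (u i) (u !i) = ∑ i, φ (v i) (v !i) := by
  have h1 : ∀ i, ∃ j, v j = u i := fun i => by rw [← mem_range, ← h]; exact ⟨i, rfl⟩
  have h2 : ∀ i, ∃ j, u j = v i := fun i => by rw [← mem_range, h]; exact ⟨i, rfl⟩
  simp only [Bool.exists_bool, Bool.forall_bool] at h1 h2
  simp only [Fintype.sum_bool, Bool.not_true, Bool.not_false]
  obtain ⟨h1f, h1t⟩ := h1
  obtain ⟨h2f, h2t⟩ := h2
  by_cases hu : u true = v true
  · have hf : u false = v false := by grind
    rw [hu, hf]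
  · have hu' : u true = v false := by grind
    have hf : u false = v true := by grind
    rw [hu', hf, add_comm]

open Classical in
/-- The boundary of a disk is made up of the sides of its bigons, which are those of the edges
around the corresponding face. -/
lemma Realization.totalCurvature_eq {S E F : Type*} [TopologicalSpace S] [CompactSpace S]
    [LocallyConnectedSpace S] [Fintype E] [Nonempty E] {G : CellularGraph S E F} {θ : E → ℝ}
    (hθ : ∀ e, 0 < θ e ∧ θ e ≤ π / 2) (P : Realization G θ) {K : F → ℝ}
    (hK : ∀ f, P.pattern.logCurvature f = K f) (f : F) :
    P.pattern.totalCurvature f = ∑ e, ∑ i, if G.side e i = f then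
      sideCurvature (θ e) (K (G.side e i)) (K (G.side e !i)) else 0 := by
  obtain ⟨g, hg, hα⟩ := P.exists_sides hθ
  have hr : ∀ f, P.pattern.radius f = radiusOf (K f) := fun f => by
    rw [← hK f]
    exact (radiusOf_log_cot (P.pattern.radius_pos f) (P.pattern.radius_lt f)).symm
  rw [CirclePattern.totalCurvature, CirclePattern.boundaryLength,
    cot_mul_sin (P.pattern.radius_pos f) (P.pattern.radius_lt f), hα, Finset.mul_sum,
    Finset.sum_filter, Fintype.sum_prod_type]
  refine Finset.sum_congr rfl fun e _ => ?_
  rw [← sum_bool_eq_of_range_eq (hg e) fun a c =>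
    if a = f then sideCurvature (θ e) (K a) (K c) else 0]
  refine Finset.sum_congr rfl fun i _ => ?_
  split_ifs with h
  · rw [← cos_mul_two_arctan_radiusOf, ← hr, ← hr, h]
  · rfl

/-- The partial derivative of `omega` for the face `f` is the total geodesic curvature of the disk
of `f` minus `T f`. -/
lemma hasFDerivAt_omega_zero_iff {S E F : Type*} [TopologicalSpace S] [CompactSpace S]
    [LocallyConnectedSpace S] [Fintype E] [Nonempty E] [Fintype F] (G : CellularGraph S E F) {θ : E → ℝ}
    (hθ : ∀ e, 0 < θ e ∧ θ e ≤ π / 2) (T : F → ℝ) (P : Realization G θ) {K : F → ℝ}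
    (hK : ∀ f, P.pattern.logCurvature f = K f) :
    HasFDerivAt (omega G θ T) (0 : (F → ℝ) →L[ℝ] ℝ) K ↔
      ∀ f, P.pattern.totalCurvature f = T f := by
  classical
  have hd := hasFDerivAt_omega G θ T hθ K
  have hsingle : ∀ f, omegaDeriv G θ T K (Pi.single f 1) = P.pattern.totalCurvature f - T f := by
    intro f
    rw [omegaDeriv_apply, P.totalCurvature_eq hθ hK]
    congr 1
    · refine Finset.sum_congr rfl fun e _ => ?_
      rw [bigonForm_apply, Fintype.sum_bool]
      simp [Pi.single_apply]
    · simp [Pi.single_apply]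
  have hzero : omegaDeriv G θ T K = 0 ↔ ∀ f, omegaDeriv G θ T K (Pi.single f 1) = 0 := by
    refine ⟨fun h f => by rw [h]; rfl, fun h => ?_⟩
    refine ContinuousLinearMap.coe_injective ((Pi.basisFun ℝ F).ext fun f => ?_)
    simpa using h f
  simp only [hsingle, sub_eq_zero] at hzero
  rw [← hzero]
  exact ⟨fun h => hd.unique h, fun h => h ▸ hd⟩

end CirclePatterns

theorem proposition4 {S E F : Type*} [TopologicalSpace S] [CompactSpace S] [T2Space S]
    [ConnectedSpace S] [ChartedSpace (EuclideanSpace ℝ (Fin 2)) S]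
    [Fintype E] [Nonempty E] [Fintype F]
    (G : CirclePatterns.CellularGraph S E F)
    (θ : E → ℝ) (hθ : ∀ e, 0 < θ e ∧ θ e ≤ π / 2)
    (T : F → ℝ) (hT : ∀ f, 0 < T f) :
    -- `Ω` is a strictly convex `C¹` function
    StrictConvexOn ℝ univ (CirclePatterns.omega G θ T) ∧
    ContDiff ℝ 1 (CirclePatterns.omega G θ T) ∧
    -- critical points of `Ω` and patterns with prescribed total geodesic curvatures
    (∀ (K : F → ℝ) (P : CirclePatterns.Realization G θ),
      (∀ f, P.pattern.logCurvature f = K f) →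
        (HasFDerivAt (CirclePatterns.omega G θ T) (0 : (F → ℝ) →L[ℝ] ℝ) K ↔
          ∀ f, P.pattern.totalCurvature f = T f)) ∧
    -- properness, in the sense that `Ω` tends to `+∞` at infinity
    (Tendsto (CirclePatterns.omega G θ T) (cocompact (F → ℝ)) atTop ↔
      CirclePatterns.SubsetInequalities G θ T) ∧
    -- if there are at least two faces, this is properness of `Ω` as a continuous map to `ℝ`
    (2 ≤ Fintype.card F →
      (IsProperMap (CirclePatterns.omega G θ T) ↔
        CirclePatterns.SubsetInequalities G θ T)) := by
  have : LocallyConnectedSpace S :=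
    ChartedSpace.locallyConnectedSpace (EuclideanSpace ℝ (Fin 2)) S
  have hside : ∀ f, ∃ e s, G.side e s = f := G.exists_side_eq
  have hconv := CirclePatterns.strictConvexOn_omega G θ T hθ hside
  have hdiff := CirclePatterns.contDiff_omega G θ T hθ
  have hlim := CirclePatterns.tendsto_omega_iff G θ T hθ hT hside
  refine ⟨hconv, hdiff, fun K P hK => CirclePatterns.hasFDerivAt_omega_zero_iff G hθ T P hK, hlim,
    fun hF => ?_⟩
  rw [CirclePatterns.isProperMap_iff_tendsto_atTop hconv.convexOn hdiff.continuous
    (by rwa [Module.finrank_fintype_fun_eq_card]), hlim]
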